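/- Let $\mathfrak g$ be a finite-dimensional complex Lie algebra, $\mathfrak h\subset\mathfrak g$ a Lie subalgebra with basis $(e_i)$, $\lambda_i=\lambda(e_i)$ the corresponding coordinates on $\mathfrak h^*$ and $\partial_i=\partial/\partial\lambda_i$, and $t\in S^2(\mathfrak g)^{\mathfrak g}$. Write $U=U(\mathfrak g)$, with its usual coproduct $\Delta_0$ and counit $\varepsilon$; superscripts indicate in which tensor slots the legs of a tensor are placed, a superscript such as $12$ for one leg meaning that its coproduct is put in slots $1,2$. Let $\mathrm{Mer}(\mathfrak h^*,V)$ be the space of meromorphic functions on $\mathfrak h^*$ with values in a finite-dimensional subspace of $V$. Let $*$ be the PBW star-product on functions on $\mathfrak h^*$: on polynomials it is the product of $U(\mathfrak h_\hbar)$, where $[x,y]_{\mathfrak h_\hbar}=\hbar[x,y]$, transported by symmetrization $S(\mathfrak h)[[\hbar]]\cong U(\mathfrak h_\hbar)$, and its coefficients are bidifferential operators, so that it extends to meromorphic functions and to functions with values in an algebra. Put $$F(\lambda+\hbar h^k)=\sum_{N\ge0}\frac{\hbar^N}{N!}\sum_{i_1,\dots,i_N}(\partial_{i_1}\cdots\partial_{i_N}F)(\lambda)\,(e_{i_1}\cdots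 e_{i_N})^{(k)},$$ the product $e_{i_1}\cdots e_{i_N}\in U$ being placed in slot $k$. Let $\Phi\in U^{\otimes3}[[\hbar]]$ be $\mathfrak g$-invariant with $\Phi=1+O(\hbar^2)$, satisfying the pentagon equation $\Phi^{1,2,34}\Phi^{12,3,4}=\Phi^{2,3,4}\Phi^{1,23,4}\Phi^{1,2,3}$, the counit axiom $(\mathrm{id}\otimes\varepsilon\otimes\mathrm{id})(\Phi)=1$, and, with $\mathcal R=e^{\hbar t/2}$, the hexagon equations $$\mathcal R^{12,3}=\Phi^{3,1,2}\mathcal R^{1,3}(\Phi^{1,3,2})^{-1}\mathcal R^{2,3}\Phi,\qquad \mathcal R^{1,23}=(\Phi^{2,3,1})^{-1}\mathcal R^{1,3}\Phi^{2,1,3}\mathcal R^{1,2}\Phi^{-1}.$$ Assume that $\Phi$ quantizes $Z=\frac14[t^{1,2},t^{2,3}]$, i.e. $\sum_{\sigma\in S_3}\mathrm{sgn}(\sigma)\,\sigma\big((\Phi-1)/\hbar^2\big)=Z$ modulo $\hbar$. Let $r\in\mathrm{Mer}(\mathfrak h^*,\mathfrak g\otimes\mathfrak g)$ be an $\mathfrak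 h$-equivariant solution of the classical dynamical Yang-Baxter equation for $(\mathfrak g,t)$, i.e. $r+r^{2,1}=t$ and $$-\sum_i\big(e_i^{1}\,\partial_i r^{2,3}-e_i^{2}\,\partial_i r^{1,3}+e_i^{3}\,\partial_i r^{1,2}\big)+[r^{1,2},r^{1,3}]+[r^{1,2},r^{2,3}]+[r^{1,3},r^{2,3}]=0 .$$ Let $J\in\mathrm{Mer}(\mathfrak h^*,U^{\otimes2})[[\hbar]]$ be $\mathfrak h$-invariant with $J=1+\hbar j+O(\hbar^2)$, satisfying the dynamical twist equation $$J^{12,3}(\lambda)*J^{1,2}(\lambda+\hbar h^3)=\Phi^{-1}J^{1,23}(\lambda)*J^{2,3}(\lambda)$$ and $j-j^{2,1}=r-\frac t2$ (so $(\Phi,J)$ is a twist quantization of $(Z,r-\frac t2)$). Then $J^{2,1}(\lambda)$ is invertible for $*$, and $R(\lambda):=J^{2,1}(\lambda)^{-1}*e^{\hbar t/2}*J(\lambda)$ (inverse with respect to $*$) is a quantum dynamical $R$-matrix quantizing $r$: it is $\mathfrak h$-invariant, $R=1+\hbar r+O(\hbar^2)$, and $$R^{1,2}(\lambda)*R^{1,3}(\lambda+\hbar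 h^2)*R^{2,3}(\lambda)=R^{2,3}(\lambda+\hbar h^1)*R^{1,3}(\lambda)*R^{1,2}(\lambda+\hbar h^3).$$ -/

import Mathlib

open scoped TensorProduct Topology

noncomputable section

namespace DynTwist

attribute [local instance 100] LieRing.ofAssociativeRing LieAlgebra.ofAssociativeAlgebra

/-! ## Meromorphic functions on `ℂⁿ` -/

/-- The filter of subsets that contain a dense open subset. -/
def denseOpen (E : Type*) [TopologicalSpace E] : Filter E where
  sets := {s | Dense (interior s)}
  univ_sets := by simp
  sets_of_superset := fun hs hst => hs.mono (interior_mono hst)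
  inter_sets := fun {s t} hs ht => by
    simp only [Set.mem_ofPred_eq] at hs ht ⊢
    rw [interior_inter]
    exact hs.inter_of_isOpen_left ht isOpen_interior

theorem mem_denseOpen {E : Type*} [TopologicalSpace E] {s : Set E} :
    s ∈ denseOpen E ↔ Dense (interior s) := Iff.rfl

/-- Functions on `ℂⁿ`, two of them being identified when they agree on a dense open set. -/
abbrev FunGerm (n : ℕ) : Type := Filter.Germ (denseOpen (Fin n → ℂ)) ℂ

instance (n : ℕ) : Algebra ℂ (FunGerm n) :=
  Algebra.ofModule
    (fun c f g => Filter.Germ.inductionOn₂ f g fun _ _ =>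
      congrArg _ (funext fun _ => smul_mul_assoc c _ _))
    (fun c f g => Filter.Germ.inductionOn₂ f g fun _ _ =>
      congrArg _ (funext fun _ => mul_smul_comm c _ _))

/-- `f` is meromorphic on `ℂⁿ`: near every point it is a quotient of two holomorphic functions
whose denominator vanishes identically on no open set. -/
def IsMeromorphic {n : ℕ} (f : (Fin n → ℂ) → ℂ) : Prop :=
  ∀ p, ∃ a b : (Fin n → ℂ) → ℂ, AnalyticAt ℂ a p ∧ AnalyticAt ℂ b p ∧
    ∀ᶠ x in 𝓝 p ⊓ denseOpen (Fin n → ℂ), b x ≠ 0 ∧ f x = a x / b x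

theorem IsMeromorphic.of_analytic {n : ℕ} {f : (Fin n → ℂ) → ℂ} (hf : ∀ p, AnalyticAt ℂ f p) :
    IsMeromorphic f := fun p =>
  ⟨f, fun _ => 1, hf p, analyticAt_const, Filter.Eventually.of_forall fun x => by simp⟩

theorem IsMeromorphic.add {n : ℕ} {f g : (Fin n → ℂ) → ℂ} (hf : IsMeromorphic f)
    (hg : IsMeromorphic g) : IsMeromorphic (f + g) := fun p => by
  obtain ⟨a, b, ha, hb, h⟩ := hf p
  obtain ⟨a', b', ha', hb', h'⟩ := hg p
  refine ⟨a * b' + b * a', b * b', (ha.mul hb').add (hb.mul ha'), hb.mul hb', ?_⟩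
  filter_upwards [h, h'] with x hx hx'
  refine ⟨mul_ne_zero hx.1 hx'.1, ?_⟩
  simp only [Pi.add_apply, Pi.mul_apply, hx.2, hx'.2]
  exact div_add_div _ _ hx.1 hx'.1

theorem IsMeromorphic.mul {n : ℕ} {f g : (Fin n → ℂ) → ℂ} (hf : IsMeromorphic f)
    (hg : IsMeromorphic g) : IsMeromorphic (f * g) := fun p => by
  obtain ⟨a, b, ha, hb, h⟩ := hf p
  obtain ⟨a', b', ha', hb', h'⟩ := hg p
  refine ⟨a * a', b * b', ha.mul ha', hb.mul hb', ?_⟩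
  filter_upwards [h, h'] with x hx hx'
  refine ⟨mul_ne_zero hx.1 hx'.1, ?_⟩
  simp only [Pi.mul_apply, hx.2, hx'.2]
  exact div_mul_div_comm _ _ _ _

/-- The algebra of meromorphic functions on `ℂⁿ`. -/
def Mer (n : ℕ) : Subalgebra ℂ (FunGerm n) where
  carrier := {φ | ∃ f : (Fin n → ℂ) → ℂ, IsMeromorphic f ∧ (f : FunGerm n) = φ}
  add_mem' := by
    rintro _ _ ⟨f, hf, rfl⟩ ⟨g, hg, rfl⟩
    exact ⟨f + g, hf.add hg, rfl⟩
  mul_mem' := by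
    rintro _ _ ⟨f, hf, rfl⟩ ⟨g, hg, rfl⟩
    exact ⟨f * g, hf.mul hg, rfl⟩
  algebraMap_mem' := fun c =>
    ⟨fun _ => c, .of_analytic fun _ => analyticAt_const, by
      rw [Algebra.algebraMap_eq_smul_one]
      exact congrArg _ (funext fun _ => (mul_one c).symm)⟩

/-- A meromorphic function is holomorphic on a dense open set. -/
theorem IsMeromorphic.analyticAt {n : ℕ} {f : (Fin n → ℂ) → ℂ} (hf : IsMeromorphic f) :
    ∀ᶠ x in denseOpen (Fin n → ℂ), AnalyticAt ℂ f x := by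
  change Dense (interior {x | AnalyticAt ℂ f x})
  rw [(isOpen_analyticAt ℂ f).interior_eq]
  intro p
  rw [mem_closure_iff_nhds]
  intro V hV
  obtain ⟨a, b, ha, hb, h⟩ := hf p
  obtain ⟨s, hs, t, ht, hst⟩ := Filter.mem_inf_iff_superset.1 h
  have hN : ∀ᶠ x in 𝓝 p, x ∈ V ∩ s ∧ AnalyticAt ℂ a x ∧ AnalyticAt ℂ b x :=
    Filter.Eventually.and (Filter.inter_mem hV hs)
      (ha.eventually_analyticAt.and hb.eventually_analyticAt)
  obtain ⟨W, hW, hWo, hpW⟩ := eventually_nhds_iff.1 hN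
  obtain ⟨x, hxW, hxt⟩ := (mem_denseOpen.1 ht).inter_open_nonempty W hWo ⟨p, hpW⟩
  have key : ∀ᶠ y in 𝓝 x, b y ≠ 0 ∧ f y = a y / b y := by
    filter_upwards [hWo.mem_nhds hxW, isOpen_interior.mem_nhds hxt] with y hy hy'
    exact hst ⟨(hW y hy).1.2, interior_subset hy'⟩
  refine ⟨x, (hW x hxW).1.1, ?_⟩
  have := (hW x hxW).2.1.div (hW x hxW).2.2 key.self_of_nhds.1
  exact this.congr (key.mono fun y hy => hy.2.symm)

/-- The `i`-th partial derivative of a function on `ℂⁿ`. -/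
def partialFun {n : ℕ} (i : Fin n) (f : (Fin n → ℂ) → ℂ) (x : Fin n → ℂ) : ℂ :=
  fderiv ℂ f x (Pi.single i 1)

theorem IsMeromorphic.partialFun {n : ℕ} (i : Fin n) {f : (Fin n → ℂ) → ℂ}
    (hf : IsMeromorphic f) : IsMeromorphic (partialFun i f) := fun p => by
  obtain ⟨a, b, ha, hb, h⟩ := hf p
  have hd : ∀ {u : (Fin n → ℂ) → ℂ}, AnalyticAt ℂ u p → AnalyticAt ℂ (DynTwist.partialFun i u) p :=
    fun hu => (ContinuousLinearMap.analyticAt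
      (ContinuousLinearMap.apply ℂ ℂ (Pi.single i (1 : ℂ) : Fin n → ℂ)) _).comp hu.fderiv
  refine ⟨b * DynTwist.partialFun i a - a * DynTwist.partialFun i b, b ^ 2,
    (hb.mul (hd ha)).sub (ha.mul (hd hb)), hb.pow 2, ?_⟩
  obtain ⟨s, hs, t, ht, hst⟩ := Filter.mem_inf_iff_superset.1 h
  obtain ⟨W, hW, hWo, hpW⟩ := eventually_nhds_iff.1
    (Filter.Eventually.and hs (ha.eventually_analyticAt.and hb.eventually_analyticAt))
  have ht' : interior t ∈ denseOpen (Fin n → ℂ) := by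
    rw [mem_denseOpen, interior_interior]; exact ht
  refine Filter.mem_inf_iff_superset.2 ⟨W, hWo.mem_nhds hpW, interior t, ht', ?_⟩
  rintro x ⟨hxW, hxt⟩
  have key : ∀ᶠ y in 𝓝 x, b y ≠ 0 ∧ f y = a y / b y := by
    filter_upwards [hWo.mem_nhds hxW, isOpen_interior.mem_nhds hxt] with y hy hy'
    exact hst ⟨(hW y hy).1, interior_subset hy'⟩
  have hb0 := key.self_of_nhds.1
  refine ⟨pow_ne_zero 2 hb0, ?_⟩
  have hfe : f =ᶠ[𝓝 x] fun y => a y / b y := key.mono fun y hy => hy.2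
  have hfx : AnalyticAt ℂ f x :=
    ((hW x hxW).2.1.div (hW x hxW).2.2 hb0).congr (key.mono fun y hy => hy.2.symm)
  have h2 := (hW x hxW).2.2.differentiableAt
  have hae : a =ᶠ[𝓝 x] f * b := key.mono fun y hy => by
    rw [Pi.mul_apply, hy.2, div_mul_cancel₀ _ hy.1]
  have e : DynTwist.partialFun i a x = f x * DynTwist.partialFun i b x +
      b x * DynTwist.partialFun i f x := by
    have := (hfx.differentiableAt.hasFDerivAt.mul h2.hasFDerivAt).fderiv
    simp [DynTwist.partialFun, hae.fderiv_eq, this]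
  simp only [Pi.sub_apply, Pi.mul_apply, Pi.pow_apply, e, hae.self_of_nhds]
  field_simp
  ring

/-- The partial derivative on germs. -/
def partialGerm {n : ℕ} (i : Fin n) : FunGerm n → FunGerm n :=
  Quotient.map' (partialFun i) fun f g h => by
    have h : ∀ᶠ x in denseOpen (Fin n → ℂ), f x = g x := h
    change ∀ᶠ x in denseOpen (Fin n → ℂ), partialFun i f x = partialFun i g x
    have h' : interior {x | f x = g x} ∈ denseOpen (Fin n → ℂ) := by
      rw [mem_denseOpen, interior_interior]; exact h
    filter_upwards [h'] with x hx
    have : f =ᶠ[𝓝 x] g := mem_interior_iff_mem_nhds.1 hx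
    simp only [partialFun, this.fderiv_eq]

/-- The partial derivative `∂/∂λᵢ` of meromorphic functions. -/
def pderiv {n : ℕ} (i : Fin n) : Mer n →ₗ[ℂ] Mer n where
  toFun φ := ⟨partialGerm i φ.1, by
    obtain ⟨_, f, hf, rfl⟩ := φ
    exact ⟨partialFun i f, hf.partialFun i, rfl⟩⟩
  map_add' := by
    rintro ⟨_, f, hf, rfl⟩ ⟨_, g, hg, rfl⟩
    refine Subtype.ext (Filter.Germ.coe_eq.2 ?_)
    filter_upwards [hf.analyticAt, hg.analyticAt] with x hx hy
    have := fderiv_add hx.differentiableAt hy.differentiableAt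
    change fderiv ℂ (f + g) x _ = fderiv ℂ f x _ + fderiv ℂ g x _
    rw [this]; rfl
  map_smul' := by
    rintro c ⟨_, f, hf, rfl⟩
    refine Subtype.ext (Filter.Germ.coe_eq.2 ?_)
    filter_upwards [hf.analyticAt] with x hx
    have := fderiv_const_smul hx.differentiableAt c
    change fderiv ℂ (c • f) x _ = c • fderiv ℂ f x _
    rw [this]; rfl

/-- The coordinate function `λ ↦ λᵢ`. -/
def coord {n : ℕ} (i : Fin n) : Mer n :=
  ⟨((fun x => x i : (Fin n → ℂ) → ℂ) : FunGerm n), _,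
    .of_analytic fun p => (ContinuousLinearMap.proj (R := ℂ) (φ := fun _ : Fin n => ℂ) i).analyticAt p,
    rfl⟩

/-- A polynomial in `λ₁, …, λₙ` as a meromorphic function. -/
def polyMer (n : ℕ) : MvPolynomial (Fin n) ℂ →ₐ[ℂ] Mer n := MvPolynomial.aeval coord

/-! ## Enveloping algebras -/

section Enveloping

variable (L : Type*) [LieRing L] [LieAlgebra ℂ L]

/-- The enveloping algebra. -/
abbrev U := UniversalEnvelopingAlgebra ℂ L
/-- `U(L)^{⊗2}`. -/
abbrev U2 := U L ⊗[ℂ] U L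
/-- `U(L)^{⊗3}`. -/
abbrev U3 := U L ⊗[ℂ] U2 L
/-- `U(L)^{⊗4}`. -/
abbrev U4 := U L ⊗[ℂ] U3 L

variable {L}

/-- The canonical map `L → U(L)`, as a linear map. -/
def inc : L →ₗ[ℂ] U L := (UniversalEnvelopingAlgebra.ι ℂ : L →ₗ⁅ℂ⁆ U L)

variable (L)

/-- The coproduct `Δ₀` of `U(L)`, with `Δ₀(x) = x ⊗ 1 + 1 ⊗ x` for `x ∈ L`. -/
def comul : U L →ₐ[ℂ] U2 L :=
  UniversalEnvelopingAlgebra.lift ℂ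
    { toLinearMap := (Algebra.TensorProduct.includeLeft.toLinearMap : U L →ₗ[ℂ] U2 L) ∘ₗ inc +
        (Algebra.TensorProduct.includeRight.toLinearMap : U L →ₗ[ℂ] U2 L) ∘ₗ inc
      map_lie' := fun {x y} => by
        simp [inc, LieRing.of_associative_ring_bracket, TensorProduct.tmul_sub,
          TensorProduct.sub_tmul, add_mul, mul_add]
        abel }

/-- The counit of `U(L)`. -/
def counit : U L →ₐ[ℂ] ℂ := UniversalEnvelopingAlgebra.lift ℂ (0 : L →ₗ⁅ℂ⁆ ℂ)

/-! Leg maps. The superscripts say in which slots the legs are put: `X^{3,1,2}` has the first leg of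
`X` in slot 3, the second one in slot 1 and the third one in slot 2; `X^{12,3}` means that the first
leg is replaced by its coproduct, which occupies slots 1 and 2. -/

section Legs

open Algebra.TensorProduct

/-- `X ↦ X^{2,1}` -/
def t21 : U2 L →ₐ[ℂ] U2 L := (Algebra.TensorProduct.comm ℂ (U L) (U L)).toAlgHom

/-- `x ↦ x ⊗ 1 ⊗ 1` -/
def s1 : U L →ₐ[ℂ] U3 L := includeLeft
/-- `x ↦ 1 ⊗ x ⊗ 1` -/
def s2 : U L →ₐ[ℂ] U3 L := includeRight.comp includeLeft
/-- `x ↦ 1 ⊗ 1 ⊗ x` -/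
def s3 : U L →ₐ[ℂ] U3 L := includeRight.comp includeRight

/-- `X ↦ X^{1,2}` -/
def t12 : U2 L →ₐ[ℂ] U3 L := map (.id ℂ _) includeLeft
/-- `X ↦ X^{1,3}` -/
def t13 : U2 L →ₐ[ℂ] U3 L := map (.id ℂ _) includeRight
/-- `X ↦ X^{2,3}` -/
def t23 : U2 L →ₐ[ℂ] U3 L := includeRight
/-- `X ↦ X^{12,3}` -/
def t12_3 : U2 L →ₐ[ℂ] U3 L :=
  (Algebra.TensorProduct.assoc ℂ ℂ ℂ (U L) (U L) (U L)).toAlgHom.comp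
    (map (comul L) (.id ℂ _))
/-- `X ↦ X^{1,23}` -/
def t1_23 : U2 L →ₐ[ℂ] U3 L := map (.id ℂ _) (comul L)

/-- `X ↦ X^{1,3,2}`: `a ⊗ b ⊗ c ↦ a ⊗ c ⊗ b` -/
def p132 : U3 L →ₐ[ℂ] U3 L := map (.id ℂ _) (t21 L)
/-- `X ↦ X^{2,1,3}`: `a ⊗ b ⊗ c ↦ b ⊗ a ⊗ c` -/
def p213 : U3 L →ₐ[ℂ] U3 L := (leftComm ℂ (U L) (U L) (U L)).toAlgHom
/-- `X ↦ X^{3,1,2}`: `a ⊗ b ⊗ c ↦ b ⊗ c ⊗ a` -/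
def p312 : U3 L →ₐ[ℂ] U3 L := (p132 L).comp (p213 L)
/-- `X ↦ X^{2,3,1}`: `a ⊗ b ⊗ c ↦ c ⊗ a ⊗ b` -/
def p231 : U3 L →ₐ[ℂ] U3 L := (p213 L).comp (p132 L)
/-- `X ↦ X^{3,2,1}`: `a ⊗ b ⊗ c ↦ c ⊗ b ⊗ a` -/
def p321 : U3 L →ₐ[ℂ] U3 L := (p132 L).comp (p231 L)

/-- `X ↦ X^{1,2,34}` -/
def q1_2_34 : U3 L →ₐ[ℂ] U4 L := map (.id ℂ _) (t1_23 L)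
/-- `X ↦ X^{1,23,4}` -/
def q1_23_4 : U3 L →ₐ[ℂ] U4 L := map (.id ℂ _) (t12_3 L)
/-- `X ↦ X^{12,3,4}` -/
def q12_3_4 : U3 L →ₐ[ℂ] U4 L :=
  (Algebra.TensorProduct.assoc ℂ ℂ ℂ (U L) (U L) (U2 L)).toAlgHom.comp
    (map (comul L) (.id ℂ _))
/-- `X ↦ X^{1,2,3}` -/
def q1_2_3 : U3 L →ₐ[ℂ] U4 L := map (.id ℂ _) (t12 L)
/-- `X ↦ X^{2,3,4}` -/
def q2_3_4 : U3 L →ₐ[ℂ] U4 L := includeRight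

/-- `id ⊗ ε ⊗ id` -/
def counit2 : U3 L →ₐ[ℂ] U2 L :=
  map (.id ℂ _) ((Algebra.TensorProduct.lid ℂ (U L)).toAlgHom.comp (map (counit L) (.id ℂ _)))

end Legs

variable {L}

/-- `Alt X = ∑_σ sgn(σ) X^σ`. -/
def alt (X : U3 L) : U3 L :=
  X + p231 L X + p312 L X - p132 L X - p213 L X - p321 L X

/-- The map `L ⊗ L → U(L)^{⊗2}`. -/
def inc2 : L ⊗[ℂ] L →ₗ[ℂ] U2 L := TensorProduct.map inc inc

/-- `t ∈ S²(L)^L`. -/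
def IsInvariantSymmetric (t : L ⊗[ℂ] L) : Prop :=
  TensorProduct.comm ℂ L L t = t ∧ ∀ x : L, ⁅x, t⁆ = 0

end Enveloping

/-! ## Associators -/

/-- `exp(ħ a)` as a formal power series in `ħ`. -/
def expSeries {B : Type*} [Ring B] [Algebra ℂ B] (a : B) : PowerSeries B :=
  PowerSeries.mk fun N => ((N.factorial : ℂ)⁻¹) • a ^ N

/-- Coefficientwise application of an algebra map to a series in `ħ`. -/
def onSeries {B C : Type*} [Semiring B] [Algebra ℂ B] [Semiring C] [Algebra ℂ C] (φ : B →ₐ[ℂ] C) :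
    PowerSeries B →+* PowerSeries C :=
  PowerSeries.map (φ : B →+* C)

section Associator

variable {L : Type*} [LieRing L] [LieAlgebra ℂ L]

/-- `Φ ∈ U(L)^{⊗3}[[ħ]]` is a quantization of `Z`: it is `L`-invariant, is `1 + O(ħ²)`, satisfies
the pentagon equation and the counit axiom, and `Alt((Φ - 1)/ħ²) = Z` modulo `ħ`. -/
structure IsAssociator (Φ : PowerSeries (U3 L)) (Z : U3 L) : Prop where
  invariant : ∀ (x : L) (N : ℕ),
    Commute (s1 L (inc x) + s2 L (inc x) + s3 L (inc x)) (PowerSeries.coeff N Φ)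
  coeff_zero : PowerSeries.coeff 0 Φ = 1
  coeff_one : PowerSeries.coeff 1 Φ = 0
  pentagon : onSeries (q1_2_34 L) Φ * onSeries (q12_3_4 L) Φ =
    onSeries (q2_3_4 L) Φ * onSeries (q1_23_4 L) Φ * onSeries (q1_2_3 L) Φ
  counit : onSeries (counit2 L) Φ = 1
  alt_coeff_two : alt (PowerSeries.coeff 2 Φ) = Z

/-- The two hexagon equations
`𝓡^{12,3} = Φ^{3,1,2} 𝓡^{1,3} (Φ^{1,3,2})⁻¹ 𝓡^{2,3} Φ` and
`𝓡^{1,23} = (Φ^{2,3,1})⁻¹ 𝓡^{1,3} Φ^{2,1,3} 𝓡^{1,2} Φ⁻¹`. -/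
structure Hexagon (Φ : PowerSeries (U3 L)) (R : PowerSeries (U2 L)) : Prop where
  left : onSeries (t12_3 L) R =
    onSeries (p312 L) Φ * onSeries (t13 L) R * Ring.inverse (onSeries (p132 L) Φ) *
      onSeries (t23 L) R * Φ
  right : onSeries (t1_23 L) R =
    Ring.inverse (onSeries (p231 L) Φ) * onSeries (t13 L) R * onSeries (p213 L) Φ *
      onSeries (t12 L) R * Ring.inverse Φ

end Associator

/-! ## The PBW star-product

Let `H` be a Lie algebra with basis `e₁, …, eₙ`. The symmetric algebra `S(H)`, that is, the algebra of
polynomial functions on `H*`, is `ℂ[λ₁, …, λₙ]`, where `λᵢ` is the function `λ ↦ λ(eᵢ)`; so `λᵢ` are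
the coordinates on `H* = ℂⁿ` that are attached to the basis dual to `e`. -/

section Star

variable {n : ℕ} {H : Type*} [LieRing H] [LieAlgebra ℂ H] (e : Module.Basis (Fin n) ℂ H)

/-- The symmetrized product `(1/N!) ∑_σ u_{σ(1)} ⋯ u_{σ(N)}`. -/
def symProd {B : Type*} [Ring B] [Algebra ℂ B] {N : ℕ} (u : Fin N → B) : B :=
  ((N.factorial : ℂ)⁻¹) • ∑ σ : Equiv.Perm (Fin N), (List.ofFn fun k => u (σ k)).prod

/-- The symmetrization map `S(H) → U(H)`; it is bijective by the PBW theorem. -/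
def symmetrization : MvPolynomial (Fin n) ℂ →ₗ[ℂ] U H :=
  (MvPolynomial.basisMonomials (Fin n) ℂ).constr ℂ fun s =>
    let l := (Finsupp.toMultiset s).toList
    symProd fun k : Fin l.length => (inc (e (l.get k)) : U H)

/-- The coefficient of `ħᵐ` in the product of two polynomials that is transported from `U(H_ħ)`,
`[x, y]_{H_ħ} = ħ [x, y]`, by symmetrization. For `f`, `g` homogeneous of degrees `p`, `q` it is the
part of degree `p + q - m` of `σ⁻¹(σ(f) σ(g))`, where `σ : S(H) → U(H)` is the symmetrization. -/
def polyStar (m : ℕ) (f g : MvPolynomial (Fin n) ℂ) : MvPolynomial (Fin n) ℂ :=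
  ∑ p ∈ Finset.range (f.totalDegree + 1), ∑ q ∈ Finset.range (g.totalDegree + 1),
    if m ≤ p + q then
      MvPolynomial.homogeneousComponent (p + q - m)
        (Function.invFun (symmetrization e)
          (symmetrization e (MvPolynomial.homogeneousComponent p f) *
            symmetrization e (MvPolynomial.homogeneousComponent q g)))
    else 0

/-- For a bilinear operator `D = polyStar m` on polynomials, the polynomial function
`c ↦ D(∏ₖ (λ_{i(k)} - c_{i(k)}), ∏ₖ (λ_{j(k)} - c_{j(k)}))(c)`, written out by expanding both
products. By Taylor's formula these are `p! q!` times the coefficients of the bidifferential operator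
`D`. -/
def starSymbol (m : ℕ) {p q : ℕ} (i : Fin p → Fin n) (j : Fin q → Fin n) :
    MvPolynomial (Fin n) ℂ :=
  ∑ S : Finset (Fin p), ∑ T : Finset (Fin q),
    (∏ k ∈ Sᶜ, -MvPolynomial.X (i k)) * (∏ k ∈ Tᶜ, -MvPolynomial.X (j k)) *
      polyStar e m (∏ k ∈ S, MvPolynomial.X (i k)) (∏ k ∈ T, MvPolynomial.X (j k))

/-- Meromorphic functions on `ℂⁿ` with values in (a finite-dimensional subspace of) `W`. -/
abbrev MerVal (n : ℕ) (W : Type*) [AddCommGroup W] [Module ℂ W] := Mer n ⊗[ℂ] W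

/-- `∂_{i(1)} ⋯ ∂_{i(p)}` on vector-valued meromorphic functions. -/
def pderivs {W : Type*} [AddCommGroup W] [Module ℂ W] {p : ℕ} (i : Fin p → Fin n) :
    MerVal n W →ₗ[ℂ] MerVal n W :=
  (List.ofFn fun k => (pderiv (i k)).rTensor W).prod

variable {W : Type*} [Ring W] [Algebra ℂ W]

/-- The bidifferential operator that is the coefficient of `ħᵐ` in the PBW star-product, on
meromorphic functions with values in an algebra `W`. It has order at most `m` in each argument, and
on polynomials it is `polyStar m`. -/
def starCoeff (m : ℕ) (F G : MerVal n W) : MerVal n W :=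
  ∑ p ∈ Finset.range (m + 1), ∑ q ∈ Finset.range (m + 1),
    ((p.factorial : ℂ)⁻¹ * (q.factorial : ℂ)⁻¹) •
      ∑ i : Fin p → Fin n, ∑ j : Fin q → Fin n,
        (polyMer n (starSymbol e m i j) ⊗ₜ[ℂ] (1 : W)) * pderivs i F * pderivs j G

/-- The PBW star-product on series in `ħ` whose coefficients are `W`-valued meromorphic functions. -/
def star (F G : PowerSeries (MerVal n W)) : PowerSeries (MerVal n W) :=
  PowerSeries.mk fun N =>
    ∑ a ∈ Finset.HasAntidiagonal.antidiagonal N, ∑ b ∈ Finset.HasAntidiagonal.antidiagonal a.2,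
      starCoeff e a.1 (PowerSeries.coeff b.1 F) (PowerSeries.coeff b.2 G)

/-- `G` is the inverse of `F` for the PBW star-product. -/
def IsStarInverse (F G : PowerSeries (MerVal n W)) : Prop :=
  star e F G = 1 ∧ star e G F = 1

/-- The infinitesimal coadjoint action of `x` on functions on `H*`; on a linear function `y ∈ H` it is
`y ↦ [x, y]`. -/
def coadAction (x : H) : Mer n →ₗ[ℂ] Mer n :=
  ∑ i, LinearMap.mulLeft ℂ (∑ k, e.repr ⁅x, e i⁆ k • coord k : Mer n) ∘ₗ pderiv i

/-- A series in `ħ` with coefficients in `W`, viewed as constant in `λ`. -/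
def const (n : ℕ) (F : PowerSeries W) : PowerSeries (MerVal n W) :=
  onSeries (Algebra.TensorProduct.includeRight : W →ₐ[ℂ] MerVal n W) F

/-- Application of an algebra map to the values of a meromorphic function. -/
def onValues (n : ℕ) {W' : Type*} [Ring W'] [Algebra ℂ W'] (φ : W →ₐ[ℂ] W') :
    MerVal n W →ₐ[ℂ] MerVal n W' :=
  Algebra.TensorProduct.map (.id ℂ _) φ

/-- Application of an algebra map to the values, for series in `ħ`. -/
def leg {n : ℕ} {W' : Type*} [Ring W'] [Algebra ℂ W'] (φ : W →ₐ[ℂ] W')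
    (F : PowerSeries (MerVal n W)) : PowerSeries (MerVal n W') :=
  onSeries (onValues n φ) F

end Star

/-! ## Dynamical equations -/

section Dynamical

variable {L : Type*} [LieRing L] [LieAlgebra ℂ L] {h : LieSubalgebra ℂ L}
  {n : ℕ} (e : Module.Basis (Fin n) ℂ h)

/-- The coefficient of `ħᴺ` in `F(λ + ħ h)`, for `F` not depending on `ħ`:
`(1/N!) ∑_{i₁, …, i_N} ∂_{i₁} ⋯ ∂_{i_N} F ⊗ e_{i₁} ⋯ e_{i_N}`. The map `φ` puts the values of `F` in
their slots, and `s` puts `e_{i₁} ⋯ e_{i_N}` in the remaining one. -/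
def shiftCoeff {W : Type*} [Ring W] [Algebra ℂ W] (φ : W →ₐ[ℂ] U3 L) (s : U L →ₐ[ℂ] U3 L)
    (N : ℕ) (F : MerVal n W) : MerVal n (U3 L) :=
  ((N.factorial : ℂ)⁻¹) • ∑ i : Fin N → Fin n,
    onValues n φ (pderivs i F) *
      ((1 : Mer n) ⊗ₜ[ℂ] s ((List.ofFn fun k => (inc (e (i k) : L) : U L)).prod))

/-- `F(λ + ħ h)`, the values of `F` being put in their slots by `φ` and `h` by `s`. -/
def shift {W : Type*} [Ring W] [Algebra ℂ W] (φ : W →ₐ[ℂ] U3 L) (s : U L →ₐ[ℂ] U3 L)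
    (F : PowerSeries (MerVal n W)) : PowerSeries (MerVal n (U3 L)) :=
  PowerSeries.mk fun N => ∑ a ∈ Finset.HasAntidiagonal.antidiagonal N,
    shiftCoeff e φ s a.1 (PowerSeries.coeff a.2 F)

/-- `h`-invariance of a series with coefficients in `Mer(h*, U(L)^{⊗2})`, for the adjoint action on
`U(L)^{⊗2}` and the coadjoint action on functions. -/
def IsInvariant (F : PowerSeries (MerVal n (U2 L))) : Prop :=
  ∀ (x : h) (N : ℕ), (coadAction e x).rTensor (U2 L) (PowerSeries.coeff N F) +
    (((1 : Mer n) ⊗ₜ[ℂ] comul L (inc (x : L))) * PowerSeries.coeff N F -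
      PowerSeries.coeff N F * ((1 : Mer n) ⊗ₜ[ℂ] comul L (inc (x : L)))) = 0

/-- A map `h* → L ⊗ L` viewed as a map `h* → U(L)^{⊗2}`. -/
def incVal (r : MerVal n (L ⊗[ℂ] L)) : MerVal n (U2 L) := inc2.lTensor (Mer n) r

/-- `CYB(r) = [r^{1,2}, r^{1,3}] + [r^{1,2}, r^{2,3}] + [r^{1,3}, r^{2,3}]`. -/
def cyb (r : MerVal n (U2 L)) : MerVal n (U3 L) :=
  let r12 := onValues n (t12 L) r
  let r13 := onValues n (t13 L) r
  let r23 := onValues n (t23 L) r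
  (r12 * r13 - r13 * r12) + (r12 * r23 - r23 * r12) + (r13 * r23 - r23 * r13)

/-- `Alt(dr) = ∑ᵢ (eᵢ¹ ∂ᵢ r^{2,3} - eᵢ² ∂ᵢ r^{1,3} + eᵢ³ ∂ᵢ r^{1,2})`. -/
def altD (r : MerVal n (U2 L)) : MerVal n (U3 L) :=
  ∑ i, let E : U L := inc (e i : L)
    let dr := (pderiv i).rTensor (U2 L) r
    ((1 : Mer n) ⊗ₜ[ℂ] s1 L E) * onValues n (t23 L) dr -
      ((1 : Mer n) ⊗ₜ[ℂ] s2 L E) * onValues n (t13 L) dr +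
      ((1 : Mer n) ⊗ₜ[ℂ] s3 L E) * onValues n (t12 L) dr

/-- `r` is a quasitriangular classical dynamical `r`-matrix `h* → L ⊗ L` for `(L, t)`. -/
structure IsClassicalRMatrix (t : L ⊗[ℂ] L) (r : MerVal n (L ⊗[ℂ] L)) : Prop where
  invariant : ∀ x : h, (coadAction e x).rTensor (L ⊗[ℂ] L) r +
    (LieModule.toEnd ℂ L (L ⊗[ℂ] L) (x : L)).lTensor (Mer n) r = 0
  symm : r + (TensorProduct.comm ℂ L L).toLinearMap.lTensor (Mer n) r = (1 : Mer n) ⊗ₜ[ℂ] t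
  cdybe : -altD e (incVal r) + cyb (incVal r) = 0

/-- `J = 1 + O(ħ)` is `h`-invariant and satisfies the dynamical twist equation
`J^{12,3}(λ) * J^{1,2}(λ + ħ h³) = Φ⁻¹ J^{1,23}(λ) * J^{2,3}(λ)`. -/
structure IsDynamicalTwist (Φ : PowerSeries (U3 L)) (J : PowerSeries (MerVal n (U2 L))) :
    Prop where
  coeff_zero : PowerSeries.coeff 0 J = 1
  invariant : IsInvariant e J
  twist : star e (leg (t12_3 L) J) (shift e (t12 L) (s3 L) J) =
    const n (Ring.inverse Φ) * star e (leg (t1_23 L) J) (leg (t23 L) J)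

/-- `(Φ, J)` is a twist quantization of `(Z, ρ)`: `Φ` is a quantization of `Z`, `J` is a dynamical
twist for `Φ`, and `ρ = j - j^{2,1}` where `J = 1 + ħ j + O(ħ²)`. -/
structure IsTwistQuantization (Φ : PowerSeries (U3 L)) (J : PowerSeries (MerVal n (U2 L)))
    (Z : U3 L) (ρ : MerVal n (L ⊗[ℂ] L)) : Prop where
  associator : IsAssociator Φ Z
  twist : IsDynamicalTwist e Φ J
  limit : incVal ρ = PowerSeries.coeff 1 J - onValues n (t21 L) (PowerSeries.coeff 1 J)

/-- `R` is a quantum dynamical `R`-matrix that quantizes `r`: it is `h`-invariant, is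
`1 + ħ r + O(ħ²)`, and satisfies the quantum dynamical Yang-Baxter equation
`R^{1,2}(λ) * R^{1,3}(λ + ħ h²) * R^{2,3}(λ) = R^{2,3}(λ + ħ h¹) * R^{1,3}(λ) * R^{1,2}(λ + ħ h³)`. -/
structure IsQuantumRMatrix (R : PowerSeries (MerVal n (U2 L))) (r : MerVal n (L ⊗[ℂ] L)) :
    Prop where
  coeff_zero : PowerSeries.coeff 0 R = 1
  coeff_one : PowerSeries.coeff 1 R = incVal r
  invariant : IsInvariant e R
  qdybe :
    star e (star e (leg (t12 L) R) (shift e (t13 L) (s2 L) R)) (leg (t23 L) R) =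
      star e (star e (shift e (t23 L) (s1 L) R) (leg (t13 L) R)) (shift e (t12 L) (s3 L) R)

end Dynamical

end DynTwist

end

/-! Write `𝓡 = exp(ħt/2)` and `A = J^{12,3}(λ) * J^{1,2}(λ + ħh³)`, so that the twist equation reads
`ΦA = J^{1,23} * J^{2,3}`. The coproduct is cocommutative, so exchanging slots 1 and 2 fixes
`J^{12,3}`; the tensor `t` is invariant, so `𝓡^{1,2}` commutes with `J^{12,3}`. Hence `J^{2,1} * R =
𝓡 * J` gives `A^{2,1,3} * R^{1,2}(λ + ħh³) = 𝓡^{1,2} A`, and likewise `(ΦA)^{1,3,2} * R^{2,3} =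
𝓡^{2,3} ΦA`. Permute the slots in these two relations. Multiplied on the left by `(ΦA)^{3,2,1}`, one
side of the dynamical Yang-Baxter equation becomes `𝓡^{1,2} 𝓡^{12,3} A` by the hexagon, and the
other becomes `𝓡^{12,3} 𝓡^{1,2} A` by the hexagon with slots 1 and 2 exchanged. They agree because
`𝓡` commutes with coproducts, and the factor cancels because it starts with `1`. This is
`yangBaxter_of_twist_hexagon`, fed by `qdybe_of_twist`.

The computation presupposes that `*` is associative with unit on meromorphic series and that `F ↦
F(λ + ħh³)` is multiplicative; most of the work goes there. On polynomials, associativity comes from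
the enveloping algebra, and multiplicativity of the shift comes from that of the coproduct, to which
the shift corresponds under symmetrization (`sum_polyShift`).

Passing to meromorphic functions requires the coefficients of `*` to be bidifferential operators. An
explicit operator with Bernoulli numbers is attached to each element of the Lie algebra. The
functional equation of `x / (eˣ - 1)` makes this a representation (`sum_actCoeff_commutator`,
`act_lie`); applying it to `1` inverts symmetrization, which proves PBW and identifies the
representation with left multiplication. So the coefficient of `ħᵐ` has order at most `m` in the
second argument, and in the first one too, since the antipode gives `f *ₘ g = (-1)ᵐ g *ₘ f`. A
differential operator that vanishes on polynomials is zero (`eq_zero_of_mem_diffOps`), so identities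
extend one argument at a time (`starₗ_assoc`, `shiftₗ_starₗ`).

Invariance of a series means star-commuting with `λ(x) + ħΔ(x)` (`isInvariant_iff`), a condition
stable under products and inverses. The first-order coefficient of `R` is `j - j^{2,1} + t/2 = r`.
-/

open Finset.HasAntidiagonal (antidiagonal)

noncomputable section

namespace DynTwist

attribute [local instance 100] LieRing.ofAssociativeRing LieAlgebra.ofAssociativeAlgebra

/-! ## Powers of linear forms -/

/-- A vector-valued polynomial in one variable that takes values in a subspace has its
coefficients in this subspace. -/
theorem mem_of_forall_sum_pow_smul_mem {V : Type*} [AddCommGroup V] [Module ℂ V]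
    (S : Submodule ℂ V) (K : ℕ) (v : ℕ → V)
    (hv : ∀ s : ℂ, ∑ k ∈ Finset.range K, s ^ k • v k ∈ S) {k : ℕ} (hk : k < K) : v k ∈ S := by
  -- In the quotient by `S`, tested against a functional, the hypothesis says that a scalar
  -- polynomial vanishes at every complex number, so all its coefficients vanish.
  rw [← Submodule.Quotient.mk_eq_zero S]
  rw [← Module.forall_dual_apply_eq_zero_iff ℂ]
  intro φ
  set p : Polynomial ℂ := ∑ k ∈ Finset.range K,
    Polynomial.monomial k (φ (Submodule.Quotient.mk (v k))) with hp
  have h0 : p = 0 := by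
    refine Polynomial.funext fun s => ?_
    have := congrArg φ ((Submodule.Quotient.mk_eq_zero S).2 (hv s))
    rw [← Submodule.mkQ_apply, map_sum, map_sum, map_zero] at this
    simp only [map_smul, Submodule.mkQ_apply, smul_eq_mul] at this
    simp only [hp, Polynomial.eval_finsetSum, Polynomial.eval_monomial, Polynomial.eval_zero]
    rw [← this]
    exact Finset.sum_congr rfl fun _ _ => mul_comm _ _
  have := congrArg (fun q => Polynomial.coeff q k) h0
  simpa [hp, Polynomial.finsetSum_coeff, Polynomial.coeff_monomial, hk] using this

section Lin

variable {n : ℕ} {H : Type*} [LieRing H] [LieAlgebra ℂ H] (e : Module.Basis (Fin n) ℂ H)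

/-- An element of `H` as a linear function on `H*`. -/
def lin : H →ₗ[ℂ] MvPolynomial (Fin n) ℂ := e.constr ℂ MvPolynomial.X

theorem lin_apply (y : H) : lin e y = ∑ i, e.repr y i • MvPolynomial.X i :=
  e.constr_apply_fintype ℂ _ _

@[simp] theorem lin_basis (i : Fin n) : lin e (e i) = MvPolynomial.X i := e.constr_basis _ _ _

/-- The powers of linear forms span the algebra of polynomials. -/
theorem span_lin_pow :
    Submodule.span ℂ {f | ∃ (y : H) (N : ℕ), f = lin e y ^ N} = ⊤ := by
  set S := Submodule.span ℂ {f | ∃ (y : H) (N : ℕ), f = lin e y ^ N} with hS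
  have hpow : ∀ y N, lin e y ^ N ∈ S := fun y N => Submodule.subset_span ⟨y, N, rfl⟩
  have hmul : ∀ (y z : H) (a b : ℕ), lin e y ^ a * lin e z ^ b ∈ S := by
    intro y z a b
    -- Polarization: the coefficient of `s ^ b` in the power `a + b` of `s z + y` is `z ^ b * y ^ a`
    -- times a non-zero binomial coefficient.
    have key := mem_of_forall_sum_pow_smul_mem S (a + b + 1)
      (fun k => lin e z ^ k * lin e y ^ (a + b - k) * ((a + b).choose k : MvPolynomial (Fin n) ℂ))
      (fun s => by
        have := hpow (s • z + y) (a + b)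
        rw [map_add, map_smul, add_pow] at this
        simpa only [smul_pow, smul_mul_assoc] using this) (k := b) (by omega)
    have hc : ((a + b).choose b : ℂ) ≠ 0 := by
      exact_mod_cast (Nat.choose_pos (by omega)).ne'
    have := S.smul_mem ((a + b).choose b : ℂ)⁻¹ key
    rw [show a + b - b = a by omega, ← nsmul_eq_mul', ← Nat.cast_smul_eq_nsmul ℂ, smul_smul,
      inv_mul_cancel₀ hc, one_smul, mul_comm] at this
    exact this
  have hmul' : ∀ f ∈ S, ∀ g ∈ S, f * g ∈ S := by
    intro f hf g hg
    have : S * S ≤ S := by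
      rw [hS, Submodule.span_mul_span, ← hS, Submodule.span_le]
      rintro _ ⟨_, ⟨y, a, rfl⟩, _, ⟨z, b, rfl⟩, rfl⟩
      exact hmul y z a b
    exact this (Submodule.mul_mem_mul hf hg)
  rw [eq_top_iff]
  intro f _
  induction f using MvPolynomial.induction_on with
  | C a =>
    have := S.smul_mem a (hpow 0 0)
    rwa [pow_zero, MvPolynomial.smul_eq_C_mul, mul_one] at this
  | add p q hp hq => exact S.add_mem (hp trivial) (hq trivial)
  | mul_X p i hp =>
    refine hmul' _ (hp trivial) _ ?_
    have := hpow (e i) 1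
    rwa [pow_one, lin_basis] at this

/-- Two linear maps that agree on the powers of linear forms are equal. -/
theorem ext_lin_pow {V : Type*} [AddCommGroup V] [Module ℂ V]
    {A B : MvPolynomial (Fin n) ℂ →ₗ[ℂ] V} (h : ∀ y N, A (lin e y ^ N) = B (lin e y ^ N)) :
    A = B :=
  LinearMap.ext_on (span_lin_pow e) (by rintro _ ⟨y, N, rfl⟩; exact h y N)

/-! ## Symmetrization -/

section SymProd

variable {B : Type*} [Ring B] [Algebra ℂ B]

theorem symProd_comp_perm {N : ℕ} (u : Fin N → B) (τ : Equiv.Perm (Fin N)) :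
    symProd (fun k => u (τ k)) = symProd u := by
  unfold symProd
  congr 1
  exact Fintype.sum_equiv (Equiv.mulLeft τ) _ _ fun σ => rfl

theorem symProd_const (N : ℕ) (a : B) : symProd (fun _ : Fin N => a) = a ^ N := by
  have : (N.factorial : ℂ) ≠ 0 := by exact_mod_cast N.factorial_ne_zero
  simp only [symProd, List.ofFn_const, List.prod_replicate, Finset.sum_const, Finset.card_univ,
    Fintype.card_perm, Fintype.card_fin]
  rw [← Nat.cast_smul_eq_nsmul ℂ, smul_smul, inv_mul_cancel₀ this, one_smul]

/-- `symmetrization` reads each monomial off an arbitrarily ordered list of its factors. Sorting the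
list and the tuple gives the same result, and rearranging does not change a symmetrized product, so
that choice is harmless. -/
theorem symProd_get_eq {N : ℕ} (g : Fin n → B) (i : Fin N → Fin n) (l : List (Fin n))
    (hl : l.Perm (List.ofFn i)) : symProd (fun k => g (l.get k)) = symProd fun k => g (i k) := by
  obtain rfl : l.length = N := by rw [hl.length_eq, List.length_ofFn]
  have h : l.get ∘ Tuple.sort l.get = i ∘ Tuple.sort i := by
    apply List.ofFn_injective
    refine List.Perm.eq_of_pairwise' (r := (· ≤ ·))
      (Tuple.monotone_sort l.get).sortedLE_ofFn.pairwise
      (Tuple.monotone_sort i).sortedLE_ofFn.pairwise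
      ((Equiv.Perm.ofFn_comp_perm _ _).trans (.trans ?_ (Equiv.Perm.ofFn_comp_perm _ _).symm))
    rwa [List.ofFn_get]
  rw [← symProd_comp_perm _ (Tuple.sort l.get), ← symProd_comp_perm (fun k => g (i k)) (Tuple.sort i)]
  congr 1
  funext k
  exact congrArg g (congrFun h k)

theorem multiset_sum_singleton_ofFn {α : Type*} {N : ℕ} (i : Fin N → α) :
    ∑ k, ({i k} : Multiset α) = (List.ofFn i : List α) := by
  induction N with
  | zero => simp
  | succ N ih =>
    rw [Fin.sum_univ_succ, ih, List.ofFn_succ, ← Multiset.cons_coe, Multiset.singleton_add]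

/-- The symmetrized product as a multilinear map. -/
def symProdMultilinear (B : Type*) [Ring B] [Algebra ℂ B] (N : ℕ) :
    MultilinearMap ℂ (fun _ : Fin N => B) B :=
  ((N.factorial : ℂ)⁻¹) • ∑ σ : Equiv.Perm (Fin N),
    (MultilinearMap.mkPiAlgebraFin ℂ N B).domDomCongr σ

theorem symProdMultilinear_apply {N : ℕ} (u : Fin N → B) :
    symProdMultilinear B N u = symProd u := by
  simp [symProdMultilinear, symProd]

end SymProd

/-- Both sides are multilinear in `u`; on basis vectors the product is a monomial, where the
definition of `symmetrization` applies. -/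
theorem symmetrization_prod_lin {N : ℕ} (u : Fin N → H) :
    symmetrization e (∏ k, lin e (u k)) = symProd fun k => (inc (u k) : U H) := by
  have : (symmetrization e).compMultilinearMap
      ((MultilinearMap.mkPiAlgebra ℂ (Fin N) (MvPolynomial (Fin n) ℂ)).compLinearMap
        fun _ => lin e) = (symProdMultilinear (U H) N).compLinearMap fun _ => inc := by
    refine Module.Basis.ext_multilinear (fun _ => e) fun i => ?_
    simp only [LinearMap.compMultilinearMap_apply, MultilinearMap.compLinearMap_apply,
      MultilinearMap.mkPiAlgebra_apply, symProdMultilinear_apply, lin_basis]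
    have hm : (∏ k, MvPolynomial.X (i k) : MvPolynomial (Fin n) ℂ) =
        MvPolynomial.basisMonomials (Fin n) ℂ (∑ k, Finsupp.single (i k) 1) := by
      rw [MvPolynomial.coe_basisMonomials]
      exact (MvPolynomial.monomial_sum_one _ _).symm
    rw [hm, symmetrization, Module.Basis.constr_basis]
    refine symProd_get_eq (fun j => (inc (e j) : U H)) i _ ?_
    rw [← Multiset.coe_eq_coe, Multiset.coe_toList, map_sum]
    simp only [Finsupp.toMultiset_single, one_smul]
    exact multiset_sum_singleton_ofFn i
  have h := congrArg (fun F => F u) this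
  simpa [symProdMultilinear_apply] using h

/-- For equal factors all orderings coincide. As powers of linear forms span the polynomials, most
identities below are checked only on them. -/
theorem symmetrization_lin_pow (y : H) (N : ℕ) :
    symmetrization e (lin e y ^ N) = inc y ^ N := by
  have := symmetrization_prod_lin e (fun _ : Fin N => y)
  rwa [Finset.prod_const, Finset.card_univ, Fintype.card_fin, symProd_const] at this

/-! ## Surjectivity of symmetrization -/

theorem inc_mul_inc_sub (x y : H) : (inc x : U H) * inc y - inc y * inc x = inc ⁅x, y⁆ := by
  simp only [inc, LieHom.coe_toLinearMap, LieHom.map_lie, LieRing.of_associative_ring_bracket]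

/-- The span of the products of `N` elements of `H`. -/
def wordSpan (H : Type*) [LieRing H] [LieAlgebra ℂ H] (N : ℕ) : Submodule ℂ (U H) :=
  Submodule.span ℂ {u | ∃ l : List H, l.length ≤ N ∧ u = (l.map inc).prod}

theorem prod_mem_wordSpan (l : List H) {N : ℕ} (h : l.length ≤ N) :
    (l.map inc).prod ∈ wordSpan H N := Submodule.subset_span ⟨l, h, rfl⟩

theorem wordSpan_mono {M N : ℕ} (h : M ≤ N) : wordSpan H M ≤ wordSpan H N :=
  Submodule.span_mono fun _ ⟨l, hl, hu⟩ => ⟨l, hl.trans h, hu⟩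

theorem inc_mul_mem_wordSpan (x : H) {N : ℕ} {u : U H} (hu : u ∈ wordSpan H N) :
    inc x * u ∈ wordSpan H (N + 1) := by
  induction hu using Submodule.span_induction with
  | mem u h =>
    obtain ⟨l, hl, rfl⟩ := h
    exact prod_mem_wordSpan (x :: l) (by simpa using hl)
  | zero => simp
  | add a b _ _ ha hb => rw [mul_add]; exact Submodule.add_mem _ ha hb
  | smul c a _ ha => rw [mul_smul_comm]; exact Submodule.smul_mem _ _ ha

/-- Exchanging two neighbours changes a word by one in which their bracket replaces them, which is
one letter shorter; such exchanges generate all rearrangements. -/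
theorem prod_sub_prod_mem_wordSpan {l l' : List H} (h : l.Perm l') :
    (l.map inc).prod - (l'.map inc).prod ∈ wordSpan H (l.length - 1) := by
  induction h with
  | nil => simp
  | @cons x l₁ l₂ h ih =>
    rw [List.map_cons, List.map_cons, List.prod_cons, List.prod_cons, ← mul_sub]
    rcases Nat.eq_zero_or_pos l₁.length with h0 | h0
    · rw [List.length_eq_zero_iff] at h0
      subst h0
      simp [h.nil_eq.symm]
    · have := inc_mul_mem_wordSpan x ih
      rwa [Nat.sub_add_cancel h0] at this
  | swap x y l =>
    simp only [List.map_cons, List.prod_cons]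
    rw [← mul_assoc, ← mul_assoc, ← sub_mul, inc_mul_inc_sub]
    exact prod_mem_wordSpan (⁅y, x⁆ :: l) (by simp)
  | @trans l₁ l₂ l₃ h₁ _ ih₁ ih₂ =>
    rw [← h₁.length_eq] at ih₂
    simpa using Submodule.add_mem _ ih₁ ih₂

/-- A word minus its symmetrization is the average of its differences with its rearrangements, hence
a combination of shorter words, to which induction applies. -/
theorem wordSpan_le_range (N : ℕ) : wordSpan H N ≤ LinearMap.range (symmetrization e) := by
  induction N with
  | zero =>
    refine Submodule.span_le.2 ?_
    rintro _ ⟨l, hl, rfl⟩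
    rw [Nat.le_zero, List.length_eq_zero_iff] at hl
    subst hl
    exact ⟨lin e 0 ^ 0, by rw [symmetrization_lin_pow]; simp⟩
  | succ N ih =>
    refine Submodule.span_le.2 ?_
    rintro _ ⟨l, hl, rfl⟩
    have h1 : (l.map inc).prod - symProd (fun k => (inc (l.get k) : U H)) ∈ wordSpan H N := by
      have hf : (l.length.factorial : ℂ) ≠ 0 := by exact_mod_cast l.length.factorial_ne_zero
      have : (l.map inc).prod - symProd (fun k => (inc (l.get k) : U H)) =
          ((l.length.factorial : ℂ)⁻¹) • ∑ σ : Equiv.Perm (Fin l.length),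
            ((l.map inc).prod - (((List.ofFn fun k => l.get (σ k)).map inc).prod : U H)) := by
        rw [Finset.sum_sub_distrib, Finset.sum_const, Finset.card_univ, Fintype.card_perm,
          Fintype.card_fin, smul_sub, ← Nat.cast_smul_eq_nsmul ℂ, smul_smul, inv_mul_cancel₀ hf,
          one_smul, symProd]
        simp only [List.map_ofFn, Function.comp_def]
      rw [this]
      refine Submodule.smul_mem _ _ (Submodule.sum_mem _ fun σ _ => ?_)
      refine wordSpan_mono (by omega) (prod_sub_prod_mem_wordSpan ?_)
      have := Equiv.Perm.ofFn_comp_perm σ l.get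
      rw [List.ofFn_get] at this
      exact this.symm
    have h2 := ih h1
    have h3 : symProd (fun k => (inc (l.get k) : U H)) ∈ LinearMap.range (symmetrization e) :=
      ⟨_, symmetrization_prod_lin e l.get⟩
    simpa using Submodule.add_mem _ h2 h3

/-- The subalgebra generated by `H` is everything: by the universal property, the map induced by `H`
into it, followed by the inclusion, is the identity. Left multiplications by `H` therefore reach all
of `U H` from `1`. -/
theorem induction_enveloping {p : U H → Prop} (h1 : p 1)
    (hmul : ∀ x u, p u → p (inc x * u)) (hadd : ∀ u v, p u → p v → p (u + v))
    (hsmul : ∀ (c : ℂ) u, p u → p (c • u)) (u : U H) : p u := by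
  let S : Submodule ℂ (U H) :=
    { carrier := {u | p u}
      add_mem' := fun {a b} ha hb => hadd a b ha hb
      zero_mem' := by simpa using hsmul 0 1 h1
      smul_mem' := fun c u hu => hsmul c u hu }
  have hA : Algebra.adjoin ℂ (Set.range (inc : H → U H)) = ⊤ := by
    set A := Algebra.adjoin ℂ (Set.range (inc : H → U H)) with hA
    let f : H →ₗ⁅ℂ⁆ A :=
      { toFun := fun x => ⟨inc x, Algebra.subset_adjoin ⟨x, rfl⟩⟩
        map_add' := fun x y => Subtype.ext (map_add _ _ _)
        map_smul' := fun c x => Subtype.ext (map_smul _ _ _)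
        map_lie' := fun {x y} => Subtype.ext (inc_mul_inc_sub x y).symm }
    have hid : A.val.comp (UniversalEnvelopingAlgebra.lift ℂ f) = AlgHom.id ℂ (U H) := by
      ext x
      simp [f, inc]
    rw [eq_top_iff]
    intro u _
    have := congrArg (fun φ => φ u) hid
    simp only [AlgHom.comp_apply, AlgHom.id_apply] at this
    rw [← this]
    exact (UniversalEnvelopingAlgebra.lift ℂ f u).2
  have key : ∀ a ∈ Algebra.adjoin ℂ (Set.range (inc : H → U H)), ∀ v ∈ S, a * v ∈ S := by
    intro a ha
    induction ha using Algebra.adjoin_induction with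
    | mem a h => obtain ⟨x, rfl⟩ := h; exact fun v hv => hmul x v hv
    | algebraMap c =>
      intro v hv
      rw [← Algebra.smul_def]
      exact S.smul_mem c hv
    | add a b _ _ ha hb => exact fun v hv => by rw [add_mul]; exact S.add_mem (ha v hv) (hb v hv)
    | mul a b _ _ ha hb => exact fun v hv => by rw [mul_assoc]; exact ha _ (hb v hv)
  have := key u (hA ▸ Algebra.mem_top) 1 h1
  rwa [mul_one] at this

theorem symmetrization_surjective : Function.Surjective (symmetrization e) := by
  intro u
  suffices ∃ N, u ∈ wordSpan H N by
    obtain ⟨N, hN⟩ := this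
    exact wordSpan_le_range e N hN
  refine induction_enveloping (p := fun u => ∃ N, u ∈ wordSpan H N)
    ⟨0, prod_mem_wordSpan [] (by simp)⟩ ?_ ?_ ?_ u
  · rintro x u ⟨N, hN⟩
    exact ⟨N + 1, inc_mul_mem_wordSpan x hN⟩
  · rintro u v ⟨M, hM⟩ ⟨N, hN⟩
    exact ⟨max M N, Submodule.add_mem _ (wordSpan_mono (le_max_left _ _) hM)
      (wordSpan_mono (le_max_right _ _) hN)⟩
  · rintro c u ⟨N, hN⟩
    exact ⟨N, Submodule.smul_mem _ _ hN⟩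

end Lin

/-! ## An identity for Bernoulli numbers -/

/-- The coefficients `Bₖ / k!` of `x / (eˣ - 1)`. -/
def bernCoeff (k : ℕ) : ℂ := algebraMap ℚ ℂ (bernoulli k / k.factorial)

theorem bernCoeff_zero : bernCoeff 0 = 1 := by simp [bernCoeff]

theorem bernCoeff_one : bernCoeff 1 = -1 / 2 := by simp [bernCoeff]

theorem bernCoeff_odd {k : ℕ} (h : Odd k) (hk : 1 < k) : bernCoeff k = 0 := by
  simp [bernCoeff, bernoulli_eq_zero_of_odd h hk]

/-! ### The functional equation of `x / (eˣ - 1)` -/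

section FunctionalEquation

variable {R : Type*} [CommRing R] [Algebra ℚ R] [IsDomain R]

-- After clearing the denominators `e^{sx} - 1`, `e^{tx} - 1` and `e^{(s+t)x} - 1`, only `e^{sx}
-- e^{tx} = e^{(s+t)x}` is needed. This equation is what makes the Bernoulli coefficients define a
-- Lie algebra action.
open PowerSeries in
theorem bernoulli_functional_equation {s t : R} (hs : s ≠ 0) (ht : t ≠ 0) (hst : s + t ≠ 0) :
    C t * (rescale s (bernoulliPowerSeries R) *
        (rescale (s + t) (bernoulliPowerSeries R) - rescale t (bernoulliPowerSeries R))) +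
      C s * (rescale t (bernoulliPowerSeries R) *
        (rescale (s + t) (bernoulliPowerSeries R) - rescale s (bernoulliPowerSeries R))) =
      -(C (s * t) * X * rescale (s + t) (bernoulliPowerSeries R)) := by
  have hE : ∀ a : R, rescale a (bernoulliPowerSeries R) * (rescale a (exp R) - 1) = C a * X := by
    intro a
    have := congrArg (rescale a) (bernoulliPowerSeries_mul_exp_sub_one R)
    simpa [rescale_X] using this
  have hX : (X : R⟦X⟧) ≠ 0 := X_ne_zero
  have hC : ∀ a : R, a ≠ 0 → (C a : R⟦X⟧) ≠ 0 := fun a ha h => ha (by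
    have := congrArg constantCoeff h
    simpa using this)
  have hne : ∀ a : R, a ≠ 0 → (rescale a (exp R) - 1 : R⟦X⟧) ≠ 0 := by
    intro a ha h
    have := hE a
    rw [h, mul_zero] at this
    exact mul_ne_zero (hC a ha) hX this.symm
  have hadd : rescale s (exp R) * rescale t (exp R) = rescale (s + t) (exp R) :=
    exp_mul_exp_eq_exp_add s t
  have h1 := hE s
  have h2 := hE t
  have h3 := hE (s + t)
  rw [← hadd] at h3
  have n1 := hne s hs
  have n2 := hne t ht
  have n3 := hne (s + t) hst
  rw [← hadd] at n3
  simp only [map_add, map_mul] at h3 ⊢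
  generalize rescale s (bernoulliPowerSeries R) = α at *
  generalize rescale t (bernoulliPowerSeries R) = β at *
  generalize rescale (s + t) (bernoulliPowerSeries R) = γ at *
  generalize rescale s (exp R) = u at *
  generalize rescale t (exp R) = v at *
  generalize (C s : R⟦X⟧) = S at *
  generalize (C t : R⟦X⟧) = T at *
  -- The three denominators are non-zero in a domain, so it suffices to prove the equation
  -- multiplied by them; there it is a combination of their defining relations.
  refine mul_right_cancel₀ (mul_ne_zero (mul_ne_zero n1 n2) n3) ?_
  linear_combination (T * γ * (u * v - 1) * (v - 1) - T * β * (v - 1) * (u * v - 1)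
      - S * β * (v - 1) * (u * v - 1)) * h1
    + (S * γ * (u * v - 1) * (u - 1) - T * S * X * (u * v - 1) - S * S * X * (u * v - 1)) * h2
    + (T * S * X * (v - 1) + S * T * X * (u - 1) + S * T * X * (u - 1) * (v - 1)) * h3

end FunctionalEquation

/-! ### The identity on coefficients, and its form in a Lie algebra -/

section TwoVariables

open MvPolynomial

theorem pow_succ_sub_pow_succ {R : Type*} [CommRing R] (s t : R) (k : ℕ) :
    (s + t) ^ (k + 1) - t ^ (k + 1) =
      s * ∑ q ∈ antidiagonal k, (s + t) ^ q.1 * t ^ q.2 := by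
  rw [Finset.Nat.sum_antidiagonal_eq_sum_range_succ (fun i j => (s + t) ^ i * t ^ j)]
  have := (Commute.all (s + t) t).geom_sum₂_mul (k + 1)
  rw [add_sub_cancel_right, mul_comm] at this
  rw [← this, Nat.add_sub_cancel]

/-- The coefficient of `x ^ (m + 1)` in `bernoulli_functional_equation` for two indeterminates. Each
difference of powers is divisible by one indeterminate (`pow_succ_sub_pow_succ`), so the common
factor `X 0 * X 1` can be cancelled. -/
theorem bernCoeff_identity (m : ℕ) :
    ∑ p ∈ antidiagonal m, C (bernCoeff p.2 * bernCoeff (p.1 + 1)) *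
      ∑ q ∈ antidiagonal p.1, (X 0 + X 1) ^ q.1 *
        (X 0 ^ p.2 * X 1 ^ q.2 + X 0 ^ q.2 * X 1 ^ p.2) =
      -(C (bernCoeff m) * (X 0 + X 1) ^ m : MvPolynomial (Fin 2) ℂ) := by
  have hs : (X 0 : MvPolynomial (Fin 2) ℂ) ≠ 0 := X_ne_zero _
  have ht : (X 1 : MvPolynomial (Fin 2) ℂ) ≠ 0 := X_ne_zero _
  have hst : (X 0 + X 1 : MvPolynomial (Fin 2) ℂ) ≠ 0 := by
    intro h
    have := congrArg (eval ![1, 0]) h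
    simp at this
  have h := congrArg (PowerSeries.coeff (m + 1)) (bernoulli_functional_equation hs ht hst)
  have hb : ∀ k, PowerSeries.coeff k (bernoulliPowerSeries (MvPolynomial (Fin 2) ℂ)) =
      C (bernCoeff k) := by
    intro k
    rw [bernoulliPowerSeries, PowerSeries.coeff_mk, IsScalarTower.algebraMap_apply ℚ ℂ]
    rfl
  rw [map_neg, mul_assoc (PowerSeries.C _), PowerSeries.coeff_C_mul, PowerSeries.coeff_succ_X_mul,
    map_add, PowerSeries.coeff_C_mul, PowerSeries.coeff_C_mul] at h
  rw [mul_comm (PowerSeries.rescale (X 0) _), mul_comm (PowerSeries.rescale (X 1) _)] at h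
  simp only [PowerSeries.coeff_mul, PowerSeries.coeff_rescale, hb, map_sub,
    Finset.Nat.sum_antidiagonal_succ, pow_zero, sub_self, zero_mul, zero_add, ← sub_mul,
    pow_succ_sub_pow_succ] at h
  have h' : ∀ k, (X 0 + X 1 : MvPolynomial (Fin 2) ℂ) ^ (k + 1) - X 0 ^ (k + 1) =
      X 1 * ∑ q ∈ antidiagonal k, (X 0 + X 1) ^ q.1 * X 0 ^ q.2 := by
    intro k
    rw [add_comm (X 0), pow_succ_sub_pow_succ]
  simp only [h'] at h
  refine mul_left_cancel₀ (mul_ne_zero hs ht) ?_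
  rw [mul_neg, mul_comm (C (bernCoeff m)), ← h, Finset.mul_sum, Finset.mul_sum, Finset.mul_sum, ← Finset.sum_add_distrib]
  refine Finset.sum_congr rfl fun p _ => ?_
  simp only [Finset.sum_mul, Finset.mul_sum, ← Finset.sum_add_distrib]
  refine Finset.sum_congr rfl fun q _ => ?_
  rw [C_mul]
  ring

variable {H : Type*} [LieRing H] [LieAlgebra ℂ H]

/-- Send `X 0 ^ a * X 1 ^ b` to the bracket of `ad(y)^a x` and `ad(y)^b z`. Since `ad y` is a
derivation of the bracket, multiplication by `X 0 + X 1` becomes `ad y`, and the identity is the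
image of `bernCoeff_identity`. -/
theorem bernCoeff_lie (y x z : H) (m : ℕ) :
    ∑ p ∈ antidiagonal m, (bernCoeff p.2 * bernCoeff (p.1 + 1)) •
      ∑ q ∈ antidiagonal p.1,
        ((LieAlgebra.ad ℂ H y ^ q.1) ⁅(LieAlgebra.ad ℂ H y ^ p.2) x, (LieAlgebra.ad ℂ H y ^ q.2) z⁆ -
        (LieAlgebra.ad ℂ H y ^ q.1)
          ⁅(LieAlgebra.ad ℂ H y ^ p.2) z, (LieAlgebra.ad ℂ H y ^ q.2) x⁆) =
      bernCoeff m • (LieAlgebra.ad ℂ H y ^ m) ⁅z, x⁆ := by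
  set A := LieAlgebra.ad ℂ H y with hA
  let Ψ : MvPolynomial (Fin 2) ℂ →ₗ[ℂ] H := (basisMonomials (Fin 2) ℂ).constr ℂ
    fun d => ⁅(A ^ d 0) x, (A ^ d 1) z⁆
  have hΨ : ∀ d, Ψ (monomial d 1) = ⁅(A ^ d 0) x, (A ^ d 1) z⁆ := fun d => by
    exact (basisMonomials (Fin 2) ℂ).constr_basis ℂ _ d
  have hmon : ∀ a b : ℕ, (X 0 ^ a * X 1 ^ b : MvPolynomial (Fin 2) ℂ) =
      monomial (Finsupp.single 0 a + Finsupp.single 1 b) 1 := fun a b => by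
    rw [X_pow_eq_monomial, X_pow_eq_monomial, monomial_mul, one_mul]
  have hΨ' : ∀ a b, Ψ (X 0 ^ a * X 1 ^ b) = ⁅(A ^ a) x, (A ^ b) z⁆ := fun a b => by
    rw [hmon, hΨ]
    simp
  have hmulA : ∀ p, Ψ ((X 0 + X 1) * p) = A (Ψ p) := by
    intro p
    have : Ψ ∘ₗ LinearMap.mulLeft ℂ (X 0 + X 1) = A ∘ₗ Ψ := by
      refine (basisMonomials (Fin 2) ℂ).ext fun d => ?_
      rw [coe_basisMonomials]
      simp only [LinearMap.comp_apply, LinearMap.mulLeft_apply, hΨ, add_mul, map_add, X,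
        monomial_mul, one_mul]
      rw [hA, LieAlgebra.ad_apply, leibniz_lie]
      simp [add_comm 1, pow_succ']
    exact congrArg (fun F => F p) this
  have hpow : ∀ k p, Ψ ((X 0 + X 1) ^ k * p) = (A ^ k) (Ψ p) := by
    intro k
    induction k with
    | zero => simp
    | succ k ih =>
      intro p
      rw [pow_succ', mul_assoc, hmulA, ih, pow_succ', Module.End.mul_apply]
  have h := congrArg Ψ (bernCoeff_identity m)
  simp only [map_sum, map_neg, ← smul_eq_C_mul, map_smul, hpow, mul_add, map_add, hΨ'] at h
  have h1 : Ψ ((X 0 + X 1) ^ m) = (A ^ m) ⁅x, z⁆ := by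
    have := hpow m (X 0 ^ 0 * X 1 ^ 0)
    rw [hΨ'] at this
    simpa using this
  rw [h1, ← smul_neg, ← map_neg, lie_skew] at h
  rw [← h]
  refine Finset.sum_congr rfl fun p _ => ?_
  congr 1
  refine Finset.sum_congr rfl fun q _ => ?_
  rw [sub_eq_add_neg, ← map_neg, lie_skew]

end TwoVariables

/-! ## The action of `H` on polynomials and the PBW theorem -/

theorem sum_range_sum_range_eq_sum_antidiagonal {V : Type*} [AddCommMonoid V] (K : ℕ)
    (F : ℕ → ℕ → V) (hF : ∀ a b, K ≤ a + b → F a b = 0) :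
    ∑ a ∈ Finset.range K, ∑ b ∈ Finset.range K, F a b =
      ∑ M ∈ Finset.range K, ∑ p ∈ antidiagonal M, F p.1 p.2 := by
  rw [← Finset.sum_product' (f := F)]
  have h1 : ∑ x ∈ Finset.range K ×ˢ Finset.range K, F x.1 x.2 =
      ∑ x ∈ (Finset.range K ×ˢ Finset.range K).filter (fun p => p.1 + p.2 < K), F x.1 x.2 := by
    symm
    refine Finset.sum_filter_of_ne fun x _ hx => ?_
    by_contra h
    exact hx (hF _ _ (not_lt.1 h))
  rw [h1, ← Finset.sum_fiberwise_of_maps_to (g := fun p : ℕ × ℕ => p.1 + p.2)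
    (t := Finset.range K) (fun x hx => by simpa using (Finset.mem_filter.1 hx).2)]
  refine Finset.sum_congr rfl fun M hM => Finset.sum_congr ?_ fun _ _ => rfl
  ext ⟨a, b⟩
  simp only [Finset.mem_filter, Finset.mem_product, Finset.mem_range,
    Finset.HasAntidiagonal.mem_antidiagonal] at hM ⊢
  omega

section Action

variable {n : ℕ} {H : Type*} [LieRing H] [LieAlgebra ℂ H] (e : Module.Basis (Fin n) ℂ H)

/-- The divided power `y^m / m!`, which is zero for negative `m`. -/
def divPow (y : H) (m : ℤ) : MvPolynomial (Fin n) ℂ :=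
  if m < 0 then 0 else ((m.toNat.factorial : ℂ)⁻¹) • lin e y ^ m.toNat

theorem divPow_of_neg (y : H) {m : ℤ} (hm : m < 0) : divPow e y m = 0 := if_pos hm

theorem divPow_natCast (y : H) (N : ℕ) :
    divPow e y N = ((N.factorial : ℂ)⁻¹) • lin e y ^ N := by
  simp [divPow]

theorem lin_pow_eq (y : H) (N : ℕ) : lin e y ^ N = (N.factorial : ℂ) • divPow e y N := by
  rw [divPow_natCast, smul_smul, mul_inv_cancel₀ (by exact_mod_cast N.factorial_ne_zero), one_smul]

theorem ext_divPow {V : Type*} [AddCommGroup V] [Module ℂ V]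
    {A B : MvPolynomial (Fin n) ℂ →ₗ[ℂ] V}
    (h : ∀ y (N : ℕ), A (divPow e y N) = B (divPow e y N)) : A = B :=
  ext_lin_pow e fun y N => by rw [lin_pow_eq, map_smul, map_smul, h]

theorem pderiv_lin (i : Fin n) (y : H) :
    MvPolynomial.pderiv i (lin e y) = MvPolynomial.C (e.repr y i) := by
  rw [lin_apply, map_sum, Finset.sum_eq_single i]
  · rw [Derivation.map_smul, MvPolynomial.pderiv_X_self, MvPolynomial.smul_eq_C_mul, mul_one]
  · intro j _ hj
    rw [Derivation.map_smul, MvPolynomial.pderiv_X_of_ne hj, smul_zero]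
  · simp

/-- Divided powers absorb the factor produced by differentiation, and the convention for negative
exponents lets the rule hold for every integer `m`. -/
theorem pderiv_divPow (i : Fin n) (y : H) (m : ℤ) :
    MvPolynomial.pderiv i (divPow e y m) = e.repr y i • divPow e y (m - 1) := by
  rcases lt_or_ge m 0 with hm | hm
  · rw [divPow_of_neg e y hm, divPow_of_neg e y (by omega), map_zero, smul_zero]
  obtain ⟨N, rfl⟩ := Int.eq_ofNat_of_zero_le hm
  rcases N with _ | N
  · rw [divPow_of_neg e y (m := ((0 : ℕ) : ℤ) - 1) (by simp)]
    simp [divPow]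
  have h : ((N + 1 : ℕ) : ℤ) - 1 = (N : ℕ) := by push_cast; ring
  rw [h, divPow_natCast, divPow_natCast, Derivation.map_smul, Derivation.leibniz_pow, pderiv_lin,
    Nat.factorial_succ, Nat.add_sub_cancel, smul_eq_mul, mul_comm _ (MvPolynomial.C _),
    ← MvPolynomial.smul_eq_C_mul, ← Nat.cast_smul_eq_nsmul ℂ, smul_smul, smul_smul, smul_smul]
  congr 1
  push_cast
  have : (N + 1 : ℂ) ≠ 0 := by exact_mod_cast N.succ_ne_zero
  field_simp

/-- The operator `∑ᵢ ad(eᵢ) ⊗ ∂ᵢ`. -/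
def adGrad : H ⊗[ℂ] MvPolynomial (Fin n) ℂ →ₗ[ℂ] H ⊗[ℂ] MvPolynomial (Fin n) ℂ :=
  ∑ i, TensorProduct.map (LieAlgebra.ad ℂ H (e i)) (MvPolynomial.pderiv i).toLinearMap

theorem adGrad_tmul (x : H) (f : MvPolynomial (Fin n) ℂ) :
    adGrad e (x ⊗ₜ f) = ∑ i, ⁅e i, x⁆ ⊗ₜ MvPolynomial.pderiv i f := by
  simp [adGrad, LinearMap.sum_apply]

/-- The map `x ⊗ f ↦ x f`. -/
def linMul : H ⊗[ℂ] MvPolynomial (Fin n) ℂ →ₗ[ℂ] MvPolynomial (Fin n) ℂ :=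
  TensorProduct.lift ((LinearMap.mul ℂ (MvPolynomial (Fin n) ℂ)).comp (lin e))

@[simp] theorem linMul_tmul (x : H) (f : MvPolynomial (Fin n) ℂ) :
    linMul e (x ⊗ₜ f) = lin e x * f := rfl

/-- The part of degree `1 - k` of the action of `x ∈ H` on polynomials. -/
def actCoeff (k : ℕ) : H →ₗ[ℂ] Module.End ℂ (MvPolynomial (Fin n) ℂ) where
  toFun x := bernCoeff k • (linMul e ∘ₗ (adGrad e ^ k) ∘ₗ TensorProduct.mk ℂ H _ x)
  map_add' x y := by
    refine LinearMap.ext fun f => ?_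
    simp
  map_smul' c x := by
    refine LinearMap.ext fun f => ?_
    simp [smul_comm c]

theorem actCoeff_apply (k : ℕ) (x : H) (f : MvPolynomial (Fin n) ℂ) :
    actCoeff e k x f = bernCoeff k • linMul e ((adGrad e ^ k) (x ⊗ₜ f)) := rfl

theorem sum_repr_tmul (y x : H) (g : MvPolynomial (Fin n) ℂ) :
    ∑ i, ⁅e i, x⁆ ⊗ₜ[ℂ] (e.repr y i • g) = ⁅y, x⁆ ⊗ₜ g := by
  conv_rhs => rw [← e.sum_repr y]
  simp only [sum_lie, smul_lie, TensorProduct.sum_tmul, TensorProduct.smul_tmul]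

/-- The gradient of a power of `y` brings out the coordinates of `y`, which reassemble the basis
vectors into `y`; so on powers of `y` the operator is just `ad y` on the first factor. -/
theorem adGrad_tmul_divPow (x y : H) (m : ℤ) :
    adGrad e (x ⊗ₜ divPow e y m) = ⁅y, x⁆ ⊗ₜ divPow e y (m - 1) := by
  simp only [adGrad_tmul, pderiv_divPow, sum_repr_tmul]

theorem adGrad_pow_tmul_divPow (k : ℕ) (x y : H) (m : ℤ) :
    (adGrad e ^ k) (x ⊗ₜ divPow e y m) =
      (LieAlgebra.ad ℂ H y ^ k) x ⊗ₜ divPow e y (m - k) := by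
  induction k with
  | zero => simp
  | succ k ih =>
    rw [pow_succ', Module.End.mul_apply, ih, adGrad_tmul_divPow, pow_succ', Module.End.mul_apply,
      LieAlgebra.ad_apply]
    congr 2
    push_cast
    ring

/-- Thus the Taylor coefficients of `z / (e^z - 1)` at `z = ad y` are applied to `x`, the `k`-th one
with a drop of `k` in the exponent of `y`. -/
theorem actCoeff_divPow (k : ℕ) (x y : H) (m : ℤ) :
    actCoeff e k x (divPow e y m) =
      bernCoeff k • (lin e ((LieAlgebra.ad ℂ H y ^ k) x) * divPow e y (m - k)) := by
  rw [actCoeff_apply, adGrad_pow_tmul_divPow, linMul_tmul]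

theorem adGrad_tmul_lin_mul_divPow (z x y : H) (m : ℤ) :
    adGrad e (z ⊗ₜ (lin e x * divPow e y m)) =
      ⁅y, z⁆ ⊗ₜ (lin e x * divPow e y (m - 1)) + ⁅x, z⁆ ⊗ₜ divPow e y m := by
  simp only [adGrad_tmul, Derivation.leibniz, pderiv_divPow, pderiv_lin, smul_eq_mul,
    mul_smul_comm, TensorProduct.tmul_add, Finset.sum_add_distrib, sum_repr_tmul]
  congr 1
  simp only [mul_comm _ (MvPolynomial.C _), ← MvPolynomial.smul_eq_C_mul, sum_repr_tmul]

/-- Leibniz: a linear factor can be differentiated only once. In the second term, `q.2` counts the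
steps before this happens and `q.1` those after it. -/
theorem adGrad_pow_succ_tmul_lin_mul_divPow (k : ℕ) (z x y : H) (m : ℤ) :
    (adGrad e ^ (k + 1)) (z ⊗ₜ (lin e x * divPow e y m)) =
      (LieAlgebra.ad ℂ H y ^ (k + 1)) z ⊗ₜ (lin e x * divPow e y (m - (k + 1 : ℕ))) +
      (∑ q ∈ antidiagonal k, (LieAlgebra.ad ℂ H y ^ q.1) ⁅x, (LieAlgebra.ad ℂ H y ^ q.2) z⁆) ⊗ₜ
        divPow e y (m - k) := by
  induction k with
  | zero => simp [adGrad_tmul_lin_mul_divPow]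
  | succ k ih =>
    rw [pow_succ', Module.End.mul_apply, ih, map_add, adGrad_tmul_lin_mul_divPow,
      adGrad_tmul_divPow, Finset.Nat.sum_antidiagonal_succ, pow_succ' (LieAlgebra.ad ℂ H y) (k + 1),
      Module.End.mul_apply, LieAlgebra.ad_apply, add_assoc, TensorProduct.add_tmul]
    have h1 : m - ((k + 1 + 1 : ℕ) : ℤ) = m - ((k + 1 : ℕ) : ℤ) - 1 := by push_cast; ring
    have h2 : m - (k : ℤ) - 1 = m - ((k + 1 : ℕ) : ℤ) := by push_cast; ring
    rw [h1, h2]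
    congr 3
    rw [← LieAlgebra.ad_apply ℂ, map_sum]
    simp only [pow_succ', Module.End.mul_apply]

/-- The representation property, one degree at a time. On powers of `y`, the terms that keep both
linear factors are symmetric in `x` and `z` and cancel; what remains is exactly `bernCoeff_lie`. -/
theorem sum_actCoeff_commutator (z x : H) (m : ℕ) (f : MvPolynomial (Fin n) ℂ) :
    ∑ p ∈ antidiagonal (m + 1),
      (actCoeff e p.1 z (actCoeff e p.2 x f) - actCoeff e p.1 x (actCoeff e p.2 z f)) =
      actCoeff e m ⁅z, x⁆ f := by
  suffices h : ∑ p ∈ antidiagonal (m + 1), (actCoeff e p.1 z ∘ₗ actCoeff e p.2 x -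
      actCoeff e p.1 x ∘ₗ actCoeff e p.2 z) = actCoeff e m ⁅z, x⁆ by
    have := congrArg (fun F => F f) h
    simpa [LinearMap.sum_apply] using this
  refine ext_divPow e fun y N => ?_
  generalize (N : ℤ) = N
  have key : ∀ z x : H, ∑ p ∈ antidiagonal (m + 1),
      actCoeff e p.1 z (actCoeff e p.2 x (divPow e y N)) =
      ∑ p ∈ antidiagonal (m + 1), (bernCoeff p.1 * bernCoeff p.2) •
        (lin e ((LieAlgebra.ad ℂ H y ^ p.1) z) * lin e ((LieAlgebra.ad ℂ H y ^ p.2) x) *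
          divPow e y (N - (m + 1 : ℕ))) +
      lin e (∑ p ∈ antidiagonal m, (bernCoeff p.2 * bernCoeff (p.1 + 1)) •
        ∑ q ∈ antidiagonal p.1, (LieAlgebra.ad ℂ H y ^ q.1)
          ⁅(LieAlgebra.ad ℂ H y ^ p.2) x, (LieAlgebra.ad ℂ H y ^ q.2) z⁆) * divPow e y (N - m) := by
    intro z x
    rw [Finset.Nat.sum_antidiagonal_succ, Finset.Nat.sum_antidiagonal_succ, add_assoc]
    congr 1
    · rw [actCoeff_divPow, map_smul, actCoeff_apply, pow_zero, Module.End.one_apply, linMul_tmul,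
        smul_smul, mul_comm, pow_zero, Module.End.one_apply, mul_assoc]
    · rw [map_sum, Finset.sum_mul, ← Finset.sum_add_distrib]
      refine Finset.sum_congr rfl fun p hp => ?_
      rw [Finset.HasAntidiagonal.mem_antidiagonal] at hp
      rw [actCoeff_divPow, map_smul, actCoeff_apply, adGrad_pow_succ_tmul_lin_mul_divPow, map_add,
        linMul_tmul, linMul_tmul, smul_smul, smul_add, map_smul, smul_mul_assoc]
      have h1 : N - (p.2 : ℤ) - ((p.1 + 1 : ℕ) : ℤ) = N - ((m + 1 : ℕ) : ℤ) := by
        rw [← hp]; push_cast; ring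
      have h2 : N - (p.2 : ℤ) - (p.1 : ℤ) = N - (m : ℤ) := by
        rw [← hp]; push_cast; ring
      rw [h1, h2, mul_assoc, mul_comm (bernCoeff p.2)]
  simp only [LinearMap.sum_apply, LinearMap.sub_apply, LinearMap.comp_apply,
    Finset.sum_sub_distrib, key]
  have hswap : ∑ p ∈ antidiagonal (m + 1), (bernCoeff p.1 * bernCoeff p.2) •
        (lin e ((LieAlgebra.ad ℂ H y ^ p.1) z) * lin e ((LieAlgebra.ad ℂ H y ^ p.2) x) *
          divPow e y (N - (m + 1 : ℕ))) =
      ∑ p ∈ antidiagonal (m + 1), (bernCoeff p.1 * bernCoeff p.2) •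
        (lin e ((LieAlgebra.ad ℂ H y ^ p.1) x) * lin e ((LieAlgebra.ad ℂ H y ^ p.2) z) *
          divPow e y (N - (m + 1 : ℕ))) := by
    rw [← Finset.Nat.sum_antidiagonal_swap]
    refine Finset.sum_congr rfl fun p _ => ?_
    rw [Prod.fst_swap, Prod.snd_swap, mul_comm (bernCoeff _), mul_comm (lin e _) (lin e _)]
  rw [hswap, add_sub_add_left_eq_sub, ← sub_mul, ← map_sub, ← Finset.sum_sub_distrib]
  simp only [← smul_sub, ← Finset.sum_sub_distrib]
  rw [bernCoeff_lie, actCoeff_divPow, map_smul, smul_mul_assoc]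

/-- The `k`-th operator differentiates `k` times, so it kills `y ^ N` once `k > N`. This makes the
infinite sum defining `act` locally finite. -/
theorem exists_actCoeff_eq_zero (x : H) (f : MvPolynomial (Fin n) ℂ) :
    ∃ K, ∀ k, K ≤ k → actCoeff e k x f = 0 := by
  have hf : f ∈ Submodule.span ℂ {f | ∃ (y : H) (N : ℕ), f = lin e y ^ N} := by
    rw [span_lin_pow]; trivial
  induction hf using Submodule.span_induction with
  | mem f h =>
    obtain ⟨y, N, rfl⟩ := h
    refine ⟨N + 1, fun k hk => ?_⟩
    rw [lin_pow_eq, map_smul, actCoeff_divPow, divPow_of_neg e y (by omega), mul_zero, smul_zero,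
      smul_zero]
  | zero => exact ⟨0, fun k _ => map_zero _⟩
  | add f g _ _ hf hg =>
    obtain ⟨K, hK⟩ := hf
    obtain ⟨K', hK'⟩ := hg
    refine ⟨max K K', fun k hk => ?_⟩
    rw [map_add, hK k (by omega), hK' k (by omega), add_zero]
  | smul c f _ hf =>
    obtain ⟨K, hK⟩ := hf
    exact ⟨K, fun k hk => by rw [map_smul, hK k hk, smul_zero]⟩

theorem finsum_eq_sum_range {V : Type*} [AddCommMonoid V] {F : ℕ → V} {K : ℕ}
    (h : ∀ k, K ≤ k → F k = 0) : ∑ᶠ k, F k = ∑ k ∈ Finset.range K, F k := by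
  refine finsum_eq_sum_of_support_subset _ fun k hk => ?_
  by_contra hk'
  exact hk (h k (by simpa using hk'))

/-- The action of `x ∈ H` on polynomials that corresponds, under symmetrization, to left
multiplication by `x` on `U(H)`. -/
def act : H →ₗ[ℂ] Module.End ℂ (MvPolynomial (Fin n) ℂ) where
  toFun x :=
    { toFun := fun f => ∑ᶠ k, actCoeff e k x f
      map_add' := fun f g => by
        obtain ⟨K, hK⟩ := exists_actCoeff_eq_zero e x f
        obtain ⟨K', hK'⟩ := exists_actCoeff_eq_zero e x g
        rw [finsum_eq_sum_range fun k hk => hK k ((le_max_left K K').trans hk),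
          finsum_eq_sum_range fun k hk => hK' k ((le_max_right K K').trans hk),
          finsum_eq_sum_range (K := max K K') fun k hk => by
            rw [map_add, hK k ((le_max_left K K').trans hk), hK' k ((le_max_right K K').trans hk),
              add_zero], ← Finset.sum_add_distrib]
        exact Finset.sum_congr rfl fun k _ => map_add _ _ _
      map_smul' := fun c f => by
        obtain ⟨K, hK⟩ := exists_actCoeff_eq_zero e x f
        rw [finsum_eq_sum_range hK, finsum_eq_sum_range (K := K) fun k hk => by
            rw [map_smul, hK k hk, smul_zero], RingHom.id_apply, Finset.smul_sum]
        exact Finset.sum_congr rfl fun k _ => map_smul _ _ _ }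
  map_add' x y := LinearMap.ext fun f => by
    obtain ⟨K, hK⟩ := exists_actCoeff_eq_zero e x f
    obtain ⟨K', hK'⟩ := exists_actCoeff_eq_zero e y f
    simp only [LinearMap.coe_mk, AddHom.coe_mk, LinearMap.add_apply]
    rw [finsum_eq_sum_range fun k hk => hK k ((le_max_left K K').trans hk),
      finsum_eq_sum_range fun k hk => hK' k ((le_max_right K K').trans hk),
      finsum_eq_sum_range (K := max K K') fun k hk => by
        rw [map_add, LinearMap.add_apply, hK k ((le_max_left K K').trans hk),
          hK' k ((le_max_right K K').trans hk), add_zero], ← Finset.sum_add_distrib]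
    exact Finset.sum_congr rfl fun k _ => by rw [map_add, LinearMap.add_apply]
  map_smul' c x := LinearMap.ext fun f => by
    obtain ⟨K, hK⟩ := exists_actCoeff_eq_zero e x f
    simp only [LinearMap.coe_mk, AddHom.coe_mk, LinearMap.smul_apply, RingHom.id_apply]
    rw [finsum_eq_sum_range hK, finsum_eq_sum_range (K := K) fun k hk => by
        rw [map_smul, LinearMap.smul_apply, hK k hk, smul_zero], Finset.smul_sum]
    exact Finset.sum_congr rfl fun k _ => by rw [map_smul, LinearMap.smul_apply]

theorem act_eq_sum (x : H) {f : MvPolynomial (Fin n) ℂ} {K : ℕ}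
    (h : ∀ k, K ≤ k → actCoeff e k x f = 0) :
    act e x f = ∑ k ∈ Finset.range K, actCoeff e k x f := finsum_eq_sum_range h

theorem exists_act_act_eq (z x : H) (f : MvPolynomial (Fin n) ℂ) :
    ∃ K, ∀ K', K ≤ K' → act e z (act e x f) =
      ∑ M ∈ Finset.range K', ∑ p ∈ antidiagonal M, actCoeff e p.1 z (actCoeff e p.2 x f) := by
  obtain ⟨K, hK⟩ := exists_actCoeff_eq_zero e x f
  have : ∃ L, ∀ b < K, ∀ a, L ≤ a → actCoeff e a z (actCoeff e b x f) = 0 := by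
    choose g hg using fun b => exists_actCoeff_eq_zero e z (actCoeff e b x f)
    exact ⟨(Finset.range K).sup g, fun b hb a ha =>
      hg b a ((Finset.le_sup (Finset.mem_range.2 hb)).trans ha)⟩
  obtain ⟨L, hL⟩ := this
  have hz : ∀ K', K + L ≤ K' → ∀ a b, K' ≤ a + b →
      actCoeff e a z (actCoeff e b x f) = 0 := by
    intro K' hK' a b hab
    rcases lt_or_ge b K with hb | hb
    · exact hL b hb a (by omega)
    · rw [hK b hb, map_zero]
  refine ⟨K + L, fun K' hK' => ?_⟩
  rw [← sum_range_sum_range_eq_sum_antidiagonal K'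
      (fun a b => actCoeff e a z (actCoeff e b x f)) (hz K' hK'),
    act_eq_sum e x (K := K') fun k hk => hK k (by omega), map_sum, Finset.sum_comm]
  exact Finset.sum_congr rfl fun b _ => act_eq_sum e z fun a ha => hz K' hK' a b (by omega)

theorem act_lie (z x : H) (f : MvPolynomial (Fin n) ℂ) :
    act e ⁅z, x⁆ f = act e z (act e x f) - act e x (act e z f) := by
  obtain ⟨K₁, h₁⟩ := exists_act_act_eq e z x f
  obtain ⟨K₂, h₂⟩ := exists_act_act_eq e x z f
  obtain ⟨K₃, h₃⟩ := exists_actCoeff_eq_zero e ⁅z, x⁆ f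
  set K := max K₁ (max K₂ K₃) with hK
  -- The sum on the right has one more term: its term of order zero is the commutator of two
  -- multiplication operators, which vanishes. The others match after a shift of the index by one.
  rw [h₁ (K + 1) (by omega), h₂ (K + 1) (by omega), act_eq_sum e _ (K := K) fun k hk => h₃ k (by omega),
    ← Finset.sum_sub_distrib, Finset.sum_range_succ']
  simp only [← Finset.sum_sub_distrib, sum_actCoeff_commutator]
  simp [actCoeff_apply, mul_left_comm]

/-- The representation of `U(H)` on polynomials that corresponds, under symmetrization, to the left
regular representation. -/
def actU : U H →ₐ[ℂ] Module.End ℂ (MvPolynomial (Fin n) ℂ) :=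
  UniversalEnvelopingAlgebra.lift ℂ
    { toLinearMap := act e
      map_lie' := fun {x y} => LinearMap.ext fun f => act_lie e x y f }

@[simp] theorem actU_inc (x : H) : actU e (inc x) = act e x :=
  UniversalEnvelopingAlgebra.lift_ι_apply ℂ _ x

/-- Every term with `k ≥ 1` contains `⁅y, y⁆`; only multiplication by `y` remains. -/
theorem act_self_lin_pow (y : H) (N : ℕ) : act e y (lin e y ^ N) = lin e y ^ (N + 1) := by
  have h : ∀ k, 1 ≤ k → actCoeff e k y (lin e y ^ N) = 0 := by
    intro k hk
    obtain ⟨k, rfl⟩ := Nat.exists_eq_add_of_le' hk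
    rw [lin_pow_eq, map_smul, actCoeff_divPow, pow_succ, Module.End.mul_apply, LieAlgebra.ad_apply,
      lie_self, map_zero, map_zero, zero_mul, smul_zero, smul_zero]
  rw [act_eq_sum e y h, Finset.sum_range_one, actCoeff_apply, pow_zero, Module.End.one_apply,
    linMul_tmul, bernCoeff_zero, one_smul, pow_succ']

/-- The inverse of the symmetrization map. -/
def unsym : U H →ₗ[ℂ] MvPolynomial (Fin n) ℂ :=
  LinearMap.applyₗ (1 : MvPolynomial (Fin n) ℂ) ∘ₗ (actU e).toLinearMap

theorem unsym_apply (u : U H) : unsym e u = actU e u 1 := rfl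

theorem unsym_mul (u v : U H) : unsym e (u * v) = actU e u (unsym e v) := by
  rw [unsym_apply, map_mul, Module.End.mul_apply, unsym_apply]

/-- The element `y ^ N` of the enveloping algebra, acting on the polynomial `1`, produces the
polynomial `y ^ N`. This is the injectivity part of PBW. -/
theorem unsym_symmetrization (f : MvPolynomial (Fin n) ℂ) : unsym e (symmetrization e f) = f := by
  suffices h : unsym e ∘ₗ symmetrization e = LinearMap.id from congrArg (fun F => F f) h
  refine ext_lin_pow e fun y N => ?_
  rw [LinearMap.comp_apply, symmetrization_lin_pow, LinearMap.id_apply]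
  induction N with
  | zero => simp [unsym_apply]
  | succ N ih => rw [pow_succ', unsym_mul, ih, actU_inc, act_self_lin_pow]

theorem symmetrization_unsym (u : U H) : symmetrization e (unsym e u) = u := by
  obtain ⟨f, rfl⟩ := symmetrization_surjective e u
  rw [unsym_symmetrization]

/-- Bijectivity makes the set-theoretic inverse used in `polyStar` equal to a linear map. -/
theorem invFun_symmetrization (u : U H) : Function.invFun (symmetrization e) u = unsym e u := by
  have := Function.invFun_eq (symmetrization_surjective e u)
  rw [← unsym_symmetrization e (Function.invFun (symmetrization e) u), this]

end Action

/-! ## Homogeneous polynomials, with integer degrees -/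

section Homogeneous

variable {n : ℕ}

/-- The homogeneous component of degree `d ∈ ℤ`, which is zero for negative `d`. -/
def homComp (d : ℤ) : MvPolynomial (Fin n) ℂ →ₗ[ℂ] MvPolynomial (Fin n) ℂ :=
  if d < 0 then 0 else MvPolynomial.homogeneousComponent d.toNat

theorem homComp_of_neg {d : ℤ} (hd : d < 0) : homComp (n := n) d = 0 := if_pos hd

theorem homComp_natCast (d : ℕ) :
    homComp (n := n) d = MvPolynomial.homogeneousComponent d := by
  simp [homComp]

theorem homComp_homComp (d d' : ℤ) (f : MvPolynomial (Fin n) ℂ) :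
    homComp d' (homComp d f) = if d' = d then homComp d f else 0 := by
  rcases lt_or_ge d' 0 with h' | h'
  · rw [homComp_of_neg h', LinearMap.zero_apply]
    split_ifs with h
    · rw [← h, homComp_of_neg h', LinearMap.zero_apply]
    · rfl
  rcases lt_or_ge d 0 with h | h
  · rw [homComp_of_neg h, LinearMap.zero_apply, map_zero, ite_self]
  obtain ⟨a, rfl⟩ := Int.eq_ofNat_of_zero_le h
  obtain ⟨b, rfl⟩ := Int.eq_ofNat_of_zero_le h'
  rw [homComp_natCast, homComp_natCast,
    MvPolynomial.homogeneousComponent_of_mem (MvPolynomial.homogeneousComponent_mem a f)]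
  simp

theorem ext_homComp {f g : MvPolynomial (Fin n) ℂ} (h : ∀ d, homComp d f = homComp d g) :
    f = g := by
  ext s
  have := congrArg (MvPolynomial.coeff s) (h (s.degree : ℕ))
  rw [homComp_natCast] at this
  simpa [MvPolynomial.coeff_homogeneousComponent] using this

/-- `f` is homogeneous of degree `d ∈ ℤ` (and zero if `d < 0`). -/
def IsHomog (d : ℤ) (f : MvPolynomial (Fin n) ℂ) : Prop :=
  ∀ d', homComp d' f = if d' = d then f else 0

theorem isHomog_homComp (d : ℤ) (f : MvPolynomial (Fin n) ℂ) : IsHomog d (homComp d f) :=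
  fun d' => homComp_homComp d d' f

theorem IsHomog.homComp_self {d : ℤ} {f : MvPolynomial (Fin n) ℂ} (h : IsHomog d f) :
    homComp d f = f := by rw [h d, if_pos rfl]

theorem IsHomog.eq_zero {d : ℤ} {f : MvPolynomial (Fin n) ℂ} (h : IsHomog d f) (hd : d < 0) :
    f = 0 := by
  rw [← h.homComp_self, homComp_of_neg hd, LinearMap.zero_apply]

theorem isHomog_zero (d : ℤ) : IsHomog d (0 : MvPolynomial (Fin n) ℂ) := fun d' => by simp

theorem IsHomog.add {d : ℤ} {f g : MvPolynomial (Fin n) ℂ} (hf : IsHomog d f) (hg : IsHomog d g) :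
    IsHomog d (f + g) := fun d' => by
  rw [map_add, hf, hg]
  split_ifs <;> simp

theorem IsHomog.smul {d : ℤ} {f : MvPolynomial (Fin n) ℂ} (c : ℂ) (hf : IsHomog d f) :
    IsHomog d (c • f) := fun d' => by
  rw [map_smul, hf]
  split_ifs <;> simp

theorem IsHomog.sum {d : ℤ} {ι : Type*} {s : Finset ι} {f : ι → MvPolynomial (Fin n) ℂ}
    (h : ∀ i ∈ s, IsHomog d (f i)) : IsHomog d (∑ i ∈ s, f i) :=
  Finset.sum_induction _ _ (fun _ _ => IsHomog.add) (isHomog_zero d) h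

theorem isHomog_of_isHomogeneous {d : ℕ} {f : MvPolynomial (Fin n) ℂ} (h : f.IsHomogeneous d) :
    IsHomog d f := fun d' => by
  rcases lt_or_ge d' 0 with h' | h'
  · rw [homComp_of_neg h', if_neg (by omega), LinearMap.zero_apply]
  obtain ⟨b, rfl⟩ := Int.eq_ofNat_of_zero_le h'
  rw [homComp_natCast, MvPolynomial.homogeneousComponent_of_mem h]
  simp

/-- Terms with the same index have the same degree, and different indices have different degrees. In
this way an identity in `U H` yields one for each power of `ħ`. -/
theorem eq_of_sum_range_eq {D : ℤ} {K : ℕ} {u v : ℕ → MvPolynomial (Fin n) ℂ}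
    (h : ∑ M ∈ Finset.range K, u M = ∑ M ∈ Finset.range K, v M)
    (hu : ∀ M : ℕ, IsHomog (D - M) (u M)) (hv : ∀ M : ℕ, IsHomog (D - M) (v M)) {M : ℕ} (hM : M < K) :
    u M = v M := by
  have key : ∀ w : ℕ → MvPolynomial (Fin n) ℂ, (∀ M : ℕ, IsHomog (D - M) (w M)) →
      homComp (D - M) (∑ M ∈ Finset.range K, w M) = w M := by
    intro w hw
    rw [map_sum, Finset.sum_eq_single M]
    · exact (hw M).homComp_self
    · intro j _ hj
      rw [hw j, if_neg (by omega)]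
    · exact fun h => absurd (Finset.mem_range.2 hM) h
  rw [← key u hu, ← key v hv, h]

theorem sum_homComp_eq {D : ℤ} {K : ℕ} (hK : D < K) {F : MvPolynomial (Fin n) ℂ}
    (hF : ∀ d, D < d → homComp d F = 0) :
    ∑ m ∈ Finset.range K, homComp (D - m) F = F := by
  refine ext_homComp fun d => ?_
  rw [map_sum]
  rcases lt_or_ge D d with hd | hd
  · rw [hF d hd]
    refine Finset.sum_eq_zero fun m _ => ?_
    rw [homComp_homComp, if_neg (by omega)]
  rcases lt_or_ge d 0 with h0 | h0
  · simp [homComp_of_neg h0]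
  obtain ⟨m, hm⟩ := Int.eq_ofNat_of_zero_le (sub_nonneg.2 hd)
  rw [Finset.sum_eq_single m]
  · rw [homComp_homComp, if_pos (by omega)]
    congr 2
    omega
  · intro j _ hj
    rw [homComp_homComp, if_neg (by omega)]
  · intro h
    rw [Finset.mem_range] at h
    omega

end Homogeneous

/-! ### The product of the enveloping algebra on polynomials, and its homogeneous parts -/

section StarPoly

variable {n : ℕ} {H : Type*} [LieRing H] [LieAlgebra ℂ H] (e : Module.Basis (Fin n) ℂ H)

theorem isHomogeneous_lin (y : H) : (lin e y).IsHomogeneous 1 := by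
  rw [lin_apply]
  refine MvPolynomial.IsHomogeneous.sum _ _ _ fun i _ => ?_
  rw [MvPolynomial.smul_eq_C_mul]
  simpa using (MvPolynomial.isHomogeneous_C _ _).mul (MvPolynomial.isHomogeneous_X ℂ i)

theorem isHomog_lin_pow (y : H) (N : ℕ) : IsHomog N (lin e y ^ N) :=
  isHomog_of_isHomogeneous (by simpa using (isHomogeneous_lin e y).pow N)

theorem isHomog_lin (y : H) : IsHomog 1 (lin e y) := by
  simpa using isHomog_lin_pow e y 1

theorem isHomog_divPow (y : H) (m : ℤ) : IsHomog m (divPow e y m) := by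
  rcases lt_or_ge m 0 with hm | hm
  · rw [divPow_of_neg e y hm]
    exact isHomog_zero m
  obtain ⟨N, rfl⟩ := Int.eq_ofNat_of_zero_le hm
  rw [divPow_natCast]
  exact (isHomog_lin_pow e y N).smul _

theorem isHomog_lin_mul_divPow (x y : H) (m : ℤ) :
    IsHomog (m + 1) (lin e x * divPow e y m) := by
  rcases lt_or_ge m 0 with hm | hm
  · rw [divPow_of_neg e y hm, mul_zero]
    exact isHomog_zero _
  obtain ⟨N, rfl⟩ := Int.eq_ofNat_of_zero_le hm
  rw [divPow_natCast, mul_smul_comm]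
  refine IsHomog.smul _ ?_
  have := (isHomogeneous_lin e x).mul ((isHomogeneous_lin e y).pow N)
  rw [one_mul, add_comm] at this
  exact_mod_cast isHomog_of_isHomogeneous this

theorem homComp_actCoeff (k : ℕ) (x : H) (d : ℤ) (f : MvPolynomial (Fin n) ℂ) :
    homComp d (actCoeff e k x f) = actCoeff e k x (homComp (d - 1 + k) f) := by
  suffices h : homComp d ∘ₗ actCoeff e k x = actCoeff e k x ∘ₗ homComp (d - 1 + k) from
    congrArg (fun F => F f) h
  refine ext_divPow e fun y N => ?_
  rw [LinearMap.comp_apply, LinearMap.comp_apply, actCoeff_divPow, map_smul,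
    isHomog_lin_mul_divPow, isHomog_divPow]
  by_cases h : d - 1 + k = N
  · rw [if_pos (by omega), if_pos h, actCoeff_divPow]
  · rw [if_neg (by omega), if_neg h, map_zero, smul_zero]

theorem homComp_act_eq_zero (x : H) {D : ℤ} {f : MvPolynomial (Fin n) ℂ}
    (hf : ∀ d, D < d → homComp d f = 0) {d : ℤ} (hd : D + 1 < d) :
    homComp d (act e x f) = 0 := by
  obtain ⟨K, hK⟩ := exists_actCoeff_eq_zero e x f
  rw [act_eq_sum e x hK, map_sum]
  refine Finset.sum_eq_zero fun k _ => ?_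
  rw [homComp_actCoeff, hf _ (by omega), map_zero]

/-- The product of `U(H)` transported to polynomials by symmetrization. -/
def symMul : MvPolynomial (Fin n) ℂ →ₗ[ℂ] Module.End ℂ (MvPolynomial (Fin n) ℂ) :=
  (actU e).toLinearMap ∘ₗ symmetrization e

theorem symMul_apply (f g : MvPolynomial (Fin n) ℂ) :
    symMul e f g = actU e (symmetrization e f) g := rfl

theorem symMul_eq_unsym (f g : MvPolynomial (Fin n) ℂ) :
    symMul e f g = unsym e (symmetrization e f * symmetrization e g) := by
  rw [unsym_mul, unsym_symmetrization, symMul_apply]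

theorem symmetrization_symMul (f g : MvPolynomial (Fin n) ℂ) :
    symmetrization e (symMul e f g) = symmetrization e f * symmetrization e g := by
  rw [symMul_eq_unsym, symmetrization_unsym]

theorem symMul_assoc (f g h : MvPolynomial (Fin n) ℂ) :
    symMul e (symMul e f g) h = symMul e f (symMul e g h) := by
  rw [symMul_eq_unsym e _ h, symMul_eq_unsym e f (symMul e g h), symmetrization_symMul,
    symmetrization_symMul, mul_assoc]

theorem symMul_lin (x : H) : symMul e (lin e x) = act e x := by
  have := symmetrization_lin_pow e x 1
  rw [pow_one, pow_one] at this
  rw [symMul, LinearMap.comp_apply, this]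
  exact actU_inc e x

theorem symMul_lin_pow (y : H) (N : ℕ) : symMul e (lin e y ^ N) = act e y ^ N := by
  rw [symMul, LinearMap.comp_apply, symmetrization_lin_pow, AlgHom.toLinearMap_apply, map_pow,
    actU_inc]

theorem symMul_one : symMul e 1 = 1 := by
  simpa using symMul_lin_pow e 0 0

/-- The product is filtered: acting by a linear form raises the degree by at most one, hence acting
`N` times raises it by at most `N`. -/
theorem homComp_symMul_eq_zero {p q : ℤ} {f g : MvPolynomial (Fin n) ℂ} (hf : IsHomog p f)
    (hg : IsHomog q g) {d : ℤ} (hd : p + q < d) : homComp d (symMul e f g) = 0 := by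
  rw [← hf.homComp_self]
  suffices h : (homComp d) ∘ₗ (LinearMap.applyₗ g) ∘ₗ symMul e ∘ₗ homComp p = 0 from
    congrArg (fun F => F f) h
  refine ext_lin_pow e fun y N => ?_
  simp only [LinearMap.comp_apply, LinearMap.applyₗ_apply_apply, LinearMap.zero_apply]
  rw [isHomog_lin_pow]
  split_ifs with h
  · rw [symMul_lin_pow]
    have : ∀ (N : ℕ) (d : ℤ), q + N < d → homComp d ((act e y ^ N) g) = 0 := by
      intro N
      induction N with
      | zero =>
        intro d hd
        rw [pow_zero, Module.End.one_apply, hg, if_neg]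
        simp at hd
        omega
      | succ N ih =>
        intro d hd
        rw [pow_succ', Module.End.mul_apply]
        exact homComp_act_eq_zero e y ih (by push_cast at hd; omega)
    exact this N d (by omega)
  · simp

/-- A common bound `K` replaces the bounds depending on `f` and `g`, which makes bilinearity
visible; integer degrees take over the case distinction `m ≤ p + q`. -/
theorem polyStar_eq_sum (m K : ℕ) {f g : MvPolynomial (Fin n) ℂ} (hf : f.totalDegree < K)
    (hg : g.totalDegree < K) :
    polyStar e m f g = ∑ p ∈ Finset.range K, ∑ q ∈ Finset.range K,
      homComp (p + q - m) (symMul e (homComp p f) (homComp q g)) := by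
  have hterm : ∀ p q : ℕ, (if m ≤ p + q then
        MvPolynomial.homogeneousComponent (p + q - m)
          (Function.invFun (symmetrization e)
            (symmetrization e (MvPolynomial.homogeneousComponent p f) *
              symmetrization e (MvPolynomial.homogeneousComponent q g))) else 0) =
      homComp ((p : ℤ) + q - m) (symMul e (homComp p f) (homComp q g)) := by
    intro p q
    rw [invFun_symmetrization, homComp_natCast, homComp_natCast, ← symMul_eq_unsym]
    split_ifs with h
    · rw [show (p : ℤ) + q - m = ((p + q - m : ℕ) : ℤ) by omega, homComp_natCast]
    · rw [homComp_of_neg (by omega), LinearMap.zero_apply]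
  unfold polyStar
  simp only [hterm]
  have hz : ∀ {f : MvPolynomial (Fin n) ℂ} {p : ℕ}, f.totalDegree < p → homComp p f = 0 := by
    intro f p hp
    rw [homComp_natCast]
    exact MvPolynomial.homogeneousComponent_eq_zero _ _ hp
  have hsub : ∀ {d : ℕ}, d < K → Finset.range (d + 1) ⊆ Finset.range K :=
    fun h => Finset.range_subset_range.2 h
  rw [Finset.sum_subset (hsub hf)]
  · refine Finset.sum_congr rfl fun p _ => Finset.sum_subset (hsub hg) fun q _ hq => ?_
    rw [hz (f := g) (by simpa using hq), map_zero, map_zero]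
  · intro p _ hp
    rw [hz (by simpa using hp)]
    simp

/-- `polyStar` as a bilinear map. -/
def polyStarₗ (m : ℕ) :
    MvPolynomial (Fin n) ℂ →ₗ[ℂ] MvPolynomial (Fin n) ℂ →ₗ[ℂ] MvPolynomial (Fin n) ℂ :=
  LinearMap.mk₂ ℂ (polyStar e m)
    (fun f f' g => by
      set K := f.totalDegree + f'.totalDegree + g.totalDegree + 1
      have h := MvPolynomial.totalDegree_add f f'
      rw [polyStar_eq_sum e m K (by omega) (by omega),
        polyStar_eq_sum e m K (f := f) (by omega) (by omega),
        polyStar_eq_sum e m K (f := f') (by omega) (by omega)]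
      simp only [map_add, LinearMap.add_apply, Finset.sum_add_distrib])
    (fun c f g => by
      set K := f.totalDegree + g.totalDegree + 1
      have h := MvPolynomial.totalDegree_smul_le c f
      rw [polyStar_eq_sum e m K (by omega) (by omega),
        polyStar_eq_sum e m K (f := f) (by omega) (by omega)]
      simp only [map_smul, LinearMap.smul_apply, Finset.smul_sum])
    (fun f g g' => by
      set K := f.totalDegree + g.totalDegree + g'.totalDegree + 1
      have h := MvPolynomial.totalDegree_add g g'
      rw [polyStar_eq_sum e m K (by omega) (by omega),
        polyStar_eq_sum e m K (g := g) (by omega) (by omega),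
        polyStar_eq_sum e m K (g := g') (by omega) (by omega)]
      simp only [map_add, Finset.sum_add_distrib])
    (fun c f g => by
      set K := f.totalDegree + g.totalDegree + 1
      have h := MvPolynomial.totalDegree_smul_le c g
      rw [polyStar_eq_sum e m K (by omega) (by omega),
        polyStar_eq_sum e m K (g := g) (by omega) (by omega)]
      simp only [map_smul, Finset.smul_sum])

theorem polyStarₗ_apply (m : ℕ) (f g : MvPolynomial (Fin n) ℂ) :
    polyStarₗ e m f g = polyStar e m f g := rfl

theorem polyStarₗ_of_isHomog (m : ℕ) {p q : ℤ} {f g : MvPolynomial (Fin n) ℂ} (hf : IsHomog p f)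
    (hg : IsHomog q g) : polyStarₗ e m f g = homComp (p + q - m) (symMul e f g) := by
  rcases lt_or_ge p 0 with hp | hp
  · rw [hf.eq_zero hp]; simp
  rcases lt_or_ge q 0 with hq | hq
  · rw [hg.eq_zero hq]; simp
  obtain ⟨p, rfl⟩ := Int.eq_ofNat_of_zero_le hp
  obtain ⟨q, rfl⟩ := Int.eq_ofNat_of_zero_le hq
  set K := f.totalDegree + g.totalDegree + p + q + 1
  rw [polyStarₗ_apply, polyStar_eq_sum e m K (by omega) (by omega), Finset.sum_eq_single p,
    Finset.sum_eq_single q, hf.homComp_self, hg.homComp_self]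
  · intro j _ hj
    rw [hg, if_neg (by exact_mod_cast hj), map_zero, map_zero]
  · intro h
    rw [Finset.mem_range] at h
    omega
  · intro j _ hj
    refine Finset.sum_eq_zero fun q _ => ?_
    rw [hf, if_neg (by exact_mod_cast hj), map_zero, LinearMap.zero_apply, map_zero]
  · intro h
    rw [Finset.mem_range] at h
    omega

theorem IsHomog.polyStarₗ {p q : ℤ} {f g : MvPolynomial (Fin n) ℂ} (hf : IsHomog p f)
    (hg : IsHomog q g) (m : ℕ) : IsHomog (p + q - m) (polyStarₗ e m f g) := by
  rw [polyStarₗ_of_isHomog e m hf hg]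
  exact isHomog_homComp _ _

/-- At `ħ = 1` the star-product is the product of `U H`. Conversely, for homogeneous factors the
degree of a component tells which power of `ħ` it belongs to. -/
theorem symMul_eq_sum {p q : ℤ} {f g : MvPolynomial (Fin n) ℂ} (hf : IsHomog p f)
    (hg : IsHomog q g) {K : ℕ} (hK : p + q < K) :
    symMul e f g = ∑ m ∈ Finset.range K, polyStarₗ e m f g := by
  simp only [polyStarₗ_of_isHomog e _ hf hg]
  exact (sum_homComp_eq hK fun d hd => homComp_symMul_eq_zero e hf hg hd).symm

/-- This is the component of degree `p + q + r - m` of associativity in `U H`. -/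
theorem polyStarₗ_assoc_of_isHomog (m : ℕ) {p q r : ℤ} {f g h : MvPolynomial (Fin n) ℂ}
    (hf : IsHomog p f) (hg : IsHomog q g) (hh : IsHomog r h) :
    ∑ a ∈ antidiagonal m, polyStarₗ e a.1 (polyStarₗ e a.2 f g) h =
      ∑ a ∈ antidiagonal m, polyStarₗ e a.1 f (polyStarₗ e a.2 g h) := by
  rcases lt_or_ge p 0 with hp | hp
  · rw [hf.eq_zero hp]; simp
  rcases lt_or_ge q 0 with hq | hq
  · rw [hg.eq_zero hq]; simp
  rcases lt_or_ge r 0 with hr | hr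
  · rw [hh.eq_zero hr]; simp
  obtain ⟨K, hK, hm⟩ : ∃ K : ℕ, p + q + r < K ∧ m < K :=
    ⟨(p + q + r).toNat + m + 1, by omega, by omega⟩
  have hz₁ : ∀ a b, K ≤ a + b → polyStarₗ e a (polyStarₗ e b f g) h = 0 := fun a b hab =>
    IsHomog.eq_zero ((hf.polyStarₗ e hg b).polyStarₗ e hh a) (by omega)
  have hz₂ : ∀ a b, K ≤ a + b → polyStarₗ e a f (polyStarₗ e b g h) = 0 := fun a b hab =>
    IsHomog.eq_zero (hf.polyStarₗ e (hg.polyStarₗ e hh b) a) (by omega)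
  have key := symMul_assoc e f g h
  rw [symMul_eq_sum e hf hg (K := K) (by omega), symMul_eq_sum e hg hh (K := K) (by omega),
    map_sum, map_sum, LinearMap.sum_apply,
    Finset.sum_congr rfl fun b _ => symMul_eq_sum e (hf.polyStarₗ e hg b) hh (K := K) (by omega),
    Finset.sum_congr rfl fun b _ => symMul_eq_sum e hf (hg.polyStarₗ e hh b) (K := K) (by omega),
    Finset.sum_comm,
    sum_range_sum_range_eq_sum_antidiagonal K
      (fun a b => polyStarₗ e a (polyStarₗ e b f g) h) hz₁, Finset.sum_comm,
    sum_range_sum_range_eq_sum_antidiagonal K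
      (fun a b => polyStarₗ e a f (polyStarₗ e b g h)) hz₂] at key
  · refine eq_of_sum_range_eq (D := p + q + r) key (fun M => ?_) (fun M => ?_) hm
    · refine IsHomog.sum fun a ha => ?_
      rw [Finset.HasAntidiagonal.mem_antidiagonal] at ha
      have := (hf.polyStarₗ e hg a.2).polyStarₗ e hh a.1
      rwa [show p + q - a.2 + r - a.1 = p + q + r - M by omega] at this
    · refine IsHomog.sum fun a ha => ?_
      rw [Finset.HasAntidiagonal.mem_antidiagonal] at ha
      have := hf.polyStarₗ e (hg.polyStarₗ e hh a.2) a.1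
      rwa [show p + (q + r - a.2) - a.1 = p + q + r - M by omega] at this

theorem lin_pow_induction {p : MvPolynomial (Fin n) ℂ → Prop} (pow : ∀ y N, p (lin e y ^ N))
    (add : ∀ f g, p f → p g → p (f + g)) (smul : ∀ (c : ℂ) f, p f → p (c • f))
    (f : MvPolynomial (Fin n) ℂ) : p f := by
  have hf : f ∈ Submodule.span ℂ {f | ∃ (y : H) (N : ℕ), f = lin e y ^ N} := by
    rw [span_lin_pow]; trivial
  induction hf using Submodule.span_induction with
  | mem f h => obtain ⟨y, N, rfl⟩ := h; exact pow y N
  | zero => simpa using smul 0 _ (pow 0 0)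
  | add f g _ _ hf hg => exact add f g hf hg
  | smul c f _ hf => exact smul c f hf

theorem polyStarₗ_assoc (m : ℕ) (f g h : MvPolynomial (Fin n) ℂ) :
    ∑ a ∈ antidiagonal m, polyStarₗ e a.1 (polyStarₗ e a.2 f g) h =
      ∑ a ∈ antidiagonal m, polyStarₗ e a.1 f (polyStarₗ e a.2 g h) := by
  induction f using lin_pow_induction e with
  | add f f' hf hf' => simp only [map_add, LinearMap.add_apply, Finset.sum_add_distrib, hf, hf']
  | smul c f hf => simp only [map_smul, LinearMap.smul_apply, ← Finset.smul_sum, hf]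
  | pow y p =>
  induction g using lin_pow_induction e with
  | add f f' hf hf' => simp only [map_add, LinearMap.add_apply, Finset.sum_add_distrib, hf, hf']
  | smul c f hf => simp only [map_smul, LinearMap.smul_apply, ← Finset.smul_sum, hf]
  | pow z q =>
  induction h using lin_pow_induction e with
  | add f f' hf hf' => simp only [map_add, Finset.sum_add_distrib, hf, hf']
  | smul c f hf => simp only [map_smul, ← Finset.smul_sum, hf]
  | pow w r =>
  exact polyStarₗ_assoc_of_isHomog e m (isHomog_lin_pow e y p) (isHomog_lin_pow e z q)
    (isHomog_lin_pow e w r)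

/-- Left multiplication by `x` is `act e x`, and comparing degrees singles out one of its terms.
Star-multiplication by a linear form is thereby an explicit differential operator. -/
theorem polyStarₗ_lin (m : ℕ) (x : H) (f : MvPolynomial (Fin n) ℂ) :
    polyStarₗ e m (lin e x) f = actCoeff e m x f := by
  induction f using lin_pow_induction e with
  | add f g hf hg => rw [map_add, map_add, hf, hg]
  | smul c f hf => rw [map_smul, map_smul, hf]
  | pow y N =>
  have hN := isHomog_lin_pow e y N
  obtain ⟨K, hK⟩ := exists_actCoeff_eq_zero e x (lin e y ^ N)
  rw [polyStarₗ_of_isHomog e m (isHomog_lin e x) hN, symMul_lin,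
    act_eq_sum e x (K := max K (m + 1)) fun k hk => hK k (by omega), map_sum, Finset.sum_eq_single m]
  · rw [homComp_actCoeff, hN, if_pos (by omega)]
  · intro j _ hj
    rw [homComp_actCoeff, hN, if_neg (by omega), map_zero]
  · intro h
    rw [Finset.mem_range] at h
    omega

theorem polyStarₗ_one_left (m : ℕ) (f : MvPolynomial (Fin n) ℂ) :
    polyStarₗ e m 1 f = if m = 0 then f else 0 := by
  induction f using lin_pow_induction e with
  | add f g hf hg => rw [map_add, hf, hg]; split_ifs <;> simp
  | smul c f hf => rw [map_smul, hf]; split_ifs <;> simp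
  | pow y N =>
  have h1 : IsHomog 0 (1 : MvPolynomial (Fin n) ℂ) := by simpa using isHomog_lin_pow e (0 : H) 0
  have hN := isHomog_lin_pow e y N
  rw [polyStarₗ_of_isHomog e m h1 hN, symMul_one, Module.End.one_apply, hN]
  exact if_congr (by omega) rfl rfl

theorem polyStarₗ_lin_lin_pow (m : ℕ) (y : H) (N : ℕ) :
    polyStarₗ e m (lin e y) (lin e y ^ N) = if m = 0 then lin e y ^ (N + 1) else 0 := by
  rw [polyStarₗ_lin]
  rcases m with _ | m
  · rw [actCoeff_apply, pow_zero, Module.End.one_apply, linMul_tmul, bernCoeff_zero, one_smul,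
      pow_succ', if_pos rfl]
  · rw [lin_pow_eq, map_smul, actCoeff_divPow, pow_succ, Module.End.mul_apply,
      LieAlgebra.ad_apply, lie_self, map_zero, map_zero, zero_mul, smul_zero, smul_zero]
    rfl

/-- Left star-multiplication by a power of a linear form, in terms of star-multiplication by
this linear form. -/
theorem polyStarₗ_lin_pow_succ (m : ℕ) (y : H) (N : ℕ) (f : MvPolynomial (Fin n) ℂ) :
    polyStarₗ e m (lin e y ^ (N + 1)) f =
      ∑ a ∈ antidiagonal m, actCoeff e a.1 y (polyStarₗ e a.2 (lin e y ^ N) f) := by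
  have := polyStarₗ_assoc e m (lin e y) (lin e y ^ N) f
  simp only [polyStarₗ_lin e _ y (polyStarₗ e _ _ _)] at this
  rw [← this, Finset.sum_eq_single (m, 0)]
  · rw [polyStarₗ_lin_lin_pow, if_pos rfl]
  · rintro ⟨a, b⟩ hab hne
    rw [Finset.HasAntidiagonal.mem_antidiagonal] at hab
    rw [polyStarₗ_lin_lin_pow, if_neg, map_zero, LinearMap.zero_apply]
    rintro rfl
    exact hne (by simpa using hab)
  · simp

theorem polyStarₗ_zero (f g : MvPolynomial (Fin n) ℂ) : polyStarₗ e 0 f g = f * g := by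
  induction f using lin_pow_induction e with
  | add f f' hf hf' => rw [map_add, LinearMap.add_apply, hf, hf', add_mul]
  | smul c f hf => rw [map_smul, LinearMap.smul_apply, hf, smul_mul_assoc]
  | pow y N =>
  induction N with
  | zero => rw [pow_zero, polyStarₗ_one_left, if_pos rfl, one_mul]
  | succ N ih =>
    rw [polyStarₗ_lin_pow_succ]
    simp only [Finset.Nat.antidiagonal_zero, Finset.sum_singleton, ih]
    rw [actCoeff_apply, pow_zero, Module.End.one_apply, linMul_tmul, bernCoeff_zero, one_smul,
      pow_succ', mul_assoc]

/-! ### The antipode -/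

/-- The antipode of `U(H)`. -/
def antipode (H : Type*) [LieRing H] [LieAlgebra ℂ H] : U H →ₐ[ℂ] (U H)ᵐᵒᵖ :=
  UniversalEnvelopingAlgebra.lift ℂ
    { toLinearMap := -((MulOpposite.opLinearEquiv ℂ).toLinearMap ∘ₗ inc)
      map_lie' := fun {x y} => by
        simp [← inc_mul_inc_sub, LieRing.of_associative_ring_bracket] }

theorem antipode_inc (x : H) : antipode H (inc x) = -MulOpposite.op (inc x) :=
  UniversalEnvelopingAlgebra.lift_ι_apply ℂ _ x

/-- On a power `y ^ N` the reversal of factors is invisible and only the sign `(-1) ^ N` remains;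
such powers suffice. -/
theorem unop_antipode_symmetrization {p : ℤ} {f : MvPolynomial (Fin n) ℂ} (hf : IsHomog p f) :
    (antipode H (symmetrization e f)).unop = (-1 : ℂ) ^ p.toNat • symmetrization e f := by
  rw [← hf.homComp_self]
  suffices h : (MulOpposite.opLinearEquiv ℂ).symm.toLinearMap ∘ₗ (antipode H).toLinearMap ∘ₗ
      symmetrization e ∘ₗ homComp p = (-1 : ℂ) ^ p.toNat • (symmetrization e ∘ₗ homComp p) from
    congrArg (fun F => F f) h
  refine ext_lin_pow e fun y N => ?_
  simp only [LinearMap.comp_apply, LinearMap.smul_apply]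
  rw [isHomog_lin_pow]
  split_ifs with h
  · subst h
    rw [symmetrization_lin_pow]
    rw [AlgHom.toLinearMap_apply, map_pow, antipode_inc, neg_pow, ← MulOpposite.op_pow,
      Int.toNat_natCast]
    rcases Nat.even_or_odd N with hN | hN
    · simp [hN.neg_one_pow]
    · simp [hN.neg_one_pow]
  · simp

/-- The antipode reverses the product in `U H` and multiplies the component of degree `d` by `(-1) ^
d`. In degree `p + q - m` the signs leave `(-1) ^ m`. Results on the second argument of the
star-product thus carry over to the first. -/
theorem polyStarₗ_comm_of_isHomog (m : ℕ) {p q : ℤ} {f g : MvPolynomial (Fin n) ℂ}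
    (hf : IsHomog p f) (hg : IsHomog q g) :
    polyStarₗ e m f g = (-1 : ℂ) ^ m • polyStarₗ e m g f := by
  rcases lt_or_ge p 0 with hp | hp
  · rw [hf.eq_zero hp]; simp
  rcases lt_or_ge q 0 with hq | hq
  · rw [hg.eq_zero hq]; simp
  obtain ⟨K, hK, hm⟩ : ∃ K : ℕ, p + q < K ∧ m < K :=
    ⟨(p + q).toNat + m + 1, by omega, by omega⟩
  have h1 : (antipode H (symmetrization e (symMul e f g))).unop =
      symmetrization e ((-1 : ℂ) ^ (p + q).toNat • symMul e g f) := by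
    rw [symmetrization_symMul, map_mul, MulOpposite.unop_mul, unop_antipode_symmetrization e hf,
      unop_antipode_symmetrization e hg, smul_mul_smul_comm, ← pow_add, map_smul,
      symmetrization_symMul, Int.toNat_add hp hq, add_comm]
  rw [symMul_eq_sum e hf hg hK, symMul_eq_sum e hg hf (K := K) (by omega), map_sum, map_sum,
    Finset.unop_sum, Finset.sum_congr rfl fun k _ =>
      unop_antipode_symmetrization e (hf.polyStarₗ e hg k)] at h1
  simp only [← (symmetrization e).map_smul, ← map_sum] at h1
  have h2 := (Function.LeftInverse.injective (unsym_symmetrization e)) h1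
  rw [Finset.smul_sum] at h2
  have h3 := eq_of_sum_range_eq (D := p + q) h2 (fun M => (hf.polyStarₗ e hg M).smul _)
    (fun M => by
      have := (hg.polyStarₗ e hf M).smul ((-1 : ℂ) ^ (p + q).toNat)
      rwa [add_comm q p] at this) hm
  -- The signs have exponents truncated by `toNat`, so negative degrees, where both sides vanish,
  -- are separated first.
  rcases lt_or_ge (p + q - m) 0 with hlt | hge
  · rw [(hf.polyStarₗ e hg m).eq_zero hlt, (hg.polyStarₗ e hf m).eq_zero (by omega), smul_zero]
  have h4 : (p + q).toNat = (p + q - m).toNat + m := by omega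
  rw [h4, pow_add, mul_smul] at h3
  have h5 := congrArg (fun F => (-1 : ℂ) ^ (p + q - m).toNat • F) h3
  simp only [smul_smul, ← pow_add, Even.neg_one_pow ⟨_, rfl⟩, one_smul] at h5
  rw [h5, ← add_assoc, pow_add, Even.neg_one_pow ⟨_, rfl⟩, one_mul]

theorem polyStarₗ_comm (m : ℕ) (f g : MvPolynomial (Fin n) ℂ) :
    polyStarₗ e m f g = (-1 : ℂ) ^ m • polyStarₗ e m g f := by
  induction f using lin_pow_induction e with
  | add f f' hf hf' => simp only [map_add, LinearMap.add_apply, hf, hf', smul_add]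
  | smul c f hf => rw [map_smul, LinearMap.smul_apply, hf, map_smul, smul_comm]
  | pow y p =>
  induction g using lin_pow_induction e with
  | add f f' hf hf' => simp only [map_add, LinearMap.add_apply, hf, hf', smul_add]
  | smul c f hf => rw [map_smul, hf, map_smul, LinearMap.smul_apply, smul_comm]
  | pow z q => exact polyStarₗ_comm_of_isHomog e m (isHomog_lin_pow e y p) (isHomog_lin_pow e z q)

theorem polyStarₗ_one_right (m : ℕ) (f : MvPolynomial (Fin n) ℂ) :
    polyStarₗ e m f 1 = if m = 0 then f else 0 := by
  rw [polyStarₗ_comm, polyStarₗ_one_left]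
  split_ifs with h
  · rw [h, pow_zero, one_smul]
  · rw [smul_zero]

/-- Even coefficients cancel by the sign rule, and odd ones above the first vanish with the odd
Bernoulli numbers. So the star-commutator with a linear function is exactly `ħ` times its coadjoint
derivation; `-1/2` doubled gives the normalization. -/
theorem polyStarₗ_lin_sub (m : ℕ) (x : H) (f : MvPolynomial (Fin n) ℂ) :
    polyStarₗ e m (lin e x) f - polyStarₗ e m f (lin e x) =
      if m = 1 then ∑ i, lin e ⁅x, e i⁆ * MvPolynomial.pderiv i f else 0 := by
  rw [polyStarₗ_comm e m f, polyStarₗ_lin]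
  rcases Nat.even_or_odd m with hm | hm
  · rw [hm.neg_one_pow, one_smul, sub_self, if_neg (by rintro rfl; simp at hm)]
  · rw [hm.neg_one_pow, neg_one_smul, sub_neg_eq_add]
    split_ifs with h
    · subst h
      rw [actCoeff_apply, pow_one, adGrad_tmul, ← two_smul ℂ, smul_smul, bernCoeff_one, map_sum,
        Finset.smul_sum]
      refine Finset.sum_congr rfl fun i _ => ?_
      rw [linMul_tmul, ← lie_skew x, map_neg]
      norm_num
    · have : 1 < m := by
        rcases hm with ⟨k, rfl⟩
        omega
      rw [actCoeff_apply, bernCoeff_odd hm this, zero_smul, add_zero]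

end StarPoly

/-! ## Differential operators on a commutative algebra with coordinates -/

/-- Commuting derivations of a commutative algebra, with coordinate functions. -/
structure Coordinates (n : ℕ) (B : Type*) [CommRing B] [Algebra ℂ B] where
  D : Fin n → Module.End ℂ B
  x : Fin n → B
  leibniz : ∀ i a b, D i (a * b) = D i a * b + a * D i b
  comm : ∀ i j, Commute (D i) (D j)
  D_x : ∀ i j, D i (x j) = if i = j then 1 else 0

/-- The product `A_{i(1)} ⋯ A_{i(p)}`. -/
def wordProd {n : ℕ} {A : Type*} [Monoid A] (D : Fin n → A) {p : ℕ} (i : Fin p → Fin n) : A :=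
  (List.ofFn fun k => D (i k)).prod

theorem wordProd_cons {n : ℕ} {A : Type*} [Monoid A] (D : Fin n → A) {p : ℕ} (j : Fin n)
    (i : Fin p → Fin n) : wordProd D (Fin.cons j i) = D j * wordProd D i := by
  simp [wordProd, List.ofFn_succ]

theorem sum_fin_succ_pi {n p : ℕ} {V : Type*} [AddCommMonoid V] (F : (Fin (p + 1) → Fin n) → V) :
    ∑ i, F i = ∑ j, ∑ i : Fin p → Fin n, F (Fin.cons j i) := by
  rw [← Fintype.sum_prod_type']
  exact (Fintype.sum_equiv (Fin.consEquiv fun _ => Fin n) _ _ fun _ => rfl).symm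

namespace Coordinates

variable {n : ℕ} {B : Type*} [CommRing B] [Algebra ℂ B] (c : Coordinates n B)

theorem D_one (i : Fin n) : c.D i 1 = 0 := by
  have := c.leibniz i 1 1
  simpa using this

theorem D_mul_mulLeft (i : Fin n) (b : B) :
    c.D i * LinearMap.mulLeft ℂ b =
      LinearMap.mulLeft ℂ b * c.D i + LinearMap.mulLeft ℂ (c.D i b) := by
  refine LinearMap.ext fun a => ?_
  simp [c.leibniz, add_comm]

/-- The commutator of an operator with the `j`-th coordinate. -/
def commX (j : Fin n) (T : Module.End ℂ B) : Module.End ℂ B :=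
  T * LinearMap.mulLeft ℂ (c.x j) - LinearMap.mulLeft ℂ (c.x j) * T

theorem commX_mulLeft_mul (j : Fin n) (b : B) (T : Module.End ℂ B) :
    c.commX j (LinearMap.mulLeft ℂ b * T) = LinearMap.mulLeft ℂ b * c.commX j T := by
  refine LinearMap.ext fun a => ?_
  simp [commX, mul_sub, mul_left_comm]

theorem commX_D_mul (i j : Fin n) (T : Module.End ℂ B) :
    c.commX j (c.D i * T) = c.D i * c.commX j T + if i = j then T else 0 := by
  refine LinearMap.ext fun a => ?_
  simp only [commX, LinearMap.sub_apply, Module.End.mul_apply, LinearMap.mulLeft_apply,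
    LinearMap.add_apply, map_sub, c.leibniz, c.D_x]
  split_ifs <;> simp
  abel

/-- Operators with constant coefficients, homogeneous of order `k`. -/
def constOps (k : ℕ) : Submodule ℂ (Module.End ℂ B) :=
  Submodule.span ℂ {T | ∃ l : List (Fin n), l.length = k ∧ T = (l.map c.D).prod}

theorem D_mul_mem_constOps (i : Fin n) {k : ℕ} {T : Module.End ℂ B} (hT : T ∈ c.constOps k) :
    c.D i * T ∈ c.constOps (k + 1) := by
  induction hT using Submodule.span_induction with
  | mem T h =>
    obtain ⟨l, rfl, rfl⟩ := h
    exact Submodule.subset_span ⟨i :: l, rfl, by simp⟩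
  | zero => simp
  | add S T _ _ hS hT => rw [mul_add]; exact add_mem hS hT
  | smul a T _ hT => rw [mul_smul_comm]; exact Submodule.smul_mem _ _ hT

theorem commX_word (j : Fin n) (l : List (Fin n)) :
    (l = [] → c.commX j (l.map c.D).prod = 0) ∧
      ∀ k, l.length = k + 1 → c.commX j (l.map c.D).prod ∈ c.constOps k := by
  induction l with
  | nil => exact ⟨fun _ => by simp [commX], fun k hk => by simp at hk⟩
  | cons i l ih =>
    refine ⟨fun h => by simp at h, fun k hk => ?_⟩
    rw [List.map_cons, List.prod_cons, commX_D_mul]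
    refine add_mem ?_ ?_
    · rcases l with _ | ⟨i', l⟩
      · rw [ih.1 rfl, mul_zero]
        exact zero_mem _
      · obtain ⟨k, rfl⟩ : ∃ k', k = k' + 1 := ⟨l.length, by simpa using hk.symm⟩
        exact c.D_mul_mem_constOps i (ih.2 k (by simpa using hk))
    · split_ifs
      · exact Submodule.subset_span ⟨l, by simpa using hk, rfl⟩
      · exact zero_mem _

theorem commX_add (j : Fin n) (S T : Module.End ℂ B) :
    c.commX j (S + T) = c.commX j S + c.commX j T := by
  simp only [commX, add_mul, mul_add]
  abel

theorem commX_smul (j : Fin n) (a : ℂ) (T : Module.End ℂ B) :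
    c.commX j (a • T) = a • c.commX j T := by
  simp only [commX, smul_mul_assoc, mul_smul_comm, smul_sub]

theorem commX_mem_constOps (j : Fin n) {k : ℕ} {T : Module.End ℂ B}
    (hT : T ∈ c.constOps (k + 1)) : c.commX j T ∈ c.constOps k := by
  induction hT using Submodule.span_induction with
  | mem T h => obtain ⟨l, hl, rfl⟩ := h; exact (c.commX_word j l).2 k hl
  | zero => simp [commX]
  | add S T _ _ hS hT => rw [commX_add]; exact add_mem hS hT
  | smul a T _ hT => rw [commX_smul]; exact Submodule.smul_mem _ _ hT

theorem mem_constOps_zero {T : Module.End ℂ B} (hT : T ∈ c.constOps 0) : ∃ a : ℂ, T = a • 1 := by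
  induction hT using Submodule.span_induction with
  | mem T h =>
    obtain ⟨l, hl, rfl⟩ := h
    rw [List.length_eq_zero_iff.1 hl]
    exact ⟨1, by simp⟩
  | zero => exact ⟨0, by simp⟩
  | add S T _ _ hS hT =>
    obtain ⟨a, rfl⟩ := hS
    obtain ⟨b, rfl⟩ := hT
    exact ⟨a + b, by rw [add_smul]⟩
  | smul a T _ hT =>
    obtain ⟨b, rfl⟩ := hT
    exact ⟨a * b, by rw [smul_smul]⟩

theorem D_word_comm (i : Fin n) (l : List (Fin n)) : Commute (c.D i) (l.map c.D).prod := by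
  refine Commute.list_prod_right _ _ fun y hy => ?_
  obtain ⟨j, _, rfl⟩ := List.mem_map.1 hy
  exact c.comm i j

theorem apply_one_of_mem_constOps_succ {k : ℕ} {T : Module.End ℂ B}
    (hT : T ∈ c.constOps (k + 1)) : T 1 = 0 := by
  induction hT using Submodule.span_induction with
  | mem T h =>
    obtain ⟨l, hl, rfl⟩ := h
    rcases l with _ | ⟨i, l⟩
    · simp at hl
    rw [List.map_cons, List.prod_cons, (c.D_word_comm i l).eq, Module.End.mul_apply, D_one, map_zero]
  | zero => rfl
  | add S T _ _ hS hT => rw [LinearMap.add_apply, hS, hT, add_zero]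
  | smul a T _ hT => rw [LinearMap.smul_apply, hT, smul_zero]

/-- Euler's identity for symbols: commutation with the `j`-th coordinate acts as differentiation
with respect to `D j`. -/
theorem sum_commX_mul_D {k : ℕ} {T : Module.End ℂ B} (hT : T ∈ c.constOps k) :
    ∑ j, c.commX j T * c.D j = (k : ℂ) • T := by
  induction hT using Submodule.span_induction with
  | mem T h =>
    obtain ⟨l, rfl, rfl⟩ := h
    induction l with
    | nil => simp [commX]
    | cons i l ih =>
      simp only [List.map_cons, List.prod_cons, commX_D_mul, add_mul, mul_assoc,
        Finset.sum_add_distrib, ← Finset.mul_sum, ih, ite_mul, zero_mul, Finset.sum_ite_eq,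
        Finset.mem_univ, if_true, ← (c.D_word_comm i l).eq, mul_smul_comm, List.length_cons]
      push_cast
      rw [add_smul, one_smul]
  | zero => simp [commX]
  | add S T _ _ hS hT => simp only [commX_add, add_mul, Finset.sum_add_distrib, hS, hT, smul_add]
  | smul a T _ hT => simp only [commX_smul, smul_mul_assoc, ← Finset.smul_sum, hT, smul_comm a]

/-- The iterated commutator of an operator with coordinates. -/
def commXs : List (Fin n) → Module.End ℂ B → Module.End ℂ B
  | [], T => T
  | j :: l, T => commXs l (c.commX j T)

theorem commXs_mulLeft_mul (l : List (Fin n)) (b : B) (T : Module.End ℂ B) :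
    c.commXs l (LinearMap.mulLeft ℂ b * T) = LinearMap.mulLeft ℂ b * c.commXs l T := by
  induction l generalizing T with
  | nil => rfl
  | cons j l ih => rw [commXs, commXs, commX_mulLeft_mul, ih]

theorem commXs_zero (l : List (Fin n)) : c.commXs l 0 = 0 := by
  induction l with
  | nil => rfl
  | cons j l ih => rw [commXs, show c.commX j 0 = 0 by simp [commX], ih]

theorem commXs_add (l : List (Fin n)) (S T : Module.End ℂ B) :
    c.commXs l (S + T) = c.commXs l S + c.commXs l T := by
  induction l generalizing S T with
  | nil => rfl
  | cons j l ih => rw [commXs, commX_add, ih]; rfl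

theorem commXs_smul (l : List (Fin n)) (a : ℂ) (T : Module.End ℂ B) :
    c.commXs l (a • T) = a • c.commXs l T := by
  induction l generalizing T with
  | nil => rfl
  | cons j l ih => rw [commXs, commX_smul, ih]; rfl

/-- Euler's identity, iterated. Evaluation at `1` selects the case `p = k`: fewer commutators leave
an operator of positive order, which kills `1`, and more give zero. -/
theorem sum_commXs_of_mem_constOps (p : ℕ) {k : ℕ} {T : Module.End ℂ B} (hT : T ∈ c.constOps k) :
    ∑ i : Fin p → Fin n, LinearMap.mulLeft ℂ (c.commXs (List.ofFn i) T 1) * wordProd c.D i =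
      if p = k then (p.factorial : ℂ) • T else 0 := by
  induction p generalizing k T with
  | zero =>
    rcases k with _ | k
    · obtain ⟨a, rfl⟩ := c.mem_constOps_zero hT
      refine LinearMap.ext fun b => ?_
      simp [wordProd, commXs]
    · simp [commXs, c.apply_one_of_mem_constOps_succ hT]
  | succ p ih =>
    have hD : ∀ (j : Fin n) (i : Fin p → Fin n),
        c.D j * wordProd c.D i = wordProd c.D i * c.D j := by
      intro j i
      have := (c.D_word_comm j (List.ofFn i)).eq
      rwa [List.map_ofFn] at this
    simp only [sum_fin_succ_pi, wordProd_cons, hD, List.ofFn_succ, Fin.cons_zero, Fin.cons_succ,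
      commXs, ← mul_assoc, ← Finset.sum_mul]
    rcases k with _ | k
    · obtain ⟨a, rfl⟩ := c.mem_constOps_zero hT
      have h0 : ∀ j, c.commX j (a • 1) = 0 := fun j => by simp [commX]
      simp [h0, commXs_zero]
    · simp only [ih (c.commX_mem_constOps _ hT)]
      by_cases h : p = k
      · subst h
        simp only [if_true, smul_mul_assoc, ← Finset.smul_sum, c.sum_commX_mul_D hT, smul_smul,
          Nat.factorial_succ]
        congr 1
        push_cast
        ring
      · simp [h]

theorem mulLeft_mul_eq (a b : B) : LinearMap.mulLeft ℂ (a * b) =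
    (LinearMap.mulLeft ℂ a * LinearMap.mulLeft ℂ b : Module.End ℂ B) :=
  LinearMap.ext fun _ => mul_assoc _ _ _

theorem mulLeft_add_eq (a b : B) :
    LinearMap.mulLeft ℂ (a + b) = LinearMap.mulLeft ℂ a + LinearMap.mulLeft ℂ b :=
  LinearMap.ext fun _ => add_mul _ _ _

theorem mulLeft_smul_eq (a : ℂ) (b : B) :
    LinearMap.mulLeft ℂ (a • b) = a • LinearMap.mulLeft ℂ b :=
  LinearMap.ext fun _ => smul_mul_assoc _ _ _

/-- Differential operators of order at most `m`. -/
def diffOps (m : ℕ) : Submodule ℂ (Module.End ℂ B) :=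
  Submodule.span ℂ {T | ∃ (b : B) (l : List (Fin n)), l.length ≤ m ∧
    T = LinearMap.mulLeft ℂ b * (l.map c.D).prod}

theorem diffOps_mono {m m' : ℕ} (h : m ≤ m') : c.diffOps m ≤ c.diffOps m' :=
  Submodule.span_mono fun _ ⟨b, l, hl, hT⟩ => ⟨b, l, hl.trans h, hT⟩

/-- Taylor's formula for differential operators, with iterated commutators. -/
theorem eq_sum_commXs {m : ℕ} {T : Module.End ℂ B} (hT : T ∈ c.diffOps m) :
    T = ∑ p ∈ Finset.range (m + 1), ((p.factorial : ℂ)⁻¹) •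
      ∑ i : Fin p → Fin n, LinearMap.mulLeft ℂ (c.commXs (List.ofFn i) T 1) * wordProd c.D i := by
  induction hT using Submodule.span_induction with
  | mem T h =>
    obtain ⟨b, l, hl, rfl⟩ := h
    have hmem : (l.map c.D).prod ∈ c.constOps l.length := Submodule.subset_span ⟨l, rfl, rfl⟩
    have hmul : ∀ a, LinearMap.mulLeft ℂ (b * a) =
        (LinearMap.mulLeft ℂ b * LinearMap.mulLeft ℂ a : Module.End ℂ B) :=
      mulLeft_mul_eq b
    simp only [commXs_mulLeft_mul, Module.End.mul_apply, LinearMap.mulLeft_apply, hmul, mul_assoc,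
      ← Finset.mul_sum, c.sum_commXs_of_mem_constOps _ hmem]
    -- An operator with coefficient `b` and `l.length` derivatives contributes in its own order
    -- only.
    rw [Finset.sum_eq_single l.length]
    · rw [if_pos rfl, mul_smul_comm, smul_smul, inv_mul_cancel₀ (by
        exact_mod_cast l.length.factorial_ne_zero), one_smul]
    · intro p _ hp
      rw [if_neg hp, mul_zero, smul_zero]
    · intro h
      rw [Finset.mem_range] at h
      omega
  | zero => simp [commXs_zero]
  | add S T _ _ hS hT =>
    conv_lhs => rw [hS, hT]
    simp only [commXs_add, LinearMap.add_apply, mulLeft_add_eq, add_mul,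
      Finset.sum_add_distrib, smul_add]
  | smul a T _ hT =>
    conv_lhs => rw [hT]
    simp only [commXs_smul, LinearMap.smul_apply, mulLeft_smul_eq, smul_mul_assoc,
      Finset.smul_sum, smul_comm a]

/-- The map `a ⊗ b ↦ a T(b)`. -/
def mulApply (T : Module.End ℂ B) : B ⊗[ℂ] B →ₗ[ℂ] B :=
  LinearMap.mul' ℂ B ∘ₗ T.lTensor B

theorem mulApply_tmul (T : Module.End ℂ B) (a b : B) : mulApply T (a ⊗ₜ b) = a * T b := by
  simp [mulApply]

theorem mulApply_mul (j : Fin n) (T : Module.End ℂ B) (z : B ⊗[ℂ] B) :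
    mulApply T ((1 ⊗ₜ c.x j + (-c.x j) ⊗ₜ 1) * z) = mulApply (c.commX j T) z := by
  induction z using TensorProduct.induction_on with
  | zero => simp
  | add z w hz hw => rw [mul_add, map_add, map_add, hz, hw]
  | tmul a b =>
    simp only [add_mul, Algebra.TensorProduct.tmul_mul_tmul, one_mul, map_add, mulApply_tmul, commX,
      LinearMap.sub_apply, Module.End.mul_apply, LinearMap.mulLeft_apply]
    ring

/-- In the commutative algebra `B ⊗ B`, commutation with `x j` becomes multiplication by `1 ⊗ x j -
x j ⊗ 1`. Iterated commutators become one product, to be expanded over subsets. -/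
theorem commXs_apply_one (l : List (Fin n)) (T : Module.End ℂ B) :
    c.commXs l T 1 = mulApply T (l.map fun j => (1 : B) ⊗ₜ[ℂ] c.x j + (-c.x j) ⊗ₜ 1).prod := by
  induction l generalizing T with
  | nil => rw [List.map_nil, List.prod_nil, Algebra.TensorProduct.one_def, mulApply_tmul]; simp [commXs]
  | cons j l ih => rw [commXs, ih, List.map_cons, List.prod_cons, mulApply_mul]

theorem commXs_ofFn_apply_one {p : ℕ} (i : Fin p → Fin n) (T : Module.End ℂ B) :
    c.commXs (List.ofFn i) T 1 =
      ∑ S : Finset (Fin p), (∏ k ∈ Sᶜ, -c.x (i k)) * T (∏ k ∈ S, c.x (i k)) := by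
  rw [commXs_apply_one, List.map_ofFn, List.prod_ofFn]
  simp only [Function.comp_apply]
  rw [Fintype.prod_add, map_sum]
  refine Finset.sum_congr rfl fun S _ => ?_
  have h1 : ∏ k ∈ S, ((1 : B) ⊗ₜ[ℂ] c.x (i k)) = 1 ⊗ₜ ∏ k ∈ S, c.x (i k) :=
    (map_prod (Algebra.TensorProduct.includeRight : B →ₐ[ℂ] B ⊗[ℂ] B) _ _).symm
  have h2 : ∏ k ∈ Sᶜ, ((-c.x (i k)) ⊗ₜ[ℂ] (1 : B)) = (∏ k ∈ Sᶜ, -c.x (i k)) ⊗ₜ 1 :=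
    (map_prod (Algebra.TensorProduct.includeLeft : B →ₐ[ℂ] B ⊗[ℂ] B) _ _).symm
  rw [h1, h2, Algebra.TensorProduct.tmul_mul_tmul, one_mul, mul_one, mulApply_tmul]

/-- Taylor's formula for differential operators. -/
theorem diffOps_taylor {m : ℕ} {T : Module.End ℂ B} (hT : T ∈ c.diffOps m) (f : B) :
    T f = ∑ p ∈ Finset.range (m + 1), ((p.factorial : ℂ)⁻¹) • ∑ i : Fin p → Fin n,
      (∑ S : Finset (Fin p), (∏ k ∈ Sᶜ, -c.x (i k)) * T (∏ k ∈ S, c.x (i k))) *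
        wordProd c.D i f := by
  conv_lhs => rw [c.eq_sum_commXs hT]
  simp [LinearMap.sum_apply, commXs_ofFn_apply_one]

/-- A differential operator that vanishes on monomials in the coordinates is zero. -/
theorem eq_zero_of_mem_diffOps {m : ℕ} {T : Module.End ℂ B} (hT : T ∈ c.diffOps m)
    (h : ∀ (p : ℕ) (i : Fin p → Fin n) (S : Finset (Fin p)), T (∏ k ∈ S, c.x (i k)) = 0) :
    T = 0 :=
  LinearMap.ext fun f => by
    rw [c.diffOps_taylor hT]
    simp [h]

theorem mulLeft_mul_mem_diffOps (b : B) {m : ℕ} {T : Module.End ℂ B} (hT : T ∈ c.diffOps m) :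
    LinearMap.mulLeft ℂ b * T ∈ c.diffOps m := by
  induction hT using Submodule.span_induction with
  | mem T h =>
    obtain ⟨a, l, hl, rfl⟩ := h
    refine Submodule.subset_span ⟨b * a, l, hl, ?_⟩
    rw [← mul_assoc]
    congr 1
    exact (mulLeft_mul_eq b a).symm
  | zero => simp
  | add S T _ _ hS hT => rw [mul_add]; exact add_mem hS hT
  | smul a T _ hT => rw [mul_smul_comm]; exact Submodule.smul_mem _ _ hT

theorem D_mul_mem_diffOps (i : Fin n) {m : ℕ} {T : Module.End ℂ B} (hT : T ∈ c.diffOps m) :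
    c.D i * T ∈ c.diffOps (m + 1) := by
  induction hT using Submodule.span_induction with
  | mem T h =>
    obtain ⟨a, l, hl, rfl⟩ := h
    rw [← mul_assoc, D_mul_mulLeft, add_mul]
    refine add_mem (Submodule.subset_span ⟨a, i :: l, by simpa using hl, ?_⟩)
      (Submodule.subset_span ⟨_, l, by omega, rfl⟩)
    rw [List.map_cons, List.prod_cons, mul_assoc]
  | zero => simp
  | add S T _ _ hS hT => rw [mul_add]; exact add_mem hS hT
  | smul a T _ hT => rw [mul_smul_comm]; exact Submodule.smul_mem _ _ hT

theorem mul_mem_diffOps {m m' : ℕ} {S T : Module.End ℂ B} (hS : S ∈ c.diffOps m)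
    (hT : T ∈ c.diffOps m') : S * T ∈ c.diffOps (m + m') := by
  induction hS using Submodule.span_induction with
  | mem S h =>
    obtain ⟨a, l, hl, rfl⟩ := h
    refine c.diffOps_mono (Nat.add_le_add_right hl m') ?_
    rw [mul_assoc]
    refine c.mulLeft_mul_mem_diffOps a ?_
    clear hl
    induction l with
    | nil => simpa using hT
    | cons i l ih =>
      rw [List.map_cons, List.prod_cons, mul_assoc, List.length_cons, Nat.add_right_comm]
      exact c.D_mul_mem_diffOps i ih
  | zero => simp
  | add S S' _ _ hS hS' => rw [add_mul]; exact add_mem hS hS'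
  | smul a S _ hS => rw [smul_mul_assoc]; exact Submodule.smul_mem _ _ hS

theorem one_mem_diffOps (m : ℕ) : 1 ∈ c.diffOps m :=
  Submodule.subset_span ⟨1, [], by simp, by
    refine LinearMap.ext fun a => ?_
    simp⟩

theorem mulLeft_mem_diffOps (b : B) (m : ℕ) : LinearMap.mulLeft ℂ b ∈ c.diffOps m := by
  simpa using c.mulLeft_mul_mem_diffOps b (c.one_mem_diffOps m)

theorem D_mem_diffOps (i : Fin n) : c.D i ∈ c.diffOps 1 := by
  simpa using c.D_mul_mem_diffOps i (c.one_mem_diffOps 0)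

/-- The algebra of differential operators. -/
def diffAlg : Subalgebra ℂ (Module.End ℂ B) where
  carrier := {T | ∃ m, T ∈ c.diffOps m}
  mul_mem' := fun ⟨m, hS⟩ ⟨m', hT⟩ => ⟨m + m', c.mul_mem_diffOps hS hT⟩
  add_mem' := fun ⟨m, hS⟩ ⟨m', hT⟩ => ⟨max m m', add_mem (c.diffOps_mono (le_max_left _ _) hS)
    (c.diffOps_mono (le_max_right _ _) hT)⟩
  algebraMap_mem' := fun a => ⟨0, by
    rw [Algebra.algebraMap_eq_smul_one]
    exact Submodule.smul_mem _ _ (c.one_mem_diffOps 0)⟩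

theorem mulLeft_mem_diffAlg (b : B) : LinearMap.mulLeft ℂ b ∈ c.diffAlg :=
  ⟨0, c.mulLeft_mem_diffOps b 0⟩

theorem D_mem_diffAlg (i : Fin n) : c.D i ∈ c.diffAlg := ⟨1, c.D_mem_diffOps i⟩

theorem wordProd_mem_diffAlg {p : ℕ} (i : Fin p → Fin n) : wordProd c.D i ∈ c.diffAlg := by
  refine list_prod_mem fun T hT => ?_
  obtain ⟨k, rfl⟩ := (List.mem_ofFn' _ _).1 hT
  exact c.D_mem_diffAlg _

end Coordinates

/-! ## The star-product on polynomials as a bidifferential operator -/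

section PolyStar

variable {n : ℕ} {H : Type*} [LieRing H] [LieAlgebra ℂ H] (e : Module.Basis (Fin n) ℂ H)

/-- The partial derivative of polynomials as a linear map. -/
def polyD (i : Fin n) : Module.End ℂ (MvPolynomial (Fin n) ℂ) := (MvPolynomial.pderiv i).toLinearMap

theorem polyD_apply (i : Fin n) (f : MvPolynomial (Fin n) ℂ) :
    polyD i f = MvPolynomial.pderiv i f := rfl

/-- The coordinates of the polynomial algebra. -/
def polyCoordinates (n : ℕ) : Coordinates n (MvPolynomial (Fin n) ℂ) where
  D := polyD
  x := MvPolynomial.X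
  leibniz i a b := by
    simp only [polyD_apply, Derivation.leibniz, smul_eq_mul]
    ring
  comm i j := LinearMap.ext fun f => by
    have h : ⁅(MvPolynomial.pderiv i : Derivation ℂ (MvPolynomial (Fin n) ℂ) _),
        (MvPolynomial.pderiv j : Derivation ℂ (MvPolynomial (Fin n) ℂ) _)⁆ = 0 := by
      refine MvPolynomial.derivation_ext fun k => ?_
      rw [Derivation.commutator_apply, MvPolynomial.pderiv_X, MvPolynomial.pderiv_X]
      simp [Pi.single_apply, apply_ite]
    have := congrArg (fun D => D f) h
    have h₂ : MvPolynomial.pderiv i (MvPolynomial.pderiv j f) =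
        MvPolynomial.pderiv j (MvPolynomial.pderiv i f) := by
      simpa [Derivation.commutator_apply, sub_eq_zero] using this
    exact h₂
  D_x i j := by
    rw [polyD_apply, MvPolynomial.pderiv_X, Pi.single_apply]
    simp [eq_comm]

/-- Each factor `adGrad` contributes one derivative and changes `x` to `⁅e i, x⁆`; hence the
induction must be over all `x` at once. -/
theorem actCoeff_mem_diffOps (k : ℕ) (x : H) : actCoeff e k x ∈ (polyCoordinates n).diffOps k := by
  have h : ∀ x, linMul e ∘ₗ (adGrad e ^ k) ∘ₗ TensorProduct.mk ℂ H _ x ∈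
      (polyCoordinates n).diffOps k := by
    induction k with
    | zero => exact fun x => (polyCoordinates n).mulLeft_mem_diffOps (lin e x) 0
    | succ k ih =>
      intro x
      have : linMul e ∘ₗ (adGrad e ^ (k + 1)) ∘ₗ TensorProduct.mk ℂ H _ x =
          ∑ i, (linMul e ∘ₗ (adGrad e ^ k) ∘ₗ TensorProduct.mk ℂ H _ ⁅e i, x⁆) *
            (polyCoordinates n).D i := by
        refine LinearMap.ext fun f => ?_
        simp only [LinearMap.comp_apply, TensorProduct.mk_apply, pow_succ, Module.End.mul_apply,
          adGrad_tmul, map_sum, LinearMap.sum_apply]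
        rfl
      rw [this]
      exact sum_mem fun i _ => Coordinates.mul_mem_diffOps _ (ih _) (Coordinates.D_mem_diffOps _ i)
  exact Submodule.smul_mem _ _ (h x)

/-- Star-multiplication by a power of a linear form is iterated star-multiplication by that form,
and the orders add up to `m`. -/
theorem polyStarₗ_mem_diffOps (m : ℕ) (f : MvPolynomial (Fin n) ℂ) :
    polyStarₗ e m f ∈ (polyCoordinates n).diffOps m := by
  induction f using lin_pow_induction e with
  | add f g hf hg => rw [map_add]; exact add_mem hf hg
  | smul c f hf => rw [map_smul]; exact Submodule.smul_mem _ _ hf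
  | pow y N =>
  induction N generalizing m with
  | zero =>
    have : polyStarₗ e m (lin e y ^ 0) = if m = 0 then 1 else 0 := LinearMap.ext fun g => by
      rw [pow_zero, polyStarₗ_one_left]
      split_ifs <;> rfl
    rw [this]
    split_ifs
    · exact Coordinates.one_mem_diffOps _ m
    · exact zero_mem _
  | succ N ih =>
    have : polyStarₗ e m (lin e y ^ (N + 1)) =
        ∑ a ∈ antidiagonal m, actCoeff e a.1 y * polyStarₗ e a.2 (lin e y ^ N) :=
      LinearMap.ext fun g => by
        rw [polyStarₗ_lin_pow_succ, LinearMap.sum_apply]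
        rfl
    rw [this]
    refine sum_mem fun a ha => ?_
    rw [← Finset.HasAntidiagonal.mem_antidiagonal.1 ha]
    exact Coordinates.mul_mem_diffOps _ (actCoeff_mem_diffOps e a.1 y) (ih a.2)

theorem polyStarₗ_flip_mem_diffOps (m : ℕ) (g : MvPolynomial (Fin n) ℂ) :
    (polyStarₗ e m).flip g ∈ (polyCoordinates n).diffOps m := by
  have : (polyStarₗ e m).flip g = (-1 : ℂ) ^ m • polyStarₗ e m g :=
    LinearMap.ext fun f => polyStarₗ_comm e m f g
  rw [this]
  exact Submodule.smul_mem _ _ (polyStarₗ_mem_diffOps e m g)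

/-- Taylor's formula for differential operators, applied in each argument; the resulting
coefficients are those collected in `starSymbol`. This is why `starCoeff` has the right values on
polynomials. -/
theorem polyStar_eq_sum_starSymbol (m : ℕ) (f g : MvPolynomial (Fin n) ℂ) :
    polyStarₗ e m f g = ∑ p ∈ Finset.range (m + 1), ∑ q ∈ Finset.range (m + 1),
      ((p.factorial : ℂ)⁻¹ * (q.factorial : ℂ)⁻¹) •
        ∑ i : Fin p → Fin n, ∑ j : Fin q → Fin n,
          starSymbol e m i j * wordProd polyD i f * wordProd polyD j g := by
  have h₁ : polyStarₗ e m f g = ∑ p ∈ Finset.range (m + 1), ((p.factorial : ℂ)⁻¹) •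
      ∑ i : Fin p → Fin n, (∑ S : Finset (Fin p), (∏ k ∈ Sᶜ, -MvPolynomial.X (i k)) *
        polyStarₗ e m (∏ k ∈ S, MvPolynomial.X (i k)) g) * wordProd polyD i f :=
    (polyCoordinates n).diffOps_taylor (polyStarₗ_flip_mem_diffOps e m g) f
  have h₂ : ∀ F, polyStarₗ e m F g = ∑ q ∈ Finset.range (m + 1), ((q.factorial : ℂ)⁻¹) •
      ∑ j : Fin q → Fin n, (∑ T : Finset (Fin q), (∏ k ∈ Tᶜ, -MvPolynomial.X (j k)) *
        polyStarₗ e m F (∏ k ∈ T, MvPolynomial.X (j k))) * wordProd polyD j g := fun F =>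
    (polyCoordinates n).diffOps_taylor (polyStarₗ_mem_diffOps e m F) g
  simp only [h₂] at h₁
  rw [← h₂] at h₁
  rw [h₁]
  refine Finset.sum_congr rfl fun p _ => ?_
  simp only [mul_smul, ← Finset.smul_sum]
  congr 1
  simp only [starSymbol, Finset.sum_mul, Finset.mul_sum, Finset.smul_sum, smul_mul_assoc,
    mul_smul_comm]
  rw [Finset.sum_comm (s := Finset.range (m + 1))]
  refine Finset.sum_congr rfl fun i _ => ?_
  rw [Finset.sum_comm]
  refine Finset.sum_congr rfl fun q _ => ?_
  rw [Finset.sum_comm]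
  refine Finset.sum_congr rfl fun j _ => Finset.sum_congr rfl fun S _ =>
    Finset.sum_congr rfl fun T _ => ?_
  rw [polyStarₗ_apply]
  congr 1
  ring

end PolyStar

/-! ## The star-product and the shift, on polynomials -/

section ShiftPoly

variable {n : ℕ} {H : Type*} [LieRing H] [LieAlgebra ℂ H] (e : Module.Basis (Fin n) ℂ H)

theorem homComp_polyD (i : Fin n) (d : ℤ) (f : MvPolynomial (Fin n) ℂ) :
    homComp d (polyD i f) = polyD i (homComp (d + 1) f) := by
  -- Divided powers of linear forms require a Lie algebra with a basis; `ℂⁿ` with zero bracket, the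
  -- commutator of a commutative ring, serves.
  let e : Module.Basis (Fin n) ℂ (Fin n → ℂ) := Pi.basisFun ℂ (Fin n)
  suffices h : homComp d ∘ₗ polyD i = polyD i ∘ₗ homComp (d + 1) from congrArg (fun F => F f) h
  let _ : LieRing (Fin n → ℂ) := LieRing.ofAssociativeRing
  let _ : LieAlgebra ℂ (Fin n → ℂ) := LieAlgebra.ofAssociativeAlgebra
  refine ext_divPow e fun y N => ?_
  rw [LinearMap.comp_apply, LinearMap.comp_apply, polyD_apply, pderiv_divPow, map_smul,
    isHomog_divPow, isHomog_divPow]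
  by_cases h : d + 1 = N
  · rw [if_pos (by omega), if_pos h, polyD_apply, pderiv_divPow]
  · rw [if_neg (by omega), if_neg h, map_zero, smul_zero]

theorem IsHomog.polyD {d : ℤ} {f : MvPolynomial (Fin n) ℂ} (hf : IsHomog d f) (i : Fin n) :
    IsHomog (d - 1) (polyD i f) := fun d' => by
  rw [homComp_polyD, hf]
  by_cases h : d' = d - 1
  · rw [if_pos (by omega), if_pos h]
  · rw [if_neg (by omega), if_neg h, map_zero]

theorem IsHomog.wordProd_polyD {d : ℤ} {f : MvPolynomial (Fin n) ℂ} (hf : IsHomog d f) {p : ℕ}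
    (i : Fin p → Fin n) : IsHomog (d - p) (wordProd DynTwist.polyD i f) := by
  induction p with
  | zero => simpa [wordProd] using hf
  | succ p ih =>
    rw [← Fin.cons_self_tail i, wordProd_cons, Module.End.mul_apply]
    have := (ih (Fin.tail i)).polyD (i 0)
    rwa [show d - p - 1 = d - (p + 1 : ℕ) by push_cast; ring] at this

/-- The product of the basis elements with given indices, in `U(H)`. -/
abbrev basisWord {p : ℕ} (i : Fin p → Fin n) : U H := wordProd (fun j => inc (e j)) i

theorem wordProd_polyD_divPow {p : ℕ} (i : Fin p → Fin n) (y : H) (m : ℤ) :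
    wordProd polyD i (divPow e y m) = (∏ k, e.repr y (i k)) • divPow e y (m - p) := by
  induction p with
  | zero => simp [wordProd]
  | succ p ih =>
    rw [← Fin.cons_self_tail i, wordProd_cons, Module.End.mul_apply, ih, map_smul, polyD_apply,
      pderiv_divPow, smul_smul, Fin.prod_univ_succ, mul_comm]
    simp only [Fin.cons_zero, Fin.cons_succ]
    rw [show m - p - 1 = m - (p + 1 : ℕ) by push_cast; ring]

theorem sum_repr_smul_basisWord (p : ℕ) (y : H) :
    ∑ i : Fin p → Fin n, (∏ k, e.repr y (i k)) • basisWord e i = inc y ^ p := by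
  induction p with
  | zero => simp [wordProd]
  | succ p ih =>
    have hy : ∑ j, e.repr y j • (inc (e j) : U H) = inc y := by
      conv_rhs => rw [← e.sum_repr y]
      simp only [map_sum, map_smul]
    rw [sum_fin_succ_pi, pow_succ', ← ih, ← hy, Finset.sum_mul]
    refine Finset.sum_congr rfl fun j _ => ?_
    rw [Finset.mul_sum]
    refine Finset.sum_congr rfl fun i _ => ?_
    rw [basisWord, wordProd_cons, Fin.prod_univ_succ, smul_mul_smul_comm]
    rfl

/-- The divided powers of `y` in `U(H)`. -/
def divPowU (y : H) (p : ℕ) : U H := ((p.factorial : ℂ)⁻¹) • inc y ^ p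

theorem symmetrization_divPow (y : H) (p : ℕ) :
    symmetrization e (divPow e y p) = divPowU y p := by
  rw [divPow_natCast, map_smul, symmetrization_lin_pow, divPowU]

/-- The coefficient of `ħᴺ` in the shift, on polynomials, after application of a functional. -/
def polyShift (φ : U H →ₗ[ℂ] ℂ) (N : ℕ) : Module.End ℂ (MvPolynomial (Fin n) ℂ) :=
  ((N.factorial : ℂ)⁻¹) • ∑ i : Fin N → Fin n, φ (basisWord e i) • wordProd polyD i

theorem IsHomog.polyShift {d : ℤ} {f : MvPolynomial (Fin n) ℂ} (hf : IsHomog d f)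
    (φ : U H →ₗ[ℂ] ℂ) (N : ℕ) : IsHomog (d - N) (polyShift e φ N f) := by
  rw [DynTwist.polyShift, LinearMap.smul_apply, LinearMap.sum_apply]
  exact (IsHomog.sum fun i _ => (hf.wordProd_polyD i).smul _).smul _

theorem polyShift_divPow (φ : U H →ₗ[ℂ] ℂ) (N : ℕ) (y : H) (m : ℤ) :
    polyShift e φ N (divPow e y m) = φ (divPowU y N) • divPow e y (m - N) := by
  rw [polyShift, LinearMap.smul_apply, LinearMap.sum_apply, divPowU, map_smul,
    ← sum_repr_smul_basisWord e, map_sum, smul_eq_mul, mul_smul, Finset.sum_smul]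
  congr 1
  refine Finset.sum_congr rfl fun i _ => ?_
  rw [LinearMap.smul_apply, wordProd_polyD_divPow, map_smul, smul_smul, smul_eq_mul, mul_comm]

theorem comul_inc (x : H) : comul H (inc x) = inc x ⊗ₜ 1 + 1 ⊗ₜ inc x :=
  UniversalEnvelopingAlgebra.lift_ι_apply ℂ _ x

/-- The binomial theorem for the commuting elements `y ⊗ 1` and `1 ⊗ y`; divided powers remove the
binomial coefficients, and terms with `j > p` are zero. -/
theorem comul_symmetrization_divPow (y : H) (p : ℕ) {K : ℕ} (hK : p < K) :
    comul H (symmetrization e (divPow e y p)) =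
      ∑ j ∈ Finset.range K, symmetrization e (divPow e y (p - j)) ⊗ₜ divPowU y j := by
  have hc : Commute (inc y ⊗ₜ[ℂ] (1 : U H)) ((1 : U H) ⊗ₜ[ℂ] inc y) := by
    simp [Commute, SemiconjBy, Algebra.TensorProduct.tmul_mul_tmul]
  rw [symmetrization_divPow, divPowU, map_smul, map_pow, comul_inc, add_comm (inc y ⊗ₜ[ℂ] 1),
    hc.symm.add_pow',
    ← Finset.sum_subset (Finset.range_subset_range.2 hK),
    Finset.Nat.sum_antidiagonal_eq_sum_range_succ_mk, Finset.smul_sum]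
  · refine Finset.sum_congr rfl fun j hj => ?_
    have hj' : j ≤ p := by simpa [Nat.lt_succ_iff] using hj
    rw [show (p : ℤ) - j = ((p - j : ℕ) : ℤ) by omega, symmetrization_divPow, divPowU, divPowU]
    simp only [Algebra.TensorProduct.tmul_pow, one_pow, Algebra.TensorProduct.tmul_mul_tmul, one_mul,
      mul_one]
    rw [TensorProduct.smul_tmul_smul, ← Nat.cast_smul_eq_nsmul ℂ, smul_smul]
    congr 1
    rw [Nat.cast_choose ℂ hj']
    have h1 : (p.factorial : ℂ) ≠ 0 := by exact_mod_cast p.factorial_ne_zero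
    field_simp
  · intro j _ hj
    have hj' : p < j := by simpa [Nat.lt_succ_iff] using hj
    rw [divPow_of_neg e y (by omega), map_zero, TensorProduct.zero_tmul]

/-- The map `u ⊗ v ↦ φ(v) σ⁻¹(u)`. -/
def unsymFunctional (φ : U H →ₗ[ℂ] ℂ) : U2 H →ₗ[ℂ] MvPolynomial (Fin n) ℂ :=
  TensorProduct.lift ((LinearMap.lsmul ℂ (MvPolynomial (Fin n) ℂ) ∘ₗ φ).flip ∘ₗ unsym e)

theorem unsymFunctional_tmul (φ : U H →ₗ[ℂ] ℂ) (u v : U H) :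
    unsymFunctional e φ (u ⊗ₜ v) = φ v • unsym e u := rfl

/-- At `ħ = 1` the shift is the coproduct transported by symmetrization, with `φ` evaluating its
second leg. On powers of `y` both are the binomial expansion. -/
theorem sum_polyShift (φ : U H →ₗ[ℂ] ℂ) {d : ℤ} {f : MvPolynomial (Fin n) ℂ} (hf : IsHomog d f)
    {K : ℕ} (hK : d < K) :
    ∑ a ∈ Finset.range K, polyShift e φ a f =
      unsymFunctional e φ (comul H (symmetrization e f)) := by
  rw [← hf.homComp_self]
  suffices h : (∑ a ∈ Finset.range K, polyShift e φ a) ∘ₗ homComp d =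
      unsymFunctional e φ ∘ₗ (comul H).toLinearMap ∘ₗ symmetrization e ∘ₗ homComp d by
    have := congrArg (fun F => F f) h
    simpa [LinearMap.sum_apply] using this
  refine ext_divPow e fun y N => ?_
  simp only [LinearMap.comp_apply]
  rw [isHomog_divPow]
  split_ifs with h
  · rw [LinearMap.sum_apply, AlgHom.toLinearMap_apply,
      comul_symmetrization_divPow e y N (K := K) (by omega), map_sum]
    refine Finset.sum_congr rfl fun j _ => ?_
    rw [polyShift_divPow, unsymFunctional_tmul, unsym_symmetrization]
  · simp

/-- This is the component of degree `p + q - N` of the multiplicativity of the coproduct. -/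
theorem polyShift_polyStarₗ_divPow (φ : U H →ₗ[ℂ] ℂ) (N : ℕ) (y z : H) (p q : ℕ) :
    ∑ a ∈ antidiagonal N, polyShift e φ a.1 (polyStarₗ e a.2 (divPow e y p) (divPow e z q)) =
      ∑ a ∈ antidiagonal N, ∑ b ∈ antidiagonal a.2, φ (divPowU y b.1 * divPowU z b.2) •
        polyStarₗ e a.1 (divPow e y (p - b.1)) (divPow e z (q - b.2)) := by
  have hf := isHomog_divPow e y p
  have hg := isHomog_divPow e z q
  obtain ⟨K, hK, hN⟩ : ∃ K : ℕ, p + q < K ∧ N < K := ⟨p + q + N + 1, by omega, by omega⟩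
  have hKz : (p : ℤ) + q < K := by exact_mod_cast hK
  have hFG : ∀ b c : ℕ, K ≤ b + c → ∀ a,
      polyStarₗ e a (divPow e y (p - b)) (divPow e z (q - c)) = 0 := fun b c hbc a =>
    IsHomog.eq_zero ((isHomog_divPow e y _).polyStarₗ e (isHomog_divPow e z _) a) (by omega)
  -- The coproduct of a product, with both coproducts expanded; no grading enters yet.
  have key : unsymFunctional e φ (comul H (symmetrization e
        (symMul e (divPow e y p) (divPow e z q)))) =
      ∑ b ∈ Finset.range K, ∑ c ∈ Finset.range K, φ (divPowU y b * divPowU z c) •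
        symMul e (divPow e y (p - b)) (divPow e z (q - c)) := by
    rw [symmetrization_symMul, map_mul, comul_symmetrization_divPow e y p (K := K) (by omega),
      comul_symmetrization_divPow e z q (K := K) (by omega), Finset.sum_mul_sum, map_sum]
    refine Finset.sum_congr rfl fun b _ => ?_
    rw [map_sum]
    refine Finset.sum_congr rfl fun c _ => ?_
    rw [Algebra.TensorProduct.tmul_mul_tmul, unsymFunctional_tmul, ← symMul_eq_unsym]
  have hS : ∀ b c : ℕ, symMul e (divPow e y (p - b)) (divPow e z (q - c)) =
      ∑ a ∈ Finset.range K, polyStarₗ e a (divPow e y (p - b)) (divPow e z (q - c)) := fun b c =>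
    symMul_eq_sum e (isHomog_divPow e y _) (isHomog_divPow e z _) (by omega)
  have hz₁ : ∀ a b, K ≤ a + b →
      polyShift e φ a (polyStarₗ e b (divPow e y p) (divPow e z q)) = 0 := fun a b hab =>
    IsHomog.eq_zero ((hf.polyStarₗ e hg b).polyShift e φ a) (by omega)
  have hz₂ : ∀ b c, K ≤ b + c → φ (divPowU y b * divPowU z c) •
      symMul e (divPow e y (p - b)) (divPow e z (q - c)) = 0 := fun b c hbc => by
    rw [hS, Finset.sum_eq_zero fun a _ => hFG b c hbc a, smul_zero]
  set F : ℕ → ℕ → MvPolynomial (Fin n) ℂ := fun a s =>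
    ∑ b ∈ antidiagonal s, φ (divPowU y b.1 * divPowU z b.2) •
        polyStarₗ e a (divPow e y (p - b.1)) (divPow e z (q - b.2)) with hF
  have hFhom : ∀ a s : ℕ, IsHomog ((p : ℤ) + q - s - a) (F a s) := fun a s => by
    refine IsHomog.sum fun b hb => IsHomog.smul _ ?_
    have := (isHomog_divPow e y (p - b.1)).polyStarₗ e (isHomog_divPow e z (q - b.2)) a
    rw [Finset.HasAntidiagonal.mem_antidiagonal] at hb
    rwa [show (p : ℤ) - b.1 + (q - b.2) - a = p + q - s - a by omega] at this
  have hz₃ : ∀ a s, K ≤ a + s → F a s = 0 := fun a s has =>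
    (hFhom a s).eq_zero (by omega)
  rw [sum_range_sum_range_eq_sum_antidiagonal K
      (fun b c => φ (divPowU y b * divPowU z c) •
        symMul e (divPow e y (p - b)) (divPow e z (q - c))) hz₂] at key
  simp only [hS, Finset.smul_sum] at key
  have hswap : ∀ s, ∑ b ∈ antidiagonal s, ∑ a ∈ Finset.range K, φ (divPowU y b.1 * divPowU z b.2) •
      polyStarₗ e a (divPow e y (p - b.1)) (divPow e z (q - b.2)) =
        ∑ a ∈ Finset.range K, F a s := fun s => Finset.sum_comm
  simp only [hswap] at key
  rw [Finset.sum_comm, sum_range_sum_range_eq_sum_antidiagonal K F hz₃,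
    symMul_eq_sum e hf hg hKz, map_sum, map_sum, map_sum, Finset.sum_congr rfl fun b _ =>
      (sum_polyShift e φ (hf.polyStarₗ e hg b) (K := K) (by omega)).symm, Finset.sum_comm,
    sum_range_sum_range_eq_sum_antidiagonal K
      (fun a b => polyShift e φ a (polyStarₗ e b (divPow e y p) (divPow e z q))) hz₁] at key
  -- Each application of the shift or the star-product lowers the degree by its order in `ħ`, so the
  -- total order is read off from the degree.
  refine eq_of_sum_range_eq (D := (p : ℤ) + q) key (fun M => ?_) (fun M => ?_) hN
  · refine IsHomog.sum fun a ha => ?_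
    rw [Finset.HasAntidiagonal.mem_antidiagonal] at ha
    have := (hf.polyStarₗ e hg a.2).polyShift e φ a.1
    rwa [show (p : ℤ) + q - a.2 - a.1 = p + q - M by omega] at this
  · refine IsHomog.sum fun a ha => ?_
    rw [Finset.HasAntidiagonal.mem_antidiagonal] at ha
    have := hFhom a.1 a.2
    rwa [show (p : ℤ) + q - a.2 - a.1 = p + q - M by omega] at this

/-- Bilinearity reduces to divided powers of `y` and `z`; there the derivatives produce coordinates,
which turn the words in the basis back into powers of `y` and `z`. -/
theorem polyShift_polyStarₗ (φ : U H →ₗ[ℂ] ℂ) (N : ℕ) (f g : MvPolynomial (Fin n) ℂ) :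
    ∑ a ∈ antidiagonal N, polyShift e φ a.1 (polyStarₗ e a.2 f g) =
      ∑ a ∈ antidiagonal N, ∑ b ∈ antidiagonal a.2,
        ((b.1.factorial : ℂ)⁻¹ * (b.2.factorial : ℂ)⁻¹) •
          ∑ i : Fin b.1 → Fin n, ∑ j : Fin b.2 → Fin n, φ (basisWord e i * basisWord e j) •
            polyStarₗ e a.1 (wordProd polyD i f) (wordProd polyD j g) := by
  induction f using lin_pow_induction e with
  | add f f' hf hf' =>
    simp only [map_add, LinearMap.add_apply, Finset.sum_add_distrib, smul_add, hf, hf']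
  | smul c f hf =>
    simp only [map_smul, LinearMap.smul_apply, ← Finset.smul_sum, hf, smul_comm _ c]
  | pow y p =>
  induction g using lin_pow_induction e with
  | add f f' hf hf' =>
    simp only [map_add, Finset.sum_add_distrib, smul_add, hf, hf']
  | smul c f hf =>
    simp only [map_smul, ← Finset.smul_sum, hf, smul_comm _ c]
  | pow z q =>
  rw [lin_pow_eq, lin_pow_eq]
  generalize (p.factorial : ℂ) = c
  generalize (q.factorial : ℂ) = d
  simp only [map_smul, LinearMap.smul_apply, smul_comm _ c, ← Finset.smul_sum]
  simp only [smul_comm _ d, ← Finset.smul_sum]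
  rw [polyShift_polyStarₗ_divPow]
  congr 2
  refine Finset.sum_congr rfl fun a _ => Finset.sum_congr rfl fun b _ => ?_
  simp only [wordProd_polyD_divPow, map_smul, LinearMap.smul_apply, smul_smul]
  simp only [← Finset.sum_smul, smul_smul]
  congr 1
  rw [divPowU, divPowU, smul_mul_smul_comm, map_smul, smul_eq_mul, ← sum_repr_smul_basisWord e,
    ← sum_repr_smul_basisWord e, Finset.sum_mul_sum, map_sum]
  congr 1
  refine Finset.sum_congr rfl fun i _ => ?_
  rw [map_sum]
  refine Finset.sum_congr rfl fun j _ => ?_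
  rw [smul_mul_smul_comm, map_smul, smul_eq_mul]
  ring

end ShiftPoly

/-! ## The star-product and the shift, on algebras with coordinates -/

namespace Coordinates

variable {n : ℕ} {B : Type*} [CommRing B] [Algebra ℂ B] (c : Coordinates n B)

/-- Polynomials in the coordinates. -/
abbrev poly : MvPolynomial (Fin n) ℂ →ₐ[ℂ] B := MvPolynomial.aeval c.x

theorem D_algebraMap (i : Fin n) (a : ℂ) : c.D i (algebraMap ℂ B a) = 0 := by
  rw [Algebra.algebraMap_eq_smul_one, map_smul, D_one, smul_zero]

theorem poly_polyD (i : Fin n) (f : MvPolynomial (Fin n) ℂ) :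
    c.poly (polyD i f) = c.D i (c.poly f) := by
  induction f using MvPolynomial.induction_on with
  | C a => simp [polyD_apply, D_algebraMap]
  | add f g hf hg => simp only [map_add, hf, hg]
  | mul_X f j hf =>
    have hX : polyD i (MvPolynomial.X j) = (if i = j then 1 else 0 : MvPolynomial (Fin n) ℂ) :=
      (polyCoordinates n).D_x i j
    have hm : polyD i (f * MvPolynomial.X j) =
        polyD i f * MvPolynomial.X j + f * polyD i (MvPolynomial.X j) :=
      (polyCoordinates n).leibniz i _ _
    rw [hm, hX, map_add, map_mul, map_mul, map_mul, c.leibniz, ← hf, MvPolynomial.aeval_X, c.D_x]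
    split_ifs <;> simp

theorem poly_wordProd {p : ℕ} (i : Fin p → Fin n) (f : MvPolynomial (Fin n) ℂ) :
    c.poly (wordProd polyD i f) = wordProd c.D i (c.poly f) := by
  induction p with
  | zero => simp [wordProd]
  | succ p ih =>
    rw [← Fin.cons_self_tail i, wordProd_cons, wordProd_cons, Module.End.mul_apply,
      Module.End.mul_apply, poly_polyD, ih]

/-- Differential operators that agree on polynomials are equal. -/
theorem ext_of_mem_diffAlg {S T : Module.End ℂ B} (hS : S ∈ c.diffAlg) (hT : T ∈ c.diffAlg)
    (h : ∀ f, S (c.poly f) = T (c.poly f)) : S = T := by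
  obtain ⟨m, hm⟩ := sub_mem hS hT
  refine sub_eq_zero.1 (c.eq_zero_of_mem_diffOps hm fun p i s => ?_)
  have := h (∏ k ∈ s, MvPolynomial.X (i k))
  rw [map_prod] at this
  simpa [sub_eq_zero] using this

variable {H : Type*} [LieRing H] [LieAlgebra ℂ H] (e : Module.Basis (Fin n) ℂ H)

/-- The coefficient of `ħᵐ` in the star-product. -/
def starₗ (m : ℕ) : B →ₗ[ℂ] B →ₗ[ℂ] B :=
  ∑ p ∈ Finset.range (m + 1), ∑ q ∈ Finset.range (m + 1),
    ((p.factorial : ℂ)⁻¹ * (q.factorial : ℂ)⁻¹) • ∑ i : Fin p → Fin n, ∑ j : Fin q → Fin n,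
      (LinearMap.mul ℂ B).compl₁₂
        (LinearMap.mulLeft ℂ (c.poly (starSymbol e m i j)) * wordProd c.D i) (wordProd c.D j)

theorem starₗ_apply (m : ℕ) (f g : B) :
    c.starₗ e m f g = ∑ p ∈ Finset.range (m + 1), ∑ q ∈ Finset.range (m + 1),
      ((p.factorial : ℂ)⁻¹ * (q.factorial : ℂ)⁻¹) • ∑ i : Fin p → Fin n, ∑ j : Fin q → Fin n,
        c.poly (starSymbol e m i j) * wordProd c.D i f * wordProd c.D j g := by
  simp only [starₗ, LinearMap.sum_apply, LinearMap.smul_apply, LinearMap.compl₁₂_apply,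
    LinearMap.mul_apply_apply, Module.End.mul_apply, LinearMap.mulLeft_apply]

/-- `polyStar_eq_sum_starSymbol` and the defining formula have the same shape. Together with
`ext_of_mem_diffAlg`, this transports polynomial identities to `B`. -/
theorem starₗ_poly (m : ℕ) (f g : MvPolynomial (Fin n) ℂ) :
    c.starₗ e m (c.poly f) (c.poly g) = c.poly (polyStarₗ e m f g) := by
  rw [polyStar_eq_sum_starSymbol, starₗ_apply]
  simp only [map_sum, map_smul, map_mul, poly_wordProd]

theorem starₗ_mem_diffAlg (m : ℕ) (f : B) : c.starₗ e m f ∈ c.diffAlg := by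
  have : c.starₗ e m f = ∑ p ∈ Finset.range (m + 1), ∑ q ∈ Finset.range (m + 1),
      ((p.factorial : ℂ)⁻¹ * (q.factorial : ℂ)⁻¹) • ∑ i : Fin p → Fin n, ∑ j : Fin q → Fin n,
        LinearMap.mulLeft ℂ (c.poly (starSymbol e m i j) * wordProd c.D i f) * wordProd c.D j := by
    refine LinearMap.ext fun g => ?_
    simp only [starₗ_apply, LinearMap.sum_apply, LinearMap.smul_apply,
      Module.End.mul_apply, LinearMap.mulLeft_apply]
  rw [this]
  exact sum_mem fun p _ => sum_mem fun q _ => Subalgebra.smul_mem _ (sum_mem fun i _ =>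
    sum_mem fun j _ => mul_mem (c.mulLeft_mem_diffAlg _) (c.wordProd_mem_diffAlg j)) _

theorem starₗ_flip_mem_diffAlg (m : ℕ) (g : B) : (c.starₗ e m).flip g ∈ c.diffAlg := by
  have : (c.starₗ e m).flip g = ∑ p ∈ Finset.range (m + 1), ∑ q ∈ Finset.range (m + 1),
      ((p.factorial : ℂ)⁻¹ * (q.factorial : ℂ)⁻¹) • ∑ i : Fin p → Fin n, ∑ j : Fin q → Fin n,
        LinearMap.mulLeft ℂ (c.poly (starSymbol e m i j) * wordProd c.D j g) * wordProd c.D i := by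
    refine LinearMap.ext fun f => ?_
    simp only [LinearMap.flip_apply, starₗ_apply, LinearMap.sum_apply, LinearMap.smul_apply,
      Module.End.mul_apply, LinearMap.mulLeft_apply, mul_right_comm]
  rw [this]
  exact sum_mem fun p _ => sum_mem fun q _ => Subalgebra.smul_mem _ (sum_mem fun i _ =>
    sum_mem fun j _ => mul_mem (c.mulLeft_mem_diffAlg _) (c.wordProd_mem_diffAlg i)) _

/-- Bilinear maps that are differential operators in each argument and agree on polynomials are
equal. -/
theorem ext_bilin {S T : B →ₗ[ℂ] B →ₗ[ℂ] B} (hS : ∀ f, S f ∈ c.diffAlg) (hT : ∀ f, T f ∈ c.diffAlg)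
    (hS' : ∀ g, S.flip g ∈ c.diffAlg) (hT' : ∀ g, T.flip g ∈ c.diffAlg)
    (h : ∀ f g, S (c.poly f) (c.poly g) = T (c.poly f) (c.poly g)) : S = T := by
  refine LinearMap.ext fun f => c.ext_of_mem_diffAlg (hS f) (hT f) fun g => ?_
  exact congrArg (fun F => F f) (c.ext_of_mem_diffAlg (hS' (c.poly g)) (hT' (c.poly g))
    fun f => h f g)

/-- In each variable separately both sides are differential operators. The polynomial identity is
extended first in `h`, then in `g`, and finally in `f`. -/
theorem starₗ_assoc (m : ℕ) (f g h : B) :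
    ∑ a ∈ antidiagonal m, c.starₗ e a.1 (c.starₗ e a.2 f g) h =
      ∑ a ∈ antidiagonal m, c.starₗ e a.1 f (c.starₗ e a.2 g h) := by
  have h₁ : ∀ f g : MvPolynomial (Fin n) ℂ,
      ∑ a ∈ antidiagonal m, c.starₗ e a.1 (c.starₗ e a.2 (c.poly f) (c.poly g)) =
        ∑ a ∈ antidiagonal m, c.starₗ e a.1 (c.poly f) * c.starₗ e a.2 (c.poly g) := by
    refine fun f g => c.ext_of_mem_diffAlg (sum_mem fun a _ => c.starₗ_mem_diffAlg e _ _)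
      (sum_mem fun a _ => mul_mem (c.starₗ_mem_diffAlg e _ _) (c.starₗ_mem_diffAlg e _ _))
      fun h => ?_
    simp only [LinearMap.sum_apply, Module.End.mul_apply, starₗ_poly, ← map_sum, polyStarₗ_assoc]
  have h₂ : ∀ (f : MvPolynomial (Fin n) ℂ) (h : B),
      ∑ a ∈ antidiagonal m, (c.starₗ e a.1).flip h * c.starₗ e a.2 (c.poly f) =
        ∑ a ∈ antidiagonal m, c.starₗ e a.1 (c.poly f) * (c.starₗ e a.2).flip h := by
    refine fun f h => c.ext_of_mem_diffAlg
      (sum_mem fun a _ => mul_mem (c.starₗ_flip_mem_diffAlg e _ _) (c.starₗ_mem_diffAlg e _ _))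
      (sum_mem fun a _ => mul_mem (c.starₗ_mem_diffAlg e _ _) (c.starₗ_flip_mem_diffAlg e _ _))
      fun g => ?_
    simpa only [LinearMap.sum_apply, Module.End.mul_apply, LinearMap.flip_apply] using
      congrArg (fun F => F h) (h₁ f g)
  have h₃ : ∑ a ∈ antidiagonal m, (c.starₗ e a.1).flip h * (c.starₗ e a.2).flip g =
      ∑ a ∈ antidiagonal m, (c.starₗ e a.1).flip (c.starₗ e a.2 g h) := by
    refine c.ext_of_mem_diffAlg
      (sum_mem fun a _ => mul_mem (c.starₗ_flip_mem_diffAlg e _ _) (c.starₗ_flip_mem_diffAlg e _ _))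
      (sum_mem fun a _ => c.starₗ_flip_mem_diffAlg e _ _) fun f => ?_
    simpa only [LinearMap.sum_apply, Module.End.mul_apply, LinearMap.flip_apply] using
      congrArg (fun F => F g) (h₂ f h)
  simpa only [LinearMap.sum_apply, Module.End.mul_apply, LinearMap.flip_apply] using
    congrArg (fun F => F f) h₃

theorem starₗ_one_left (m : ℕ) (f : B) : c.starₗ e m 1 f = if m = 0 then f else 0 := by
  have : c.starₗ e m 1 = if m = 0 then 1 else 0 := by
    refine c.ext_of_mem_diffAlg (c.starₗ_mem_diffAlg e _ _)
      (by split_ifs; exacts [one_mem _, zero_mem _]) fun f => ?_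
    rw [← map_one c.poly, starₗ_poly, polyStarₗ_one_left]
    split_ifs <;> simp
  rw [this]
  split_ifs <;> rfl

theorem starₗ_one_right (m : ℕ) (f : B) : c.starₗ e m f 1 = if m = 0 then f else 0 := by
  have : (c.starₗ e m).flip 1 = if m = 0 then 1 else 0 := by
    refine c.ext_of_mem_diffAlg (c.starₗ_flip_mem_diffAlg e _ _)
      (by split_ifs; exacts [one_mem _, zero_mem _]) fun f => ?_
    rw [← map_one c.poly, LinearMap.flip_apply, starₗ_poly, polyStarₗ_one_right]
    split_ifs <;> simp
  have := congrArg (fun F => F f) this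
  rw [LinearMap.flip_apply] at this
  rw [this]
  split_ifs <;> rfl

theorem starₗ_zero (f g : B) : c.starₗ e 0 f g = f * g := by
  have : c.starₗ e 0 = LinearMap.mul ℂ B := by
    refine c.ext_bilin (c.starₗ_mem_diffAlg e _) c.mulLeft_mem_diffAlg (c.starₗ_flip_mem_diffAlg e _)
      (fun g => ?_) fun f g => ?_
    · convert c.mulLeft_mem_diffAlg g using 1
      exact LinearMap.ext fun f => mul_comm _ _
    · rw [starₗ_poly, polyStarₗ_zero, map_mul, LinearMap.mul_apply_apply]
  rw [this, LinearMap.mul_apply_apply]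

theorem starₗ_lin_sub (m : ℕ) (x : H) (f : B) :
    c.starₗ e m (c.poly (lin e x)) f - c.starₗ e m f (c.poly (lin e x)) =
      if m = 1 then ∑ i, c.poly (lin e ⁅x, e i⁆) * c.D i f else 0 := by
  have : c.starₗ e m (c.poly (lin e x)) - (c.starₗ e m).flip (c.poly (lin e x)) =
      if m = 1 then ∑ i, LinearMap.mulLeft ℂ (c.poly (lin e ⁅x, e i⁆)) * c.D i else 0 := by
    refine c.ext_of_mem_diffAlg
      (sub_mem (c.starₗ_mem_diffAlg e _ _) (c.starₗ_flip_mem_diffAlg e _ _)) ?_ fun f => ?_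
    · split_ifs
      exacts [sum_mem fun i _ => mul_mem (c.mulLeft_mem_diffAlg _) (c.D_mem_diffAlg i), zero_mem _]
    · rw [LinearMap.sub_apply, LinearMap.flip_apply, starₗ_poly, starₗ_poly, ← map_sub,
        polyStarₗ_lin_sub]
      split_ifs
      · simp only [map_sum, map_mul, ← polyD_apply, poly_polyD, LinearMap.sum_apply,
          Module.End.mul_apply, LinearMap.mulLeft_apply]
      · simp
  have := congrArg (fun F => F f) this
  rw [LinearMap.sub_apply, LinearMap.flip_apply] at this
  rw [this]
  split_ifs
  · simp only [LinearMap.sum_apply, Module.End.mul_apply, LinearMap.mulLeft_apply]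
  · rfl

/-- The coefficient of `ħᴺ` in the shift, after application of a functional. -/
def shiftₗ (φ : U H →ₗ[ℂ] ℂ) (N : ℕ) : Module.End ℂ B :=
  ((N.factorial : ℂ)⁻¹) • ∑ i : Fin N → Fin n, φ (basisWord e i) • wordProd c.D i

theorem shiftₗ_poly (φ : U H →ₗ[ℂ] ℂ) (N : ℕ) (f : MvPolynomial (Fin n) ℂ) :
    c.shiftₗ e φ N (c.poly f) = c.poly (polyShift e φ N f) := by
  simp only [shiftₗ, polyShift, LinearMap.smul_apply, LinearMap.sum_apply, map_smul, map_sum,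
    poly_wordProd]

theorem shiftₗ_mem_diffAlg (φ : U H →ₗ[ℂ] ℂ) (N : ℕ) : c.shiftₗ e φ N ∈ c.diffAlg :=
  Subalgebra.smul_mem _ (sum_mem fun i _ => Subalgebra.smul_mem _ (c.wordProd_mem_diffAlg i) _) _

/-- The same extension from polynomials, first in `g` and then in `f`. -/
theorem shiftₗ_starₗ (φ : U H →ₗ[ℂ] ℂ) (N : ℕ) (f g : B) :
    ∑ a ∈ antidiagonal N, c.shiftₗ e φ a.1 (c.starₗ e a.2 f g) =
      ∑ a ∈ antidiagonal N, ∑ b ∈ antidiagonal a.2,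
        ((b.1.factorial : ℂ)⁻¹ * (b.2.factorial : ℂ)⁻¹) •
          ∑ i : Fin b.1 → Fin n, ∑ j : Fin b.2 → Fin n, φ (basisWord e i * basisWord e j) •
            c.starₗ e a.1 (wordProd c.D i f) (wordProd c.D j g) := by
  have h₁ : ∀ f : MvPolynomial (Fin n) ℂ,
      ∑ a ∈ antidiagonal N, c.shiftₗ e φ a.1 * c.starₗ e a.2 (c.poly f) =
        ∑ a ∈ antidiagonal N, ∑ b ∈ antidiagonal a.2,
          ((b.1.factorial : ℂ)⁻¹ * (b.2.factorial : ℂ)⁻¹) •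
            ∑ i : Fin b.1 → Fin n, ∑ j : Fin b.2 → Fin n, φ (basisWord e i * basisWord e j) •
              (c.starₗ e a.1 (wordProd c.D i (c.poly f)) * wordProd c.D j) := by
    refine fun f => c.ext_of_mem_diffAlg
      (sum_mem fun a _ => mul_mem (c.shiftₗ_mem_diffAlg e _ _) (c.starₗ_mem_diffAlg e _ _))
      (sum_mem fun a _ => sum_mem fun b _ => Subalgebra.smul_mem _ (sum_mem fun i _ =>
        sum_mem fun j _ => Subalgebra.smul_mem _ (mul_mem (c.starₗ_mem_diffAlg e _ _)
          (c.wordProd_mem_diffAlg j)) _) _) fun g => ?_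
    simp only [LinearMap.sum_apply, LinearMap.smul_apply, Module.End.mul_apply, ← poly_wordProd,
      starₗ_poly, shiftₗ_poly, ← map_sum, ← map_smul, polyShift_polyStarₗ]
  have h₂ : ∑ a ∈ antidiagonal N, c.shiftₗ e φ a.1 * (c.starₗ e a.2).flip g =
        ∑ a ∈ antidiagonal N, ∑ b ∈ antidiagonal a.2,
          ((b.1.factorial : ℂ)⁻¹ * (b.2.factorial : ℂ)⁻¹) •
            ∑ i : Fin b.1 → Fin n, ∑ j : Fin b.2 → Fin n, φ (basisWord e i * basisWord e j) •
              ((c.starₗ e a.1).flip (wordProd c.D j g) * wordProd c.D i) := by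
    refine c.ext_of_mem_diffAlg
      (sum_mem fun a _ => mul_mem (c.shiftₗ_mem_diffAlg e _ _) (c.starₗ_flip_mem_diffAlg e _ _))
      (sum_mem fun a _ => sum_mem fun b _ => Subalgebra.smul_mem _ (sum_mem fun i _ =>
        sum_mem fun j _ => Subalgebra.smul_mem _ (mul_mem (c.starₗ_flip_mem_diffAlg e _ _)
          (c.wordProd_mem_diffAlg i)) _) _) fun f => ?_
    simpa only [LinearMap.sum_apply, LinearMap.smul_apply, Module.End.mul_apply,
      LinearMap.flip_apply] using congrArg (fun F => F g) (h₁ f)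
  simpa only [LinearMap.sum_apply, LinearMap.smul_apply, Module.End.mul_apply,
    LinearMap.flip_apply] using congrArg (fun F => F f) h₂

end Coordinates

/-- Elements of `M ⊗ V` that agree after application of all functionals on `V` are equal. -/
theorem tensor_ext_right {M V : Type*} [AddCommGroup M] [Module ℂ M] [AddCommGroup V] [Module ℂ V]
    {z w : M ⊗[ℂ] V}
    (h : ∀ φ : V →ₗ[ℂ] ℂ, TensorProduct.rid ℂ M (φ.lTensor M z) =
      TensorProduct.rid ℂ M (φ.lTensor M w)) : z = w := by
  classical
  let b := Module.Basis.ofVectorSpace ℂ V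
  refine (TensorProduct.equivFinsuppOfBasisRight b).injective (Finsupp.ext fun k => ?_)
  have key : ∀ z : M ⊗[ℂ] V, TensorProduct.equivFinsuppOfBasisRight b z k =
      TensorProduct.rid ℂ M ((b.coord k).lTensor M z) := by
    intro z
    induction z using TensorProduct.induction_on with
    | zero => simp
    | add z w hz hw => simp only [map_add, Finsupp.add_apply, hz, hw]
    | tmul m v => simp
  rw [key, key, h]

/-- The star-product and the shift are compatible. -/
theorem Coordinates.sum_starₗ_tmul_basisWord {n : ℕ} {B : Type*} [CommRing B] [Algebra ℂ B]
    (c : Coordinates n B) {H : Type*} [LieRing H] [LieAlgebra ℂ H] (e : Module.Basis (Fin n) ℂ H)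
    (N : ℕ) (f g : B) :
    ∑ a ∈ antidiagonal N, ((a.1.factorial : ℂ)⁻¹) • ∑ i : Fin a.1 → Fin n,
        wordProd c.D i (c.starₗ e a.2 f g) ⊗ₜ[ℂ] basisWord e i =
      ∑ a ∈ antidiagonal N, ∑ b ∈ antidiagonal a.2,
        ((b.1.factorial : ℂ)⁻¹ * (b.2.factorial : ℂ)⁻¹) •
          ∑ i : Fin b.1 → Fin n, ∑ j : Fin b.2 → Fin n,
            c.starₗ e a.1 (wordProd c.D i f) (wordProd c.D j g) ⊗ₜ[ℂ]
              (basisWord e i * basisWord e j) := by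
  -- A functional on the second factor makes both sides `B`-valued, where the extension from
  -- polynomials has been carried out; this is the purpose of `φ` in the shift.
  refine tensor_ext_right fun φ => ?_
  simp only [map_sum, map_smul, LinearMap.lTensor_tmul, TensorProduct.rid_tmul]
  simpa only [Coordinates.shiftₗ, LinearMap.smul_apply, LinearMap.sum_apply] using
    c.shiftₗ_starₗ e φ N f g

/-! ## Coordinates on meromorphic functions -/

theorem partialFun_comm {n : ℕ} (i j : Fin n) {f : (Fin n → ℂ) → ℂ} {x : Fin n → ℂ}
    (hf : AnalyticAt ℂ f x) :
    partialFun i (partialFun j f) x = partialFun j (partialFun i f) x := by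
  have h : ∀ i j, partialFun i (partialFun j f) x =
      fderiv ℂ (fderiv ℂ f) x (Pi.single i 1) (Pi.single j 1) := fun i j => by
    have := (hf.fderiv.differentiableAt.hasFDerivAt.clm_apply
      (hasFDerivAt_const (Pi.single j (1 : ℂ) : Fin n → ℂ) x)).fderiv
    change fderiv ℂ (fun y => fderiv ℂ f y (Pi.single j 1)) x _ = _
    rw [this]
    simp
  rw [h, h]
  exact (hf.contDiffAt (n := 2)).isSymmSndFDerivAt (by simp) _ _

theorem pderiv_leibniz {n : ℕ} (i : Fin n) (f g : Mer n) :
    pderiv i (f * g) = pderiv i f * g + f * pderiv i g := by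
  obtain ⟨_, f, hf, rfl⟩ := f
  obtain ⟨_, g, hg, rfl⟩ := g
  refine Subtype.ext (Filter.Germ.coe_eq.2 ?_)
  filter_upwards [hf.analyticAt, hg.analyticAt] with x hx hy
  have := fderiv_mul hx.differentiableAt hy.differentiableAt
  change fderiv ℂ (f * g) x _ = fderiv ℂ f x _ * g x + f x * fderiv ℂ g x _
  rw [this]
  simp
  ring

theorem pderiv_comm {n : ℕ} (i j : Fin n) : Commute (pderiv i) (pderiv j) :=
  LinearMap.ext fun f => by
    obtain ⟨_, f, hf, rfl⟩ := f
    refine Subtype.ext (Filter.Germ.coe_eq.2 ?_)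
    filter_upwards [hf.analyticAt] with x hx
    exact partialFun_comm i j hx

theorem pderiv_coord {n : ℕ} (i j : Fin n) :
    pderiv i (coord j) = if i = j then 1 else 0 := by
  have h : ∀ x : Fin n → ℂ, partialFun i (fun x => x j) x = if i = j then 1 else 0 := fun x => by
    have := (ContinuousLinearMap.proj (R := ℂ) (φ := fun _ : Fin n => ℂ) j).hasFDerivAt (x := x)
    have h2 : fderiv ℂ (fun x : Fin n → ℂ => x j) x =
        ContinuousLinearMap.proj (R := ℂ) (φ := fun _ : Fin n => ℂ) j := this.fderiv
    rw [partialFun, h2]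
    simp [Pi.single_apply, eq_comm]
  refine Subtype.ext ?_
  split_ifs with hij
  · exact Filter.Germ.coe_eq.2 (Filter.Eventually.of_forall fun x => by
      change partialFun i (fun x => x j) x = 1
      rw [h, if_pos hij])
  · exact Filter.Germ.coe_eq.2 (Filter.Eventually.of_forall fun x => by
      change partialFun i (fun x => x j) x = 0
      rw [h, if_neg hij])

/-- The coordinates on meromorphic functions. -/
def merCoordinates (n : ℕ) : Coordinates n (Mer n) where
  D := pderiv
  x := coord
  leibniz := pderiv_leibniz
  comm := pderiv_comm
  D_x := pderiv_coord

theorem Coordinates.wordProd_one {n : ℕ} {B : Type*} [CommRing B] [Algebra ℂ B]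
    (c : Coordinates n B) {p : ℕ} (i : Fin (p + 1) → Fin n) : wordProd c.D i 1 = 0 := by
  refine c.apply_one_of_mem_constOps_succ (k := p) (Submodule.subset_span ⟨List.ofFn i, by simp, ?_⟩)
  rw [List.map_ofFn]
  rfl

/-! ## The star-product on series of vector-valued meromorphic functions -/

section StarRing

variable {n : ℕ} {H : Type*} [LieRing H] [LieAlgebra ℂ H] (e : Module.Basis (Fin n) ℂ H)
  {W : Type*} [Ring W] [Algebra ℂ W] {W' : Type*} [Ring W'] [Algebra ℂ W']

/-- The coefficient of `ħᵐ` in the star-product of scalar meromorphic functions. -/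
abbrev merStar (m : ℕ) : Mer n →ₗ[ℂ] Mer n →ₗ[ℂ] Mer n := (merCoordinates n).starₗ e m

theorem pderivs_eq {V : Type*} [AddCommGroup V] [Module ℂ V] {p : ℕ} (i : Fin p → Fin n) :
    pderivs (W := V) i = (wordProd pderiv i).rTensor V := by
  change wordProd (fun k => (pderiv k).rTensor V) i = _
  induction p with
  | zero => simp [wordProd, Module.End.one_eq_id]
  | succ p ih =>
    rw [← Fin.cons_self_tail i, wordProd_cons, wordProd_cons, ih, LinearMap.rTensor_mul]

theorem pderivs_tmul {V : Type*} [AddCommGroup V] [Module ℂ V] {p : ℕ} (i : Fin p → Fin n)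
    (f : Mer n) (v : V) : pderivs i (f ⊗ₜ v) = wordProd pderiv i f ⊗ₜ v := by
  rw [pderivs_eq, LinearMap.rTensor_tmul]

/-- The coefficients of the star-product as bilinear maps. -/
def starCoeffₗ (m : ℕ) : MerVal n W →ₗ[ℂ] MerVal n W →ₗ[ℂ] MerVal n W :=
  ∑ p ∈ Finset.range (m + 1), ∑ q ∈ Finset.range (m + 1),
    ((p.factorial : ℂ)⁻¹ * (q.factorial : ℂ)⁻¹) • ∑ i : Fin p → Fin n, ∑ j : Fin q → Fin n,
      (LinearMap.mul ℂ (MerVal n W)).compl₁₂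
        (LinearMap.mulLeft ℂ (polyMer n (starSymbol e m i j) ⊗ₜ[ℂ] (1 : W)) ∘ₗ pderivs i)
        (pderivs j)

theorem starCoeffₗ_apply (m : ℕ) (F G : MerVal n W) :
    starCoeffₗ e m F G = starCoeff e m F G := by
  simp only [starCoeffₗ, starCoeff, LinearMap.sum_apply, LinearMap.smul_apply,
    LinearMap.compl₁₂_apply, LinearMap.mul_apply_apply, LinearMap.comp_apply,
    LinearMap.mulLeft_apply]

/-- Functions are star-multiplied and values multiplied independently, so identities for scalar
functions pass to values in any algebra. -/
theorem starCoeffₗ_tmul (m : ℕ) (f g : Mer n) (w w' : W) :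
    starCoeffₗ e m (f ⊗ₜ w) (g ⊗ₜ w') = merStar e m f g ⊗ₜ[ℂ] (w * w') := by
  rw [starCoeffₗ_apply, starCoeff, Coordinates.starₗ_apply]
  simp only [pderivs_tmul, Algebra.TensorProduct.tmul_mul_tmul, one_mul, TensorProduct.sum_tmul,
    TensorProduct.smul_tmul', Finset.smul_sum]
  rfl

theorem starCoeffₗ_assoc (m : ℕ) (F G K : MerVal n W) :
    ∑ a ∈ antidiagonal m, starCoeffₗ e a.1 (starCoeffₗ e a.2 F G) K =
      ∑ a ∈ antidiagonal m, starCoeffₗ e a.1 F (starCoeffₗ e a.2 G K) := by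
  induction F using TensorProduct.induction_on with
  | zero => simp
  | add F F' hF hF' => simp only [map_add, LinearMap.add_apply, Finset.sum_add_distrib, hF, hF']
  | tmul f w =>
  induction G using TensorProduct.induction_on with
  | zero => simp
  | add F F' hF hF' => simp only [map_add, LinearMap.add_apply, Finset.sum_add_distrib, hF, hF']
  | tmul g w' =>
  induction K using TensorProduct.induction_on with
  | zero => simp
  | add F F' hF hF' => simp only [map_add, Finset.sum_add_distrib, hF, hF']
  | tmul k w'' =>
    simp only [starCoeffₗ_tmul, mul_assoc, ← TensorProduct.sum_tmul, Coordinates.starₗ_assoc]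

theorem starCoeffₗ_const_left (m : ℕ) (w : W) (F : MerVal n W) :
    starCoeffₗ e m (1 ⊗ₜ w) F = if m = 0 then (1 : Mer n) ⊗ₜ w * F else 0 := by
  induction F using TensorProduct.induction_on with
  | zero => simp
  | add F F' hF hF' => rw [map_add, hF, hF']; split_ifs <;> simp [mul_add]
  | tmul f w' =>
    rw [starCoeffₗ_tmul, Coordinates.starₗ_one_left]
    split_ifs <;> simp [Algebra.TensorProduct.tmul_mul_tmul]

theorem starCoeffₗ_const_right (m : ℕ) (w : W) (F : MerVal n W) :
    starCoeffₗ e m F (1 ⊗ₜ w) = if m = 0 then F * (1 : Mer n) ⊗ₜ w else 0 := by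
  induction F using TensorProduct.induction_on with
  | zero => simp
  | add F F' hF hF' => rw [map_add, LinearMap.add_apply, hF, hF']; split_ifs <;> simp [add_mul]
  | tmul f w' =>
    rw [starCoeffₗ_tmul, Coordinates.starₗ_one_right]
    split_ifs <;> simp [Algebra.TensorProduct.tmul_mul_tmul]

theorem starCoeffₗ_zero (F G : MerVal n W) : starCoeffₗ e 0 F G = F * G := by
  induction F using TensorProduct.induction_on with
  | zero => simp
  | add F F' hF hF' => rw [map_add, LinearMap.add_apply, hF, hF', add_mul]
  | tmul f w =>
  induction G using TensorProduct.induction_on with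
  | zero => simp
  | add F F' hF hF' => rw [map_add, hF, hF', mul_add]
  | tmul g w' =>
    rw [starCoeffₗ_tmul, Coordinates.starₗ_zero, Algebra.TensorProduct.tmul_mul_tmul]

theorem onValues_starCoeffₗ (φ : W →ₐ[ℂ] W') (m : ℕ) (F G : MerVal n W) :
    onValues n φ (starCoeffₗ e m F G) = starCoeffₗ e m (onValues n φ F) (onValues n φ G) := by
  induction F using TensorProduct.induction_on with
  | zero => simp
  | add F F' hF hF' => simp only [map_add, LinearMap.add_apply, hF, hF']
  | tmul f w =>
  induction G using TensorProduct.induction_on with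
  | zero => simp
  | add F F' hF hF' => simp only [map_add, hF, hF']
  | tmul g w' => simp [onValues, starCoeffₗ_tmul]

theorem coeff_star (F G : PowerSeries (MerVal n W)) (N : ℕ) :
    PowerSeries.coeff N (star e F G) = ∑ a ∈ antidiagonal N, ∑ b ∈ antidiagonal a.2,
      starCoeffₗ e a.1 (PowerSeries.coeff b.1 F) (PowerSeries.coeff b.2 G) := by
  simp only [star, PowerSeries.coeff_mk, starCoeffₗ_apply]

/-- A reindexing. The arguments of `f` are the orders of two nested star-products, followed by those
of three series; the two star orders are gathered in one antidiagonal, where `starCoeffₗ_assoc`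
applies. -/
theorem sum_antidiagonal_nested_left {V : Type*} [AddCommMonoid V] (f : ℕ → ℕ → ℕ → ℕ → ℕ → V)
    (N : ℕ) :
    ∑ a ∈ antidiagonal N, ∑ b ∈ antidiagonal a.2, ∑ c ∈ antidiagonal b.1, ∑ d ∈ antidiagonal c.2,
        f a.1 c.1 d.1 d.2 b.2 =
      ∑ s ∈ antidiagonal N, ∑ t ∈ antidiagonal s.2, ∑ u ∈ antidiagonal t.1, ∑ v ∈ antidiagonal s.1,
        f v.1 v.2 u.1 u.2 t.2 := by
  simp only [Finset.sum_sigma']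
  refine Finset.sum_nbij'
    (fun x => ⟨(x.1.1 + x.2.2.1.1, x.2.2.2.1 + x.2.2.2.2 + x.2.1.2),
      (x.2.2.2.1 + x.2.2.2.2, x.2.1.2), x.2.2.2, (x.1.1, x.2.2.1.1)⟩)
    (fun x => ⟨(x.2.2.2.1, x.2.2.2.2 + x.2.2.1.1 + x.2.2.1.2 + x.2.1.2),
      (x.2.2.2.2 + x.2.2.1.1 + x.2.2.1.2, x.2.1.2), (x.2.2.2.2, x.2.2.1.1 + x.2.2.1.2), x.2.2.1⟩)
    ?_ ?_ ?_ ?_ ?_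
  · rintro ⟨⟨a, a'⟩, ⟨b, b'⟩, ⟨c, c'⟩, ⟨d, d'⟩⟩
    simp only [Finset.mem_sigma, Finset.HasAntidiagonal.mem_antidiagonal]
    rintro ⟨rfl, rfl, rfl, rfl⟩
    simp
    omega
  · rintro ⟨⟨a, a'⟩, ⟨b, b'⟩, ⟨c, c'⟩, ⟨d, d'⟩⟩
    simp only [Finset.mem_sigma, Finset.HasAntidiagonal.mem_antidiagonal]
    rintro ⟨rfl, rfl, rfl, rfl⟩
    simp
    omega
  · rintro ⟨⟨a, a'⟩, ⟨b, b'⟩, ⟨c, c'⟩, ⟨d, d'⟩⟩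
    simp only [Finset.mem_sigma, Finset.HasAntidiagonal.mem_antidiagonal]
    rintro ⟨rfl, rfl, rfl, rfl⟩
    simp [add_assoc]
  · rintro ⟨⟨a, a'⟩, ⟨b, b'⟩, ⟨c, c'⟩, ⟨d, d'⟩⟩
    simp only [Finset.mem_sigma, Finset.HasAntidiagonal.mem_antidiagonal]
    rintro ⟨rfl, rfl, rfl, rfl⟩
    simp [add_assoc]
  · rintro ⟨⟨a, a'⟩, ⟨b, b'⟩, ⟨c, c'⟩, ⟨d, d'⟩⟩ _
    rfl

theorem sum_antidiagonal_nested_right {V : Type*} [AddCommMonoid V] (f : ℕ → ℕ → ℕ → ℕ → ℕ → V)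
    (N : ℕ) :
    ∑ a ∈ antidiagonal N, ∑ b ∈ antidiagonal a.2, ∑ c ∈ antidiagonal b.2, ∑ d ∈ antidiagonal c.2,
        f a.1 c.1 b.1 d.1 d.2 =
      ∑ s ∈ antidiagonal N, ∑ t ∈ antidiagonal s.2, ∑ u ∈ antidiagonal t.1, ∑ v ∈ antidiagonal s.1,
        f v.1 v.2 u.1 u.2 t.2 := by
  simp only [Finset.sum_sigma']
  refine Finset.sum_nbij'
    (fun x => ⟨(x.1.1 + x.2.2.1.1, x.2.1.1 + x.2.2.2.1 + x.2.2.2.2),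
      (x.2.1.1 + x.2.2.2.1, x.2.2.2.2), (x.2.1.1, x.2.2.2.1), (x.1.1, x.2.2.1.1)⟩)
    (fun x => ⟨(x.2.2.2.1, x.2.2.2.2 + x.2.2.1.1 + x.2.2.1.2 + x.2.1.2),
      (x.2.2.1.1, x.2.2.2.2 + x.2.2.1.2 + x.2.1.2), (x.2.2.2.2, x.2.2.1.2 + x.2.1.2),
      (x.2.2.1.2, x.2.1.2)⟩)
    ?_ ?_ ?_ ?_ ?_
  · rintro ⟨⟨a, a'⟩, ⟨b, b'⟩, ⟨c, c'⟩, ⟨d, d'⟩⟩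
    simp only [Finset.mem_sigma, Finset.HasAntidiagonal.mem_antidiagonal]
    rintro ⟨rfl, rfl, rfl, rfl⟩
    simp
    omega
  · rintro ⟨⟨a, a'⟩, ⟨b, b'⟩, ⟨c, c'⟩, ⟨d, d'⟩⟩
    simp only [Finset.mem_sigma, Finset.HasAntidiagonal.mem_antidiagonal]
    rintro ⟨rfl, rfl, rfl, rfl⟩
    simp
    omega
  · rintro ⟨⟨a, a'⟩, ⟨b, b'⟩, ⟨c, c'⟩, ⟨d, d'⟩⟩
    simp only [Finset.mem_sigma, Finset.HasAntidiagonal.mem_antidiagonal]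
    rintro ⟨rfl, rfl, rfl, rfl⟩
    simp
    omega
  · rintro ⟨⟨a, a'⟩, ⟨b, b'⟩, ⟨c, c'⟩, ⟨d, d'⟩⟩
    simp only [Finset.mem_sigma, Finset.HasAntidiagonal.mem_antidiagonal]
    rintro ⟨rfl, rfl, rfl, rfl⟩
    simp [add_assoc]
  · rintro ⟨⟨a, a'⟩, ⟨b, b'⟩, ⟨c, c'⟩, ⟨d, d'⟩⟩ _
    rfl

theorem star_assoc (F G K : PowerSeries (MerVal n W)) :
    star e (star e F G) K = star e F (star e G K) := by
  ext N
  simp only [coeff_star, map_sum, LinearMap.sum_apply]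
  rw [sum_antidiagonal_nested_left (fun v v' i j k => starCoeffₗ e v (starCoeffₗ e v'
      (PowerSeries.coeff i F) (PowerSeries.coeff j G)) (PowerSeries.coeff k K)),
    sum_antidiagonal_nested_right (fun v v' i j k => starCoeffₗ e v (PowerSeries.coeff i F)
      (starCoeffₗ e v' (PowerSeries.coeff j G) (PowerSeries.coeff k K)))]
  simp only [starCoeffₗ_assoc]

theorem coeff_const (F : PowerSeries W) (N : ℕ) :
    PowerSeries.coeff N (const n F) = (1 : Mer n) ⊗ₜ[ℂ] PowerSeries.coeff N F :=
  PowerSeries.coeff_map _ _ _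

theorem star_const_left (F : PowerSeries W) (G : PowerSeries (MerVal n W)) :
    star e (const n F) G = const n F * G := by
  ext N
  rw [coeff_star, PowerSeries.coeff_mul, Finset.sum_eq_single (0, N)]
  · refine Finset.sum_congr rfl fun b _ => ?_
    rw [coeff_const, starCoeffₗ_const_left, if_pos rfl]
  · rintro ⟨a, a'⟩ ha hne
    refine Finset.sum_eq_zero fun b _ => ?_
    rw [Finset.HasAntidiagonal.mem_antidiagonal] at ha
    rw [coeff_const, starCoeffₗ_const_left, if_neg]
    rintro rfl
    simp_all
  · intro h
    simp at h

theorem star_const_right (F : PowerSeries W) (G : PowerSeries (MerVal n W)) :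
    star e G (const n F) = G * const n F := by
  ext N
  rw [coeff_star, PowerSeries.coeff_mul, Finset.sum_eq_single (0, N)]
  · refine Finset.sum_congr rfl fun b _ => ?_
    rw [coeff_const, starCoeffₗ_const_right, if_pos rfl]
  · rintro ⟨a, a'⟩ ha hne
    refine Finset.sum_eq_zero fun b _ => ?_
    rw [Finset.HasAntidiagonal.mem_antidiagonal] at ha
    rw [coeff_const, starCoeffₗ_const_right, if_neg]
    rintro rfl
    simp_all
  · intro h
    simp at h

theorem star_add (F G K : PowerSeries (MerVal n W)) :
    star e F (G + K) = star e F G + star e F K := by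
  ext N
  simp only [map_add, coeff_star, Finset.sum_add_distrib]

theorem add_star (F G K : PowerSeries (MerVal n W)) :
    star e (F + G) K = star e F K + star e G K := by
  ext N
  simp only [map_add, LinearMap.add_apply, coeff_star, Finset.sum_add_distrib]

theorem zero_star (F : PowerSeries (MerVal n W)) : star e 0 F = 0 := by
  ext N
  simp only [coeff_star, map_zero, LinearMap.zero_apply, Finset.sum_const_zero]

theorem star_zero (F : PowerSeries (MerVal n W)) : star e F 0 = 0 := by
  ext N
  simp only [coeff_star, map_zero, Finset.sum_const_zero]

theorem const_one : const n (1 : PowerSeries W) = 1 := map_one (onSeries _)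

theorem one_star (F : PowerSeries (MerVal n W)) : star e 1 F = F := by
  rw [← const_one, star_const_left, const_one, one_mul]

theorem star_one (F : PowerSeries (MerVal n W)) : star e F 1 = F := by
  rw [← const_one, star_const_right, const_one, mul_one]

theorem coeff_leg (φ : W →ₐ[ℂ] W') (F : PowerSeries (MerVal n W)) (N : ℕ) :
    PowerSeries.coeff N (leg φ F) = onValues n φ (PowerSeries.coeff N F) :=
  PowerSeries.coeff_map _ _ _

theorem leg_star (φ : W →ₐ[ℂ] W') (F G : PowerSeries (MerVal n W)) :
    leg φ (star e F G) = star e (leg φ F) (leg φ G) := by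
  ext N
  simp only [coeff_leg, coeff_star, map_sum, onValues_starCoeffₗ]

/-- The ring of series of meromorphic functions for the star-product. -/
def StarSeries (_e : Module.Basis (Fin n) ℂ H) (W : Type*) [Ring W] [Algebra ℂ W] : Type _ :=
  PowerSeries (MerVal n W)

instance : AddCommGroup (StarSeries e W) := inferInstanceAs (AddCommGroup (PowerSeries (MerVal n W)))

instance : Ring (StarSeries e W) where
  __ := (inferInstance : AddCommGroup (StarSeries e W))
  mul := star e
  one := (1 : PowerSeries (MerVal n W))
  left_distrib := star_add e
  right_distrib := add_star e
  zero_mul := zero_star e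
  mul_zero := star_zero e
  mul_assoc := star_assoc e
  one_mul := one_star e
  mul_one := star_one e

namespace StarSeries

/-- The identity map. -/
def of : PowerSeries (MerVal n W) →+ StarSeries e W := AddMonoidHom.id _

variable {e} in
/-- The coefficient of `ħᴺ`. -/
def coeff (N : ℕ) : StarSeries e W →+ MerVal n W :=
  (PowerSeries.coeff (R := MerVal n W) N).toAddMonoidHom

variable {e}

theorem of_star (F G : PowerSeries (MerVal n W)) : of e (star e F G) = of e F * of e G := rfl

theorem of_injective : Function.Injective (of e : PowerSeries (MerVal n W) →+ StarSeries e W) :=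
  Function.injective_id

theorem coeff_of (N : ℕ) (F : PowerSeries (MerVal n W)) :
    coeff N (of e F) = PowerSeries.coeff N F := rfl

@[ext] theorem ext {F G : StarSeries e W} (h : ∀ N, coeff N F = coeff N G) : F = G :=
  PowerSeries.ext h

theorem coeff_one (N : ℕ) : coeff N (1 : StarSeries e W) = if N = 0 then 1 else 0 :=
  PowerSeries.coeff_one N

theorem coeff_mul (N : ℕ) (F G : StarSeries e W) :
    coeff N (F * G) = ∑ a ∈ antidiagonal N, ∑ b ∈ antidiagonal a.2,
      starCoeffₗ e a.1 (coeff b.1 F) (coeff b.2 G) :=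
  DynTwist.coeff_star e F G N

theorem coeff_zero_mul (F G : StarSeries e W) : coeff 0 (F * G) = coeff 0 F * coeff 0 G := by
  simp [coeff_mul, starCoeffₗ_zero]

theorem coeff_mul_congr {F F' G G' : StarSeries e W} {N : ℕ} (hF : ∀ k ≤ N, coeff k F = coeff k F')
    (hG : ∀ k ≤ N, coeff k G = coeff k G') : coeff N (F * G) = coeff N (F' * G') := by
  rw [coeff_mul, coeff_mul]
  refine Finset.sum_congr rfl fun a ha => Finset.sum_congr rfl fun b hb => ?_
  rw [Finset.HasAntidiagonal.mem_antidiagonal] at ha hb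
  rw [hF _ (by omega), hG _ (by omega)]

theorem coeff_pow_eq_zero {F : StarSeries e W} (hF : coeff 0 F = 0) (k : ℕ) {N : ℕ} (hN : N < k) :
    coeff N (F ^ k) = 0 := by
  induction k generalizing N with
  | zero => omega
  | succ k ih =>
    rw [pow_succ, coeff_mul]
    refine Finset.sum_eq_zero fun a ha => Finset.sum_eq_zero fun b hb => ?_
    rw [Finset.HasAntidiagonal.mem_antidiagonal] at ha hb
    rcases Nat.eq_zero_or_pos b.2 with h | h
    · rw [h, hF, map_zero]
    · rw [ih (by omega), map_zero, LinearMap.zero_apply]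

/-- A series with constant term `1` is invertible. -/
theorem isUnit_of_coeff_zero {F : StarSeries e W} (hF : coeff 0 F = 1) : IsUnit F := by
  let D := 1 - F
  have hD : coeff 0 D = 0 := by
    rw [map_sub, coeff_one, if_pos rfl, hF, sub_self]
  let S : ℕ → StarSeries e W := fun N => ∑ k ∈ Finset.range (N + 1), D ^ k
  -- The geometric series in `D`: since `D ^ k` starts at order `k`, the coefficient of order `N` is
  -- already that of the partial sum `S N`.
  let G : StarSeries e W := of e (PowerSeries.mk fun N => coeff N (S N))
  have hG : ∀ N, ∀ k ≤ N, coeff k G = coeff k (S N) := by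
    intro N k hk
    rw [coeff_of, PowerSeries.coeff_mk, map_sum, map_sum]
    refine Finset.sum_subset (Finset.range_subset_range.2 (by omega)) fun j _ hj => ?_
    exact coeff_pow_eq_zero hD j (by simpa using hj)
  -- A partial sum inverts `F` up to a power of `D` that is invisible at order `N`.
  have hpow : ∀ N, coeff N (1 - D ^ (N + 1)) = coeff N (1 : StarSeries e W) := fun N =>
    (map_sub _ _ _).trans (sub_eq_self.2 (coeff_pow_eq_zero hD _ (Nat.lt_succ_self N)))
  have hFD : F = 1 - D := (sub_sub_cancel 1 F).symm
  refine ⟨⟨F, G, ?_, ?_⟩, rfl⟩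
  · ext N
    rw [coeff_mul_congr (fun k _ => rfl) (hG N), ← hpow, hFD, mul_neg_geom_sum]
  · ext N
    rw [coeff_mul_congr (hG N) (fun k _ => rfl), ← hpow, hFD, geom_sum_mul_neg]

/-- Application of an algebra map to the values. -/
def leg (φ : W →ₐ[ℂ] W') : StarSeries e W →+* StarSeries e W' where
  toFun := DynTwist.leg (n := n) φ
  map_one' := map_one (onSeries (onValues n φ))
  map_zero' := map_zero (onSeries (onValues n φ))
  map_add' := map_add (onSeries (onValues n φ))
  map_mul' := leg_star e φ

theorem of_leg (φ : W →ₐ[ℂ] W') (F : PowerSeries (MerVal n W)) :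
    of e (DynTwist.leg φ F) = leg φ (of e F) := rfl

theorem coeff_leg (φ : W →ₐ[ℂ] W') (F : StarSeries e W) (N : ℕ) :
    coeff N (leg φ F) = onValues n φ (coeff N F) := DynTwist.coeff_leg φ F N

variable (e) in
/-- Series that are constant in `λ`. -/
def const : PowerSeries W →+* StarSeries e W where
  toFun := DynTwist.const n
  map_one' := map_one (onSeries _)
  map_zero' := map_zero (onSeries _)
  map_add' := map_add (onSeries _)
  map_mul' F G := ((map_mul (onSeries _) F G).trans (star_const_left e F (DynTwist.const n G)).symm)

theorem of_const_mul (F : PowerSeries W) (G : PowerSeries (MerVal n W)) :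
    of e (DynTwist.const n F * G) = const e F * of e G :=
  (star_const_left e F G).symm

theorem coeff_const (F : PowerSeries W) (N : ℕ) :
    coeff N (const e F) = (1 : Mer n) ⊗ₜ[ℂ] PowerSeries.coeff N F := DynTwist.coeff_const F N

theorem leg_const (φ : W →ₐ[ℂ] W') (F : PowerSeries W) :
    leg φ (const e F) = const e (onSeries φ F) := by
  ext N
  rw [coeff_leg, coeff_const, coeff_const, onSeries, PowerSeries.coeff_map]
  simp [onValues]

theorem leg_leg {W'' : Type*} [Ring W''] [Algebra ℂ W''] (ψ : W' →ₐ[ℂ] W'') (φ : W →ₐ[ℂ] W')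
    (F : StarSeries e W) : leg ψ (leg φ F) = leg (ψ.comp φ) F := by
  ext N
  simp only [coeff_leg]
  induction coeff N F using TensorProduct.induction_on with
  | zero => simp
  | add F G hF hG => simp only [map_add, hF, hG]
  | tmul f w => rfl

end StarSeries

end StarRing

/-! ## The shift -/

section Shift

variable {L : Type*} [LieRing L] [LieAlgebra ℂ L] {h : LieSubalgebra ℂ L}
  {n : ℕ} (e : Module.Basis (Fin n) ℂ h) {W : Type*} [Ring W] [Algebra ℂ W]
  (φ : W →ₐ[ℂ] U3 L) (s : U L →ₐ[ℂ] U3 L)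

/-- The map `U(h) → U(L)`. -/
def envelopingIncl (h : LieSubalgebra ℂ L) : U h →ₐ[ℂ] U L :=
  UniversalEnvelopingAlgebra.lift ℂ ((UniversalEnvelopingAlgebra.ι ℂ).comp h.incl)

theorem envelopingIncl_basisWord {p : ℕ} (i : Fin p → Fin n) :
    envelopingIncl h (basisWord e i) = (List.ofFn fun k => (inc (e (i k) : L) : U L)).prod := by
  rw [basisWord, wordProd, map_list_prod, List.map_ofFn]
  congr 2
  funext k
  exact UniversalEnvelopingAlgebra.lift_ι_apply ℂ _ _

/-- The coefficients of the shift, as linear maps. -/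
def shiftCoeffₗ (N : ℕ) : MerVal n W →ₗ[ℂ] MerVal n (U3 L) :=
  ((N.factorial : ℂ)⁻¹) • ∑ i : Fin N → Fin n,
    LinearMap.mulRight ℂ ((1 : Mer n) ⊗ₜ[ℂ] s (envelopingIncl h (basisWord e i))) ∘ₗ
      (onValues n φ).toLinearMap ∘ₗ pderivs i

theorem shiftCoeffₗ_apply (N : ℕ) (F : MerVal n W) :
    shiftCoeffₗ e φ s N F = shiftCoeff e φ s N F := by
  simp only [shiftCoeffₗ, shiftCoeff, LinearMap.smul_apply, LinearMap.sum_apply,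
    LinearMap.comp_apply, LinearMap.mulRight_apply, AlgHom.toLinearMap_apply,
    envelopingIncl_basisWord]

theorem shiftCoeffₗ_tmul (N : ℕ) (f : Mer n) (w : W) :
    shiftCoeffₗ e φ s N (f ⊗ₜ w) = ((N.factorial : ℂ)⁻¹) • ∑ i : Fin N → Fin n,
      wordProd pderiv i f ⊗ₜ[ℂ] (φ w * s (envelopingIncl h (basisWord e i))) := by
  simp only [shiftCoeffₗ, LinearMap.smul_apply, LinearMap.sum_apply,
    LinearMap.comp_apply, LinearMap.mulRight_apply, AlgHom.toLinearMap_apply, pderivs_tmul, onValues,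
    Algebra.TensorProduct.map_tmul, Algebra.TensorProduct.tmul_mul_tmul, mul_one, AlgHom.id_apply]

variable {φ s}

/-- The scalar compatibility `sum_starₗ_tmul_basisWord`, with the words sent to their slot by `s`.
The hypothesis `hc` lets the values of `G` move past the words coming from `F`. -/
theorem shiftCoeffₗ_starCoeffₗ (hc : ∀ w u, Commute (φ w) (s u)) (N : ℕ) (F G : MerVal n W) :
    ∑ a ∈ antidiagonal N, shiftCoeffₗ e φ s a.1 (starCoeffₗ e a.2 F G) =
      ∑ a ∈ antidiagonal N, ∑ b ∈ antidiagonal a.2,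
        starCoeffₗ e a.1 (shiftCoeffₗ e φ s b.1 F) (shiftCoeffₗ e φ s b.2 G) := by
  induction F using TensorProduct.induction_on with
  | zero => simp
  | add F F' hF hF' => simp only [map_add, LinearMap.add_apply, Finset.sum_add_distrib, hF, hF']
  | tmul f w =>
  induction G using TensorProduct.induction_on with
  | zero => simp
  | add F F' hF hF' => simp only [map_add, Finset.sum_add_distrib, hF, hF']
  | tmul g w' =>
    have key := congrArg ((LinearMap.mulLeft ℂ (φ (w * w')) ∘ₗ s.toLinearMap ∘ₗ
      (envelopingIncl h).toLinearMap).lTensor (Mer n))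
      ((merCoordinates n).sum_starₗ_tmul_basisWord e N f g)
    simp only [map_sum, map_smul, LinearMap.lTensor_tmul, LinearMap.comp_apply,
      AlgHom.toLinearMap_apply, LinearMap.mulLeft_apply] at key
    simp only [starCoeffₗ_tmul, shiftCoeffₗ_tmul, map_smul, LinearMap.smul_apply, map_sum,
      LinearMap.sum_apply]
    refine key.trans ?_
    refine Finset.sum_congr rfl fun a _ => Finset.sum_congr rfl fun b _ => ?_
    simp only [Finset.smul_sum, smul_smul]
    rw [Finset.sum_comm]
    refine Finset.sum_congr rfl fun j _ => Finset.sum_congr rfl fun i _ => ?_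
    rw [mul_comm (b.1.factorial : ℂ)⁻¹, map_mul φ, map_mul (envelopingIncl h), map_mul s,
      (hc w' _).symm.mul_mul_mul_comm]
    rfl

theorem sum_antidiagonal_shift_left {V : Type*} [AddCommMonoid V] (f : ℕ → ℕ → ℕ → ℕ → V)
    (N : ℕ) :
    ∑ a ∈ antidiagonal N, ∑ b ∈ antidiagonal a.2, ∑ c ∈ antidiagonal b.2, f a.1 b.1 c.1 c.2 =
      ∑ x ∈ antidiagonal N, ∑ y ∈ antidiagonal x.2, ∑ z ∈ antidiagonal x.1,
        f z.1 z.2 y.1 y.2 := by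
  simp only [Finset.sum_sigma']
  refine Finset.sum_nbij'
    (fun x => ⟨(x.1.1 + x.2.1.1, x.2.2.1 + x.2.2.2), x.2.2, (x.1.1, x.2.1.1)⟩)
    (fun x => ⟨(x.2.2.1, x.2.2.2 + x.2.1.1 + x.2.1.2), (x.2.2.2, x.2.1.1 + x.2.1.2), x.2.1⟩)
    ?_ ?_ ?_ ?_ ?_
  · rintro ⟨⟨a, a'⟩, ⟨b, b'⟩, ⟨c, c'⟩⟩
    simp only [Finset.mem_sigma, Finset.HasAntidiagonal.mem_antidiagonal]
    rintro ⟨rfl, rfl, rfl⟩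
    simp
    omega
  · rintro ⟨⟨a, a'⟩, ⟨b, b'⟩, ⟨c, c'⟩⟩
    simp only [Finset.mem_sigma, Finset.HasAntidiagonal.mem_antidiagonal]
    rintro ⟨rfl, rfl, rfl⟩
    simp
    omega
  · rintro ⟨⟨a, a'⟩, ⟨b, b'⟩, ⟨c, c'⟩⟩
    simp only [Finset.mem_sigma, Finset.HasAntidiagonal.mem_antidiagonal]
    rintro ⟨rfl, rfl, rfl⟩
    simp [add_assoc]
  · rintro ⟨⟨a, a'⟩, ⟨b, b'⟩, ⟨c, c'⟩⟩
    simp only [Finset.mem_sigma, Finset.HasAntidiagonal.mem_antidiagonal]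
    rintro ⟨rfl, rfl, rfl⟩
    simp
  · rintro ⟨⟨a, a'⟩, ⟨b, b'⟩, ⟨c, c'⟩⟩ _
    rfl

theorem sum_antidiagonal_shift_right {V : Type*} [AddCommMonoid V] (f : ℕ → ℕ → ℕ → ℕ → ℕ → V)
    (N : ℕ) :
    ∑ a ∈ antidiagonal N, ∑ b ∈ antidiagonal a.2, ∑ d ∈ antidiagonal b.2, ∑ c ∈ antidiagonal b.1,
        f a.1 c.1 c.2 d.1 d.2 =
      ∑ x ∈ antidiagonal N, ∑ y ∈ antidiagonal x.2, ∑ z ∈ antidiagonal x.1, ∑ v ∈ antidiagonal z.2,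
        f z.1 v.1 y.1 v.2 y.2 := by
  simp only [Finset.sum_sigma']
  refine Finset.sum_nbij'
    (fun x => ⟨(x.1.1 + x.2.2.2.1 + x.2.2.1.1, x.2.2.2.2 + x.2.2.1.2), (x.2.2.2.2, x.2.2.1.2),
      (x.1.1, x.2.2.2.1 + x.2.2.1.1), (x.2.2.2.1, x.2.2.1.1)⟩)
    (fun x => ⟨(x.2.2.1.1, x.2.2.2.1 + x.2.1.1 + (x.2.2.2.2 + x.2.1.2)),
      (x.2.2.2.1 + x.2.1.1, x.2.2.2.2 + x.2.1.2), (x.2.2.2.2, x.2.1.2), (x.2.2.2.1, x.2.1.1)⟩)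
    ?_ ?_ ?_ ?_ ?_
  · rintro ⟨⟨a, a'⟩, ⟨b, b'⟩, ⟨c, c'⟩, ⟨d, d'⟩⟩
    simp only [Finset.mem_sigma, Finset.HasAntidiagonal.mem_antidiagonal]
    rintro ⟨rfl, rfl, rfl, rfl⟩
    simp
    omega
  · rintro ⟨⟨a, a'⟩, ⟨b, b'⟩, ⟨c, c'⟩, ⟨d, d'⟩⟩
    simp only [Finset.mem_sigma, Finset.HasAntidiagonal.mem_antidiagonal]
    rintro ⟨rfl, rfl, rfl, rfl⟩
    simp
    omega
  · rintro ⟨⟨a, a'⟩, ⟨b, b'⟩, ⟨c, c'⟩, ⟨d, d'⟩⟩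
    simp only [Finset.mem_sigma, Finset.HasAntidiagonal.mem_antidiagonal]
    rintro ⟨rfl, rfl, rfl, rfl⟩
    simp
  · rintro ⟨⟨a, a'⟩, ⟨b, b'⟩, ⟨c, c'⟩, ⟨d, d'⟩⟩
    simp only [Finset.mem_sigma, Finset.HasAntidiagonal.mem_antidiagonal]
    rintro ⟨rfl, rfl, rfl, rfl⟩
    simp [add_assoc]
  · rintro ⟨⟨a, a'⟩, ⟨b, b'⟩, ⟨c, c'⟩, ⟨d, d'⟩⟩ _
    rfl

theorem coeff_shift (F : PowerSeries (MerVal n W)) (N : ℕ) :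
    PowerSeries.coeff N (shift e φ s F) =
      ∑ a ∈ antidiagonal N, shiftCoeffₗ e φ s a.1 (PowerSeries.coeff a.2 F) := by
  simp only [shift, PowerSeries.coeff_mk, shiftCoeffₗ_apply]

theorem shift_star (hc : ∀ w u, Commute (φ w) (s u)) (F G : PowerSeries (MerVal n W)) :
    shift e φ s (star e F G) = star e (shift e φ s F) (shift e φ s G) := by
  ext N
  simp only [coeff_star, coeff_shift, map_sum, LinearMap.sum_apply]
  rw [sum_antidiagonal_shift_left (fun a b i j => shiftCoeffₗ e φ s a (starCoeffₗ e b
      (PowerSeries.coeff i F) (PowerSeries.coeff j G))),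
    sum_antidiagonal_shift_right (fun a b i c j => starCoeffₗ e a
      (shiftCoeffₗ e φ s b (PowerSeries.coeff i F)) (shiftCoeffₗ e φ s c (PowerSeries.coeff j G)))]
  simp only [shiftCoeffₗ_starCoeffₗ e hc]

theorem shift_const (F : PowerSeries W) : shift e φ s (const n F) = const n (onSeries φ F) := by
  ext N
  rw [coeff_shift, Finset.sum_eq_single (0, N)]
  · rw [coeff_const, coeff_const, shiftCoeffₗ_tmul]
    simp [wordProd, onSeries]
  · rintro ⟨a, a'⟩ ha hne
    rw [Finset.HasAntidiagonal.mem_antidiagonal] at ha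
    rcases a with _ | a
    · simp_all
    rw [coeff_const, shiftCoeffₗ_tmul, Finset.sum_eq_zero, smul_zero]
    intro i _
    have hw := (merCoordinates n).wordProd_one i
    rw [show wordProd pderiv i (1 : Mer n) = 0 from hw, TensorProduct.zero_tmul]
  · intro h
    simp at h

end Shift

/-! ## Leg maps -/

section LegMaps

variable {L : Type*} [LieRing L] [LieAlgebra ℂ L]

/-- Cocommutativity is checked on generators. It is responsible for `J^{12,3}` and `J^{1,23}` being
fixed when the two slots of the coproduct are exchanged. -/
theorem t21_comp_comul : (t21 L).comp (comul L) = comul L := by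
  refine UniversalEnvelopingAlgebra.hom_ext ℂ (LieHom.ext fun x => ?_)
  change t21 L (comul L (inc x)) = comul L (inc x)
  rw [comul_inc, map_add, add_comm]
  rfl

theorem t21_comul (u : U L) : t21 L (comul L u) = comul L u :=
  congrArg (fun F => F u) t21_comp_comul

theorem t12_3_tmul (a b : U L) : t12_3 L (a ⊗ₜ b) =
    Algebra.TensorProduct.assoc ℂ ℂ ℂ (U L) (U L) (U L) (comul L a ⊗ₜ b) := rfl

theorem t12_eq_assoc (X : U2 L) :
    t12 L X = Algebra.TensorProduct.assoc ℂ ℂ ℂ (U L) (U L) (U L) (X ⊗ₜ 1) := by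
  induction X using TensorProduct.induction_on with
  | zero => rw [map_zero, TensorProduct.zero_tmul, map_zero]
  | add X Y hX hY => rw [map_add, hX, hY, TensorProduct.add_tmul, map_add]
  | tmul a b => rfl

theorem p213_assoc (X : U2 L) (b : U L) :
    p213 L (Algebra.TensorProduct.assoc ℂ ℂ ℂ (U L) (U L) (U L) (X ⊗ₜ b)) =
      Algebra.TensorProduct.assoc ℂ ℂ ℂ (U L) (U L) (U L) (t21 L X ⊗ₜ b) := by
  induction X using TensorProduct.induction_on with
  | zero => simp only [map_zero, TensorProduct.zero_tmul]
  | add X Y hX hY => simp only [map_add, hX, hY, TensorProduct.add_tmul]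
  | tmul a b => rfl

theorem p213_comp_t12_3 : (p213 L).comp (t12_3 L) = t12_3 L :=
  Algebra.TensorProduct.ext' fun a b => by
    rw [AlgHom.comp_apply, t12_3_tmul, p213_assoc, t21_comul]

theorem p132_comp_t1_23 : (p132 L).comp (t1_23 L) = t1_23 L :=
  Algebra.TensorProduct.ext' fun a b => by
    change a ⊗ₜ[ℂ] t21 L (comul L b) = a ⊗ₜ[ℂ] comul L b
    rw [t21_comul]

theorem p213_comp_t12 : (p213 L).comp (t12 L) = (t12 L).comp (t21 L) :=
  Algebra.TensorProduct.ext' fun _ _ => rfl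

theorem p213_comp_s3 : (p213 L).comp (s3 L) = s3 L := AlgHom.ext fun _ => rfl

theorem p132_comp_t23 : (p132 L).comp (t23 L) = (t23 L).comp (t21 L) := AlgHom.ext fun _ => rfl

theorem p132_comp_t12 : (p132 L).comp (t12 L) = t13 L := Algebra.TensorProduct.ext' fun _ _ => rfl

theorem p132_comp_s3 : (p132 L).comp (s3 L) = s2 L := AlgHom.ext fun _ => rfl

theorem p231_comp_t12 : (p231 L).comp (t12 L) = t23 L := Algebra.TensorProduct.ext' fun _ _ => rfl

theorem p231_comp_s3 : (p231 L).comp (s3 L) = s1 L := AlgHom.ext fun _ => rfl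

theorem p312_comp_t23 : (p312 L).comp (t23 L) = t12 L := Algebra.TensorProduct.ext' fun _ _ => rfl

theorem p213_comp_t23 : (p213 L).comp (t23 L) = t13 L := Algebra.TensorProduct.ext' fun _ _ => rfl

theorem p213_comp_t13 : (p213 L).comp (t13 L) = t23 L := Algebra.TensorProduct.ext' fun _ _ => rfl

theorem U3_hom_ext {B : Type*} [Semiring B] [Algebra ℂ B] {φ ψ : U3 L →ₐ[ℂ] B}
    (h : ∀ a b c, φ (a ⊗ₜ (b ⊗ₜ c)) = ψ (a ⊗ₜ (b ⊗ₜ c))) : φ = ψ := by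
  refine Algebra.TensorProduct.ext' fun a X => ?_
  induction X using TensorProduct.induction_on with
  | zero => simp only [TensorProduct.tmul_zero, map_zero]
  | add X Y hX hY => simp only [TensorProduct.tmul_add, map_add, hX, hY]
  | tmul b c => exact h a b c

theorem p231_comp_p213 : (p231 L).comp (p213 L) = p321 L := U3_hom_ext fun _ _ _ => rfl

theorem p312_comp_p132 : (p312 L).comp (p132 L) = p321 L := U3_hom_ext fun _ _ _ => rfl

theorem p132_comp_p213 : (p132 L).comp (p213 L) = p312 L := rfl

theorem p213_comp_p132 : (p213 L).comp (p132 L) = p231 L := rfl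

theorem p213_comp_p312 : (p213 L).comp (p312 L) = p321 L := U3_hom_ext fun _ _ _ => rfl

theorem commute_t12_s3 (X : U2 L) (u : U L) : Commute (t12 L X) (s3 L u) := by
  induction X using TensorProduct.induction_on with
  | zero => rw [map_zero]; exact Commute.zero_left _
  | add X Y hX hY => rw [map_add]; exact hX.add_left hY
  | tmul a b =>
    change (a ⊗ₜ[ℂ] (b ⊗ₜ[ℂ] (1 : U L))) * ((1 : U L) ⊗ₜ[ℂ] ((1 : U L) ⊗ₜ[ℂ] u)) =
      ((1 : U L) ⊗ₜ[ℂ] ((1 : U L) ⊗ₜ[ℂ] u)) * (a ⊗ₜ[ℂ] (b ⊗ₜ[ℂ] (1 : U L)))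
    simp only [Algebra.TensorProduct.tmul_mul_tmul, mul_one, one_mul]

theorem inc2_lie (x : L) (t : L ⊗[ℂ] L) :
    comul L (inc x) * inc2 t - inc2 t * comul L (inc x) = inc2 ⁅x, t⁆ := by
  induction t using TensorProduct.induction_on with
  | zero => simp
  | add s t hs ht => rw [map_add, lie_add, map_add, ← hs, ← ht, mul_add, add_mul]; abel
  | tmul y z =>
    rw [comul_inc, TensorProduct.LieModule.lie_tmul_right, map_add]
    simp only [inc2, TensorProduct.map_tmul, ← inc_mul_inc_sub, add_mul, mul_add,
      Algebra.TensorProduct.tmul_mul_tmul, one_mul, mul_one, TensorProduct.sub_tmul,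
      TensorProduct.tmul_sub]
    abel

/-- For an element of `L` this is the invariance of `t`, by `inc2_lie`; products preserve it. -/
theorem commute_comul_inc2 {t : L ⊗[ℂ] L} (ht : ∀ x : L, ⁅x, t⁆ = 0) (u : U L) :
    Commute (comul L u) (inc2 t) := by
  induction u using induction_enveloping with
  | h1 => rw [map_one]; exact Commute.one_left _
  | hmul x u hu =>
    rw [map_mul]
    refine Commute.mul_left ?_ hu
    have := inc2_lie x t
    rwa [ht, map_zero, sub_eq_zero] at this
  | hadd u v hu hv => rw [map_add]; exact hu.add_left hv
  | hsmul c u hu => rw [map_smul]; exact hu.smul_left c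

/-- The first leg of `X` enters slots 1 and 2 through its coproduct, which commutes with `T`; the
second leg sits in another slot. -/
theorem commute_t12_t12_3 {T : U2 L} (hT : ∀ u, Commute (comul L u) T) (X : U2 L) :
    Commute (t12 L T) (t12_3 L X) := by
  induction X using TensorProduct.induction_on with
  | zero => rw [map_zero]; exact Commute.zero_right _
  | add X Y hX hY => rw [map_add]; exact hX.add_right hY
  | tmul a b =>
    rw [t12_eq_assoc, t12_3_tmul]
    refine Commute.map ?_ _
    simp only [Commute, SemiconjBy, Algebra.TensorProduct.tmul_mul_tmul, one_mul, mul_one,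
      (hT a).eq]

theorem commute_t23_t1_23 {T : U2 L} (hT : ∀ u, Commute (comul L u) T) (X : U2 L) :
    Commute (t23 L T) (t1_23 L X) := by
  induction X using TensorProduct.induction_on with
  | zero => rw [map_zero]; exact Commute.zero_right _
  | add X Y hX hY => rw [map_add]; exact hX.add_right hY
  | tmul a b =>
    change ((1 : U L) ⊗ₜ[ℂ] T) * (a ⊗ₜ[ℂ] comul L b) = (a ⊗ₜ[ℂ] comul L b) * ((1 : U L) ⊗ₜ[ℂ] T)
    simp only [Algebra.TensorProduct.tmul_mul_tmul, one_mul, mul_one, (hT b).eq]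

end LegMaps

/-! ## Legs of shifts -/

section LegShift

variable {L : Type*} [LieRing L] [LieAlgebra ℂ L] {h : LieSubalgebra ℂ L}
  {n : ℕ} (e : Module.Basis (Fin n) ℂ h) {W : Type*} [Ring W] [Algebra ℂ W]
  (φ : W →ₐ[ℂ] U3 L) (s : U L →ₐ[ℂ] U3 L)

theorem onValues_shiftCoeffₗ (ψ : U3 L →ₐ[ℂ] U3 L) (N : ℕ) (F : MerVal n W) :
    onValues n ψ (shiftCoeffₗ e φ s N F) = shiftCoeffₗ e (ψ.comp φ) (ψ.comp s) N F := by
  induction F using TensorProduct.induction_on with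
  | zero => simp
  | add F G hF hG => simp only [map_add, hF, hG]
  | tmul f w => simp [shiftCoeffₗ_tmul, onValues]

theorem shiftCoeffₗ_onValues {W' : Type*} [Ring W'] [Algebra ℂ W'] (χ : W' →ₐ[ℂ] W) (N : ℕ)
    (F : MerVal n W') :
    shiftCoeffₗ e φ s N (onValues n χ F) = shiftCoeffₗ e (φ.comp χ) s N F := by
  induction F using TensorProduct.induction_on with
  | zero => simp
  | add F G hF hG => simp only [map_add, hF, hG]
  | tmul f w => simp [shiftCoeffₗ_tmul, onValues]

theorem leg_shift (ψ : U3 L →ₐ[ℂ] U3 L) (F : PowerSeries (MerVal n W)) :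
    leg ψ (shift e φ s F) = shift e (ψ.comp φ) (ψ.comp s) F := by
  ext N
  simp only [coeff_leg, coeff_shift, map_sum, onValues_shiftCoeffₗ]

theorem shift_leg {W' : Type*} [Ring W'] [Algebra ℂ W'] (χ : W' →ₐ[ℂ] W)
    (F : PowerSeries (MerVal n W')) :
    shift e φ s (leg χ F) = shift e (φ.comp χ) s F := by
  ext N
  simp only [coeff_leg, coeff_shift, shiftCoeffₗ_onValues]

end LegShift

/-! ## Invariance -/

section Invariance

variable {L : Type*} [LieRing L] [LieAlgebra ℂ L] {h : LieSubalgebra ℂ L}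
  {n : ℕ} (e : Module.Basis (Fin n) ℂ h)

theorem starCoeffₗ_lin {W : Type*} [Ring W] [Algebra ℂ W] (m : ℕ) (x : h) (F : MerVal n W) :
    starCoeffₗ e m (polyMer n (lin e x) ⊗ₜ 1) F = starCoeffₗ e m F (polyMer n (lin e x) ⊗ₜ 1) +
      if m = 1 then (coadAction e x).rTensor W F else 0 := by
  induction F using TensorProduct.induction_on with
  | zero => simp
  | add F G hF hG =>
    simp only [map_add, LinearMap.add_apply, hF, hG]
    rw [add_add_add_comm]
    split_ifs <;> simp
  | tmul f w =>
    have := (merCoordinates n).starₗ_lin_sub e m x f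
    rw [starCoeffₗ_tmul, starCoeffₗ_tmul, one_mul, mul_one,
      show merStar e m (polyMer n (lin e x)) f = _ + merStar e m f (polyMer n (lin e x)) from
      sub_eq_iff_eq_add.1 this, add_comm, TensorProduct.add_tmul]
    congr 1
    split_ifs
    · rw [LinearMap.rTensor_tmul, coadAction, LinearMap.sum_apply]
      congr 1
      refine Finset.sum_congr rfl fun i _ => ?_
      rw [lin_apply, map_sum]
      simp only [map_smul, MvPolynomial.aeval_X]
      rfl
    · rw [TensorProduct.zero_tmul]

/-- The function `λ ↦ λ(x) + ħ Δ(x)`, whose star-commutator is `ħ` times the action of `x`. -/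
def momentum (x : h) : StarSeries e (U2 L) :=
  StarSeries.of e (PowerSeries.C (polyMer n (lin e x) ⊗ₜ[ℂ] (1 : U2 L))) +
    StarSeries.const e (PowerSeries.X * PowerSeries.C (comul L (inc (x : L))))

theorem coeff_of_C_mul {W : Type*} [Ring W] [Algebra ℂ W] (A : MerVal n W) (F : StarSeries e W)
    (N : ℕ) : StarSeries.coeff N (StarSeries.of e (PowerSeries.C A) * F) =
      ∑ a ∈ antidiagonal N, starCoeffₗ e a.1 A (StarSeries.coeff a.2 F) := by
  rw [StarSeries.coeff_mul]
  refine Finset.sum_congr rfl fun a _ => ?_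
  rw [Finset.sum_eq_single (0, a.2)]
  · rw [StarSeries.coeff_of, PowerSeries.coeff_zero_C]
  · rintro ⟨b, b'⟩ hb hne
    rw [Finset.HasAntidiagonal.mem_antidiagonal] at hb
    rw [StarSeries.coeff_of, PowerSeries.coeff_C, if_neg, map_zero, LinearMap.zero_apply]
    rintro rfl
    simp_all
  · intro h
    simp at h

theorem coeff_mul_of_C {W : Type*} [Ring W] [Algebra ℂ W] (A : MerVal n W) (F : StarSeries e W)
    (N : ℕ) : StarSeries.coeff N (F * StarSeries.of e (PowerSeries.C A)) =
      ∑ a ∈ antidiagonal N, starCoeffₗ e a.1 (StarSeries.coeff a.2 F) A := by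
  rw [StarSeries.coeff_mul]
  refine Finset.sum_congr rfl fun a _ => ?_
  rw [Finset.sum_eq_single (a.2, 0)]
  · rw [StarSeries.coeff_of, PowerSeries.coeff_zero_C]
  · rintro ⟨b, b'⟩ hb hne
    rw [Finset.HasAntidiagonal.mem_antidiagonal] at hb
    rw [StarSeries.coeff_of, PowerSeries.coeff_C, if_neg, map_zero]
    rintro rfl
    simp_all
  · intro h
    simp at h

theorem const_X_mul_C (d : U2 L) :
    const n (PowerSeries.X * PowerSeries.C d) = PowerSeries.X * PowerSeries.C ((1 : Mer n) ⊗ₜ[ℂ] d) := by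
  rw [const, map_mul, onSeries, PowerSeries.map_X, PowerSeries.map_C]
  rfl

theorem coeff_const_X_mul_C_mul (d : U2 L) (F : PowerSeries (MerVal n (U2 L))) (N : ℕ) :
    StarSeries.coeff N (StarSeries.const e (PowerSeries.X * PowerSeries.C d) * StarSeries.of e F) =
      PowerSeries.coeff N (PowerSeries.X * (PowerSeries.C ((1 : Mer n) ⊗ₜ[ℂ] d) * F)) := by
  rw [← mul_assoc, ← const_X_mul_C, ← star_const_left e]
  rfl

theorem coeff_mul_const_X_mul_C (d : U2 L) (F : PowerSeries (MerVal n (U2 L))) (N : ℕ) :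
    StarSeries.coeff N (StarSeries.of e F * StarSeries.const e (PowerSeries.X * PowerSeries.C d)) =
      PowerSeries.coeff N (F * PowerSeries.C ((1 : Mer n) ⊗ₜ[ℂ] d) * PowerSeries.X) := by
  rw [mul_assoc, ← PowerSeries.X_mul, ← const_X_mul_C, ← star_const_right e]
  rfl

theorem coeff_of_C_lin_mul {W : Type*} [Ring W] [Algebra ℂ W] (x : h) (F : StarSeries e W) (N : ℕ) :
    StarSeries.coeff N (StarSeries.of e (PowerSeries.C (polyMer n (lin e x) ⊗ₜ[ℂ] (1 : W))) * F) =
      StarSeries.coeff N (F * StarSeries.of e (PowerSeries.C (polyMer n (lin e x) ⊗ₜ[ℂ] (1 : W)))) +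
    ∑ a ∈ antidiagonal N,
      if a.1 = 1 then (coadAction e x).rTensor W (StarSeries.coeff a.2 F) else 0 := by
  rw [coeff_of_C_mul, coeff_mul_of_C, ← Finset.sum_add_distrib]
  exact Finset.sum_congr rfl fun a _ => starCoeffₗ_lin e a.1 x _

theorem coeff_zero_momentum_mul (x : h) (F : PowerSeries (MerVal n (U2 L))) :
    StarSeries.coeff 0 (momentum e x * StarSeries.of e F) =
      StarSeries.coeff 0 (StarSeries.of e F * momentum e x) := by
  rw [momentum, add_mul, mul_add, map_add, map_add, coeff_of_C_lin_mul, coeff_const_X_mul_C_mul,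
    coeff_mul_const_X_mul_C, PowerSeries.coeff_zero_X_mul, PowerSeries.coeff_zero_mul_X,
    Finset.sum_eq_zero, add_zero]
  intro a ha
  rw [Finset.HasAntidiagonal.mem_antidiagonal] at ha
  exact if_neg (by omega)

/-- Star-commutation with the linear function contributes the coadjoint term, and the constant
`ħΔ(x)` contributes the adjoint one; both raise the order in `ħ` by one. -/
theorem coeff_succ_momentum_mul (x : h) (F : PowerSeries (MerVal n (U2 L))) (N : ℕ) :
    StarSeries.coeff (N + 1) (momentum e x * StarSeries.of e F) +
        PowerSeries.coeff N F * ((1 : Mer n) ⊗ₜ[ℂ] comul L (inc (x : L))) =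
      StarSeries.coeff (N + 1) (StarSeries.of e F * momentum e x) +
        ((coadAction e x).rTensor (U2 L) (PowerSeries.coeff N F) +
          ((1 : Mer n) ⊗ₜ[ℂ] comul L (inc (x : L))) * PowerSeries.coeff N F) := by
  rw [momentum, add_mul, mul_add, map_add, map_add, coeff_of_C_lin_mul, coeff_const_X_mul_C_mul,
    coeff_mul_const_X_mul_C, PowerSeries.coeff_succ_X_mul,
    PowerSeries.coeff_succ_mul_X, PowerSeries.coeff_C_mul, PowerSeries.coeff_mul_C,
    Finset.sum_eq_single (1, N) (fun a ha hne => if_neg fun h1 => hne (by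
      rw [Finset.HasAntidiagonal.mem_antidiagonal] at ha
      exact Prod.ext h1 (by simp only; omega)))
    (fun hn => (hn (by rw [Finset.HasAntidiagonal.mem_antidiagonal]; omega)).elim), if_pos rfl,
    StarSeries.coeff_of]
  abel

/-- Order `N + 1` of the star-commutator is the invariance condition at order `N`, and order zero
vanishes automatically. Invariance becomes membership in a centralizer, hence passes to products and
inverses. -/
theorem isInvariant_iff (F : PowerSeries (MerVal n (U2 L))) :
    IsInvariant e F ↔ ∀ x, Commute (momentum e x) (StarSeries.of e F) := by
  have key : ∀ a b c : MerVal n (U2 L), a + (b - c) = 0 ↔ a + b = c := fun a b c => by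
    rw [← add_sub_assoc]
    exact sub_eq_zero
  have cancel : ∀ {A : Type _} [AddCommGroup A] {a b c : A}, a + c = b + c → a = b :=
    add_right_cancel
  refine forall_congr' fun x => ⟨fun hF => StarSeries.ext fun N => ?_, fun hF N => (key _ _ _).2 ?_⟩
  · rcases N with _ | N
    · exact coeff_zero_momentum_mul e x _
    · have := coeff_succ_momentum_mul e x F N
      rw [(key _ _ _).1 (hF N)] at this
      exact cancel this
  · have := coeff_succ_momentum_mul e x F N
    rw [hF.eq] at this
    rw [add_comm _ (PowerSeries.coeff N F * _), add_comm _ (_ + _)] at this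
    exact (cancel this).symm

/-- Exchanging the legs fixes `Δ(x)` and does not touch the functions of `λ`. -/
theorem isInvariant_leg_t21 {F : PowerSeries (MerVal n (U2 L))} (hF : IsInvariant e F) :
    IsInvariant e (leg (t21 L) F) := by
  intro x N
  have := congrArg (onValues n (t21 L)) (hF x N)
  rw [map_add, map_sub, map_mul, map_mul, map_zero] at this
  have h₁ : onValues n (t21 L) ((1 : Mer n) ⊗ₜ[ℂ] comul L (inc (x : L))) =
      (1 : Mer n) ⊗ₜ[ℂ] comul L (inc (x : L)) := by
    change (1 : Mer n) ⊗ₜ[ℂ] t21 L (comul L (inc (x : L))) = _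
    rw [t21_comul]
  have h₂ : ∀ G : MerVal n (U2 L), onValues n (t21 L) ((coadAction e x).rTensor (U2 L) G) =
      (coadAction e x).rTensor (U2 L) (onValues n (t21 L) G) := fun G => by
    induction G using TensorProduct.induction_on with
    | zero => simp
    | add F G hF hG => simp only [map_add, hF, hG]
    | tmul f w => rfl
  rw [h₁, h₂] at this
  rw [coeff_leg]
  exact this

theorem isInvariant_const {R : PowerSeries (U2 L)}
    (hR : ∀ u N, Commute (comul L u) (PowerSeries.coeff N R)) : IsInvariant e (const n R) := by
  intro x N
  have h₁ : coadAction e x 1 = 0 := by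
    rw [coadAction, LinearMap.sum_apply]
    refine Finset.sum_eq_zero fun i _ => ?_
    rw [LinearMap.comp_apply, show pderiv i (1 : Mer n) = 0 from (merCoordinates n).D_one i, map_zero]
  rw [coeff_const, LinearMap.rTensor_tmul, h₁, TensorProduct.zero_tmul, zero_add,
    Algebra.TensorProduct.tmul_mul_tmul, Algebra.TensorProduct.tmul_mul_tmul, (hR _ _).eq, sub_self]

end Invariance

/-! ## The quantum dynamical `R`-matrix of a dynamical twist -/

theorem map_ringInverse {A B : Type*} [Ring A] [Ring B] (f : A →+* B) {a : A} (ha : IsUnit a) :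
    f (Ring.inverse a) = Ring.inverse (f a) := by
  obtain ⟨u, rfl⟩ := ha
  rw [Ring.inverse_unit, show f (u : A) = (Units.map f.toMonoidHom u : Bˣ) from rfl,
    Ring.inverse_unit]
  rfl

/-- The noncommutative algebra of the argument. Digits record the permutation of slots, `f` stands
for `Φ`, `v` for inverses of its permutations, `T` for `𝓡`, `T123` for `𝓡^{12,3}`, and a final `s`
for a shift. Both sides, multiplied by `f321 * A321`, reduce to the product of `T12`, `T123` and
`A`. -/
theorem yangBaxter_of_twist_hexagon {S : Type*} [Ring S]
    {A A132 A213 A231 A312 A321 f f132 f213 f231 f312 f321 v132 v231 T12 T13 T23 T123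
      R12 R13 R23 R12s R13s R23s : S}
    (hA : IsUnit A321) (hf : IsUnit f321) (hv132 : v132 * f132 = 1) (hv231 : v231 * f231 = 1)
    (h12s : A213 * R12s = T12 * A) (h13s : A312 * R13s = T13 * A132)
    (h23s : A321 * R23s = T23 * A231) (h23 : f132 * A132 * R23 = T23 * f * A)
    (h12 : f321 * A321 * R12 = T12 * f312 * A312) (h13 : f231 * A231 * R13 = T13 * f213 * A213)
    (hex : T123 = f312 * T13 * v132 * T23 * f) (hex' : T123 = f321 * T23 * v231 * T13 * f213)
    (hT : Commute T12 T123) : R12 * R13s * R23 = R23s * R13 * R12s := by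
  have h23' : A132 * R23 = v132 * T23 * f * A := by
    calc A132 * R23 = v132 * f132 * (A132 * R23) := by rw [hv132, one_mul]
      _ = v132 * (f132 * A132 * R23) := by simp only [mul_assoc]
      _ = v132 * T23 * f * A := by rw [h23]; simp only [mul_assoc]
  have h13' : A231 * R13 = v231 * T13 * f213 * A213 := by
    calc A231 * R13 = v231 * f231 * (A231 * R13) := by rw [hv231, one_mul]
      _ = v231 * (f231 * A231 * R13) := by simp only [mul_assoc]
      _ = v231 * T13 * f213 * A213 := by rw [h13]; simp only [mul_assoc]
  refine (hf.mul hA).mul_left_cancel ?_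
  calc f321 * A321 * (R12 * R13s * R23) = f321 * A321 * R12 * R13s * R23 := by
        simp only [mul_assoc]
    _ = T12 * f312 * (A312 * R13s) * R23 := by rw [h12]; simp only [mul_assoc]
    _ = T12 * f312 * T13 * (A132 * R23) := by rw [h13s]; simp only [mul_assoc]
    _ = T12 * (f312 * T13 * v132 * T23 * f) * A := by rw [h23']; simp only [mul_assoc]
    -- Here the first hexagon expression is collapsed to `T123`, moved past `T12`, and expanded
    -- again by the one with slots 1 and 2 exchanged.
    _ = f321 * T23 * v231 * T13 * f213 * (T12 * A) := by
        rw [← hex, hT.eq, hex']; simp only [mul_assoc]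
    _ = f321 * T23 * (v231 * T13 * f213 * A213) * R12s := by rw [← h12s]; simp only [mul_assoc]
    _ = f321 * (T23 * A231) * R13 * R12s := by rw [← h13']; simp only [mul_assoc]
    _ = f321 * A321 * (R23s * R13 * R12s) := by rw [← h23s]; simp only [mul_assoc]

/-! ### Commutation, first order and the shift in the ring of star-series -/

namespace StarSeries

section

variable {n : ℕ} {H : Type*} [LieRing H] [LieAlgebra ℂ H] {e : Module.Basis (Fin n) ℂ H}
  {W : Type*} [Ring W] [Algebra ℂ W] {W' : Type*} [Ring W'] [Algebra ℂ W']

theorem commute_const_leg {C : PowerSeries W'} {ψ : W →ₐ[ℂ] W'}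
    (hC : ∀ N X, Commute (PowerSeries.coeff N C) (ψ X)) (F : StarSeries e W) :
    Commute (const e C) (leg ψ F) := by
  have h : ∀ N (X : MerVal n W),
      (1 : Mer n) ⊗ₜ[ℂ] PowerSeries.coeff N C * onValues n ψ X =
        onValues n ψ X * (1 : Mer n) ⊗ₜ[ℂ] PowerSeries.coeff N C := fun N X => by
    induction X using TensorProduct.induction_on with
    | zero => simp
    | add X Y hX hY => rw [map_add, mul_add, add_mul, hX, hY]
    | tmul f w =>
      simp [onValues, Algebra.TensorProduct.tmul_mul_tmul, (hC N w).eq]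
  refine ext fun N => ?_
  rw [coeff_mul, coeff_mul]
  refine Finset.sum_congr rfl fun a _ => ?_
  rw [← Finset.Nat.sum_antidiagonal_swap]
  refine Finset.sum_congr rfl fun b _ => ?_
  rw [coeff_const, coeff_const, coeff_leg, coeff_leg, starCoeffₗ_const_left,
    starCoeffₗ_const_right, h]
  rfl

/-- The order-one term of the star-product itself contributes nothing, since it vanishes on
constants. -/
theorem coeff_one_mul_of_coeff_zero {F G : StarSeries e W} (hF : coeff 0 F = 1) (hG : coeff 0 G = 1) :
    coeff 1 (F * G) = coeff 1 F + coeff 1 G := by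
  have h : starCoeffₗ e 1 (1 : MerVal n W) 1 = 0 := by
    rw [Algebra.TensorProduct.one_def, starCoeffₗ_const_left, if_neg one_ne_zero]
  rw [coeff_mul, Finset.Nat.antidiagonal_succ]
  simp [hF, hG, h, starCoeffₗ_zero, Finset.Nat.antidiagonal_succ, add_comm]

end

variable {L : Type*} [LieRing L] [LieAlgebra ℂ L] {h : LieSubalgebra ℂ L}
  {n : ℕ} {e : Module.Basis (Fin n) ℂ h}

variable (e) in
/-- The shift `F ↦ F^{1,2}(λ + ħ h³)`. -/
def shift : StarSeries e (U2 L) →* StarSeries e (U3 L) where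
  toFun := DynTwist.shift e (t12 L) (s3 L)
  map_one' := by
    change DynTwist.shift e (t12 L) (s3 L) (1 : PowerSeries (MerVal n (U2 L))) =
      (1 : PowerSeries (MerVal n (U3 L)))
    rw [← DynTwist.const_one, DynTwist.shift_const, map_one, DynTwist.const_one]
  map_mul' := shift_star e commute_t12_s3

theorem shift_const (F : PowerSeries (U2 L)) :
    shift e (const e F) = const e (onSeries (t12 L) F) := DynTwist.shift_const e F

theorem leg_shift_of (ψ : U3 L →ₐ[ℂ] U3 L) (F : PowerSeries (MerVal n (U2 L))) :
    leg ψ (shift e (of e F)) = of e (DynTwist.shift e (ψ.comp (t12 L)) (ψ.comp (s3 L)) F) :=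
  DynTwist.leg_shift e _ _ ψ F

theorem leg_p213_shift (F : StarSeries e (U2 L)) :
    leg (p213 L) (shift e F) = shift e (leg (t21 L) F) := by
  have (F : PowerSeries (MerVal n (U2 L))) :
      DynTwist.leg (p213 L) (DynTwist.shift e (t12 L) (s3 L) F) =
        DynTwist.shift e (t12 L) (s3 L) (DynTwist.leg (t21 L) F) := by
    rw [leg_shift, p213_comp_t12, p213_comp_s3, shift_leg]
  exact this F

end StarSeries

/-! ### From the twist to the `R`-matrix -/

section Main

variable {L : Type*} [LieRing L] [LieAlgebra ℂ L] {h : LieSubalgebra ℂ L}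
  {n : ℕ} {e : Module.Basis (Fin n) ℂ h}

open StarSeries (of)

/-- Exchanging slots 1 and 2 fixes `J^{12,3}` and turns the shifted `J` into the shifted `J^{2,1}`,
which cancels against its inverse `k`; then `𝓡^{1,2}` passes through `J^{12,3}`. -/
theorem shift_twisted {j k : StarSeries e (U2 L)} {R : PowerSeries (U2 L)}
    (hR : ∀ u N, Commute (comul L u) (PowerSeries.coeff N R))
    (hk : StarSeries.leg (t21 L) j * k = 1) :
    StarSeries.leg (p213 L) (StarSeries.leg (t12_3 L) j * StarSeries.shift e j) *
        StarSeries.shift e (k * StarSeries.const e R * j) =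
      StarSeries.const e (onSeries (t12 L) R) *
        (StarSeries.leg (t12_3 L) j * StarSeries.shift e j) := by
  have hc : Commute (StarSeries.const e (onSeries (t12 L) R)) (StarSeries.leg (t12_3 L) j) :=
    StarSeries.commute_const_leg (fun N X => by
      rw [onSeries, PowerSeries.coeff_map]
      exact commute_t12_t12_3 (fun u => hR u N) X) j
  rw [map_mul, StarSeries.leg_p213_shift, StarSeries.leg_leg, p213_comp_t12_3, mul_assoc, ← map_mul,
    ← mul_assoc, ← mul_assoc, hk, one_mul, map_mul, StarSeries.shift_const, ← mul_assoc, ← mul_assoc,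
    hc.eq]

/-- The same cancellation with slots 2 and 3, on the other side of the twist equation and with no
shift. -/
theorem leg_t23_twisted {j k : StarSeries e (U2 L)} {R : PowerSeries (U2 L)}
    (hR : ∀ u N, Commute (comul L u) (PowerSeries.coeff N R))
    (hk : StarSeries.leg (t21 L) j * k = 1) :
    StarSeries.leg (p132 L) (StarSeries.leg (t1_23 L) j * StarSeries.leg (t23 L) j) *
        StarSeries.leg (t23 L) (k * StarSeries.const e R * j) =
      StarSeries.const e (onSeries (t23 L) R) *
        (StarSeries.leg (t1_23 L) j * StarSeries.leg (t23 L) j) := by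
  have hc : Commute (StarSeries.const e (onSeries (t23 L) R)) (StarSeries.leg (t1_23 L) j) :=
    StarSeries.commute_const_leg (fun N X => by
      rw [onSeries, PowerSeries.coeff_map]
      exact commute_t23_t1_23 (fun u => hR u N) X) j
  rw [map_mul, StarSeries.leg_leg, StarSeries.leg_leg, p132_comp_t1_23, p132_comp_t23,
    ← StarSeries.leg_leg, mul_assoc, ← map_mul, ← mul_assoc, ← mul_assoc, hk, one_mul, map_mul,
    StarSeries.leg_const, ← mul_assoc, ← mul_assoc, hc.eq]

theorem onSeries_onSeries {A B C : Type*} [Ring A] [Algebra ℂ A] [Ring B] [Algebra ℂ B] [Ring C]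
    [Algebra ℂ C] (ψ : B →ₐ[ℂ] C) (φ : A →ₐ[ℂ] B) (F : PowerSeries A) :
    onSeries ψ (onSeries φ F) = onSeries (ψ.comp φ) F := by
  ext N
  simp [onSeries]

theorem qdybe_of_twist {Φ : PowerSeries (U3 L)} {R : PowerSeries (U2 L)}
    {J K : PowerSeries (MerVal n (U2 L))} (hΦ : PowerSeries.coeff 0 Φ = 1)
    (hex : onSeries (t12_3 L) R = onSeries (p312 L) Φ * onSeries (t13 L) R *
      Ring.inverse (onSeries (p132 L) Φ) * onSeries (t23 L) R * Φ)
    (hR : ∀ u N, Commute (comul L u) (PowerSeries.coeff N R))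
    (hJ : PowerSeries.coeff 0 J = 1)
    (twist : star e (leg (t12_3 L) J) (shift e (t12 L) (s3 L) J) =
      const n (Ring.inverse Φ) * star e (leg (t1_23 L) J) (leg (t23 L) J))
    (hK : star e (leg (t21 L) J) K = 1) {Q : PowerSeries (MerVal n (U2 L))}
    (hQ : Q = star e (star e K (const n R)) J) :
    star e (star e (leg (t12 L) Q) (shift e (t13 L) (s2 L) Q)) (leg (t23 L) Q) =
      star e (star e (shift e (t23 L) (s1 L) Q) (leg (t13 L) Q)) (shift e (t12 L) (s3 L) Q) := by
  refine StarSeries.of_injective (e := e) ?_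
  have hQ' : of e Q = of e K * StarSeries.const e R * of e J := congrArg (of e) hQ
  have hK' : StarSeries.leg (t21 L) (of e J) * of e K = 1 := hK
  set j := of e J
  set k := of e K
  set q := of e Q with hq
  have hΦu : IsUnit Φ := PowerSeries.isUnit_iff_constantCoeff.2 (by
    rw [← PowerSeries.coeff_zero_eq_constantCoeff_apply, hΦ]; exact isUnit_one)
  set A : StarSeries e (U3 L) := StarSeries.leg (t12_3 L) j * StarSeries.shift e j with hA
  have hA' : StarSeries.const e Φ * A = StarSeries.leg (t1_23 L) j * StarSeries.leg (t23 L) j := by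
    have : A = StarSeries.const e (Ring.inverse Φ) *
        (StarSeries.leg (t1_23 L) j * StarSeries.leg (t23 L) j) :=
      (congrArg (of e) twist).trans (StarSeries.of_const_mul _ _)
    rw [this, ← mul_assoc, ← map_mul, Ring.mul_inverse_cancel _ hΦu, map_one, one_mul]
  have hju : IsUnit j := StarSeries.isUnit_of_coeff_zero hJ
  have hAu : IsUnit A :=
    (hju.map (StarSeries.leg (t12_3 L))).mul (hju.map (StarSeries.shift e))
  have h12s : StarSeries.leg (p213 L) A * StarSeries.shift e q =
      StarSeries.const e (onSeries (t12 L) R) * A := by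
    rw [hQ']
    exact shift_twisted hR hK'
  have h23 : StarSeries.const e (onSeries (p132 L) Φ) * StarSeries.leg (p132 L) A *
      StarSeries.leg (t23 L) q =
      StarSeries.const e (onSeries (t23 L) R) * StarSeries.const e Φ * A := by
    rw [← StarSeries.leg_const, ← map_mul, mul_assoc _ _ A, hA', hQ']
    exact leg_t23_twisted hR hK'
  have hshift : ∀ (ψ : U3 L →ₐ[ℂ] U3 L), StarSeries.leg ψ (StarSeries.shift e q) =
      of e (shift e (ψ.comp (t12 L)) (ψ.comp (s3 L)) Q) := fun ψ => StarSeries.leg_shift_of ψ Q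
  have hleg : ∀ (φ : U2 L →ₐ[ℂ] U3 L), StarSeries.leg φ q = of e (leg φ Q) := fun φ => rfl
  -- All six factors of the Yang-Baxter equation are covered by `h12s`, `h23` and two slot
  -- permutations of each.
  have h13s := congrArg (StarSeries.leg (p132 L)) h12s
  have h23s := congrArg (StarSeries.leg (p231 L)) h12s
  have h12 := congrArg (StarSeries.leg (p312 L)) h23
  have h13 := congrArg (StarSeries.leg (p213 L)) h23
  -- By cocommutativity the exchange fixes `𝓡^{12,3}`, so the hexagon yields a second expression for
  -- it.
  have hex' := congrArg (onSeries (p213 L)) hex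
  have hv : ∀ ψ : U3 L →ₐ[ℂ] U3 L, StarSeries.const e (Ring.inverse (onSeries ψ Φ)) *
      StarSeries.const e (onSeries ψ Φ) = 1 := fun ψ => by
    rw [← map_mul, Ring.inverse_mul_cancel _ (hΦu.map (onSeries ψ)), map_one]
  simp only [map_mul, StarSeries.leg_leg, StarSeries.leg_const, onSeries_onSeries,
    map_ringInverse _ (hΦu.map (onSeries (p132 L))), hshift,
    p132_comp_t12, p132_comp_s3, p231_comp_t12, p231_comp_s3, p231_comp_p213, p312_comp_t23,
    p312_comp_p132, p213_comp_t23, p213_comp_t13, p213_comp_p312, p213_comp_t12_3,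
    p132_comp_p213, p213_comp_p132] at h13s h23s h12 h13 hex'
  rw [hleg] at h23 h12 h13
  have hT : Commute (StarSeries.const e (onSeries (t12 L) R))
      (StarSeries.const e (onSeries (t12_3 L) R)) := by
    rw [← StarSeries.leg_const (t12_3 L)]
    exact StarSeries.commute_const_leg (fun N X => by
      rw [onSeries, PowerSeries.coeff_map]
      exact commute_t12_t12_3 (fun u => hR u N) X) _
  rw [StarSeries.of_star, StarSeries.of_star, StarSeries.of_star, StarSeries.of_star]
  have hexA := congrArg (StarSeries.const e) hex
  have hexB := congrArg (StarSeries.const e) hex'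
  simp only [map_mul] at hexA hexB
  exact yangBaxter_of_twist_hexagon (hAu.map (StarSeries.leg (p321 L)))
    ((hΦu.map (onSeries (p321 L))).map (StarSeries.const e)) (hv (p132 L)) (hv (p231 L))
    h12s h13s h23s h23 h12 h13 hexA hexB hT

theorem commute_coeff_expSeries {t : L ⊗[ℂ] L} (ht : ∀ x : L, ⁅x, t⁆ = 0) (c : ℂ) (u : U L) (N : ℕ) :
    Commute (comul L u) (PowerSeries.coeff N (expSeries (c • inc2 t))) := by
  rw [expSeries, PowerSeries.coeff_mk]
  exact (((commute_comul_inc2 ht u).smul_right c).pow_right N).smul_right _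

/-- All constant terms are `1`, so first-order coefficients add up: `K` contributes `-j^{2,1}`, `𝓡`
contributes `t/2` and `J` contributes `j`. For invariance, each of the three factors commutes with
every `momentum e x`. -/
theorem isQuantumRMatrix_of_twist {Φ : PowerSeries (U3 L)} {t : L ⊗[ℂ] L} {r : MerVal n (L ⊗[ℂ] L)}
    {J K : PowerSeries (MerVal n (U2 L))} (ht : ∀ x : L, ⁅x, t⁆ = 0)
    (hΦ : PowerSeries.coeff 0 Φ = 1) (hex : Hexagon Φ (expSeries ((1 / 2 : ℂ) • inc2 t)))
    (hJ : IsDynamicalTwist e Φ J)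
    (limit : incVal (r - (1 : Mer n) ⊗ₜ[ℂ] ((1 / 2 : ℂ) • t)) =
      PowerSeries.coeff 1 J - onValues n (t21 L) (PowerSeries.coeff 1 J))
    (hK : IsStarInverse e (leg (t21 L) J) K) :
    IsQuantumRMatrix e
      (star e (star e K (const n (expSeries ((1 / 2 : ℂ) • inc2 t)))) J) r := by
  have hR := commute_coeff_expSeries ht (1 / 2 : ℂ)
  set R := expSeries ((1 / 2 : ℂ) • inc2 t) with hRdef
  have hJ₀ : StarSeries.coeff 0 (of e J) = 1 := hJ.coeff_zero
  have hJ' : StarSeries.coeff 0 (of e (leg (t21 L) J)) = 1 := by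
    rw [StarSeries.of_leg, StarSeries.coeff_leg, hJ₀]
    exact map_one (onValues n (t21 L))
  have hK₁ : of e (leg (t21 L) J) * of e K = 1 := hK.1
  have hK₂ : of e K * of e (leg (t21 L) J) = 1 := hK.2
  have hK₀ : StarSeries.coeff 0 (of e K) = 1 := by
    have := congrArg (StarSeries.coeff 0) hK₁
    rwa [StarSeries.coeff_zero_mul, hJ', one_mul, StarSeries.coeff_one, if_pos rfl] at this
  have hR₀ : StarSeries.coeff 0 (StarSeries.const e R) = 1 := by
    rw [StarSeries.coeff_const, hRdef, expSeries, PowerSeries.coeff_mk]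
    simp [Algebra.TensorProduct.one_def]
  have hR₁ : StarSeries.coeff 1 (StarSeries.const e R) =
      (1 : Mer n) ⊗ₜ[ℂ] ((1 / 2 : ℂ) • inc2 t) := by
    rw [StarSeries.coeff_const, hRdef, expSeries, PowerSeries.coeff_mk]
    simp
  have hKR₀ : StarSeries.coeff 0 (of e K * StarSeries.const e R) = 1 := by
    rw [StarSeries.coeff_zero_mul, hK₀, hR₀, one_mul]
  refine ⟨?_, ?_, ?_, ?_⟩
  · change StarSeries.coeff 0 (of e K * StarSeries.const e R * of e J) = 1
    rw [StarSeries.coeff_zero_mul, hKR₀, hJ₀, one_mul]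
  · change StarSeries.coeff 1 (of e K * StarSeries.const e R * of e J) = incVal r
    have h₁ := congrArg (StarSeries.coeff 1) hK₁
    rw [StarSeries.coeff_one_mul_of_coeff_zero hJ' hK₀, StarSeries.coeff_one, if_neg one_ne_zero,
      StarSeries.of_leg, StarSeries.coeff_leg] at h₁
    rw [StarSeries.coeff_one_mul_of_coeff_zero hKR₀ hJ₀,
      StarSeries.coeff_one_mul_of_coeff_zero hK₀ hR₀, hR₁]
    have h₂ : incVal (r - (1 : Mer n) ⊗ₜ[ℂ] ((1 / 2 : ℂ) • t)) +
        (1 : Mer n) ⊗ₜ[ℂ] ((1 / 2 : ℂ) • inc2 t) = incVal r := by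
      rw [incVal, map_sub, LinearMap.lTensor_tmul, map_smul]
      exact sub_add_cancel _ _
    rw [← h₂, limit]
    have key : ∀ {A : Type _} [AddCommGroup A] (a b c d : A), b + c = 0 →
        c + d + a = a - b + d := by
      intro A _ a b c d h
      rw [eq_neg_of_add_eq_zero_right h]
      abel
    exact key (A := MerVal n (U2 L)) _ _ _ _ h₁
  · rw [isInvariant_iff]
    intro x
    have hj := (isInvariant_iff e J).1 hJ.invariant x
    have hr := (isInvariant_iff e _).1 (isInvariant_const e hR) x
    have hj' := (isInvariant_iff e _).1 (isInvariant_leg_t21 e hJ.invariant) x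
    -- `K` is the inverse of the invariant series `J^{2,1}`, so it has the same commutation
    -- property.
    have hk : Commute (momentum e x) (of e K) :=
      Commute.units_inv_right (u := ⟨of e (leg (t21 L) J), of e K, hK₁, hK₂⟩) hj'
    exact (hk.mul_right hr).mul_right hj
  · exact qdybe_of_twist hΦ hex.left hR hJ.coeff_zero hJ.twist hK.1 rfl

theorem exists_isStarInverse {F : PowerSeries (MerVal n (U2 L))} (hF : PowerSeries.coeff 0 F = 1) :
    ∃ K, IsStarInverse e F K := by
  obtain ⟨u, hu⟩ := StarSeries.isUnit_of_coeff_zero (F := of e F) hF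
  have h₁ : of e F * ((u⁻¹ : (StarSeries e (U2 L))ˣ) : StarSeries e (U2 L)) = 1 := by
    rw [← hu, u.mul_inv]
  have h₂ : ((u⁻¹ : (StarSeries e (U2 L))ˣ) : StarSeries e (U2 L)) * of e F = 1 := by
    rw [← hu, u.inv_mul]
  exact ⟨_, h₁, h₂⟩

end Main

end DynTwist

end

theorem theorem4p2 {L : Type*} [LieRing L] [LieAlgebra ℂ L] [FiniteDimensional ℂ L]
    (h : LieSubalgebra ℂ L) {n : ℕ} (e : Module.Basis (Fin n) ℂ h)
    (t : L ⊗[ℂ] L) (ht : DynTwist.IsInvariantSymmetric t)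
    (Z : DynTwist.U3 L)
    (hZ : Z = (1 / 4 : ℂ) • (DynTwist.t12 L (DynTwist.inc2 t) * DynTwist.t23 L (DynTwist.inc2 t) -
      DynTwist.t23 L (DynTwist.inc2 t) * DynTwist.t12 L (DynTwist.inc2 t)))
    (Φ : PowerSeries (DynTwist.U3 L)) (hΦ : DynTwist.IsAssociator Φ Z)
    (hex : DynTwist.Hexagon Φ (DynTwist.expSeries ((1 / 2 : ℂ) • DynTwist.inc2 t)))
    (r : DynTwist.MerVal n (L ⊗[ℂ] L)) (hr : DynTwist.IsClassicalRMatrix e t r)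
    (J : PowerSeries (DynTwist.MerVal n (DynTwist.U2 L)))
    (hJ : DynTwist.IsTwistQuantization e Φ J Z
      (r - (1 : DynTwist.Mer n) ⊗ₜ[ℂ] ((1 / 2 : ℂ) • t))) :
    (∃ K, DynTwist.IsStarInverse e (DynTwist.leg (DynTwist.t21 L) J) K) ∧
    ∀ K, DynTwist.IsStarInverse e (DynTwist.leg (DynTwist.t21 L) J) K →
      DynTwist.IsQuantumRMatrix e
        (DynTwist.star e
          (DynTwist.star e K
            (DynTwist.const n (DynTwist.expSeries ((1 / 2 : ℂ) • DynTwist.inc2 t))))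
          J) r := by
  refine ⟨DynTwist.exists_isStarInverse ?_, fun K hK =>
    DynTwist.isQuantumRMatrix_of_twist ht.2 hΦ.coeff_zero hex hJ.twist hJ.limit hK⟩
  rw [DynTwist.coeff_leg, hJ.twist.coeff_zero]
  exact map_one (DynTwist.onValues n (DynTwist.t21 L))
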